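/- Let $G$ be a finite simple undirected graph with $n$ vertices and $m$ edges, $s\in V(G)$, $C\subseteq V(G)\setminus\{s\}$ and $k\ge 0$. A fire breaks out at $s$ at time step $0$. A $k$-step strategy is a map $\mathfrak h:\{1,\dots,k\}\to V(G)$: at time step $2i-1$ the vertex $\mathfrak h(i)$ becomes permanently protected, and at every even time step $2,4,6,\dots$ every unprotected neighbour of a burning vertex starts to burn. The strategy is *valid* if for every $i$ the vertex $\mathfrak h(i)$ is not burning at time step $2i-1$, and the fire cannot spread any more after time step $2k$. It *saves* $C$ if it is valid and $S=\{\mathfrak h(1),\dots,\mathfrak h(k)\}$ is an $s$–$C$ separator, i.e. $S\cap(\{s\}\cup C)=\emptyset$ and no vertex of $C$ is reachable from $s$ in $G\setminus S$. *Saving A Critical Set* (SACS) asks, given $(G,s,C,k)$, whether some $k$-step strategy saves $C$; the parameter is the number $k$ of firefighters. The model of computation is a deterministic random access machine with unit-cost instructions (constants, addition, truncated subtraction, comparison, indirect addressing; no multiplication). The input consists of $n$, $m$, $s$, $|C|$, $k$, the list of the edges in any order and orientation, and the list of the vertices of $C$ in any order. **Theorem.** SACS, parameterized by $k$, is fixed-parameter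 tractable: a single program decides all instances within $g(k)\cdot(n+m)^{O(1)}$ steps for some computable function $g$. Moreover, it has an algorithm with running time $f(k)\cdot O(nm^2)$, where $f(k)=k^{O(k^3)}$. Precisely, there are a program and constants $c,A\in\mathbb N$ such that every instance is decided within $k^{ck^3}\cdot A\,n(m+1)^2$ steps (with $0^0=1$). (For $m\ge1$ we have $n(m+1)^2\le 4nm^2$; the summand $1$ only matters for graphs without edges.) Both assertions also hold for the variant of the problem in which a strategy need not satisfy the condition that the fire cannot spread any more after time step $2k$, all other requirements being unchanged. -/

import Mathlib

namespace Firefighter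

/-! ### The firefighting game -/

section Game

variable {V : Type*}

/-- The vertices protected during the first `i` rounds. The strategy is indexed from `0`: the
firefighter `h j` is placed at time step `2 * j + 1`, that is, in round `j + 1`. -/
def protectedUpTo {k : ℕ} (h : Fin k → V) (i : ℕ) : Set V :=
  {v | ∃ j : Fin k, (j : ℕ) < i ∧ h j = v}

/-- The vertices that are burning after `i` rounds, i.e. at the time steps `2 * i` and
`2 * i + 1`. In every round one firefighter is placed (while the strategy lasts), and then the
fire spreads to all unprotected neighbours of burning vertices. -/
def burning (G : SimpleGraph V) (s : V) {k : ℕ} (h : Fin k → V) : ℕ → Set V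
  | 0 => {s}
  | i + 1 => burning G s h i ∪
      {v | v ∉ protectedUpTo h (i + 1) ∧ ∃ u ∈ burning G s h i, G.Adj u v}

/-- No firefighter is ever placed on a vertex that is burning at that time. -/
def IsPlayable (G : SimpleGraph V) (s : V) {k : ℕ} (h : Fin k → V) : Prop :=
  ∀ j : Fin k, h j ∉ burning G s h j

/-- A valid `k`-step strategy: it is playable, and the fire cannot spread any more after
time step `2 * k`. -/
def IsValid (G : SimpleGraph V) (s : V) {k : ℕ} (h : Fin k → V) : Prop :=
  IsPlayable G s h ∧ ∀ i, k ≤ i → burning G s h i = burning G s h k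

/-- The set of vertices reachable from `X` in the graph `G` without the vertices of `S`. -/
def reachableSet (G : SimpleGraph V) (X S : Set V) : Set V :=
  {v | ∃ x ∈ X, ∃ p : G.Walk x v, ∀ w ∈ p.support, w ∉ S}

/-- `S` is an `X`-`Y` separator; it contains no vertex of `X` or `Y`. -/
def IsSeparator (G : SimpleGraph V) (X Y S : Set V) : Prop :=
  S ⊆ (X ∪ Y)ᶜ ∧ reachableSet G X S ∩ Y = ∅

end Game

/-! ### The problem -/

/-- An instance `(G, s, C, k)`. -/
structure Instance where
  n : ℕ
  G : SimpleGraph (Fin n)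
  s : Fin n
  C : Finset (Fin n)
  s_notMem : s ∉ C
  k : ℕ

/-- The number of edges. -/
noncomputable def Instance.m (I : Instance) : ℕ := I.G.edgeSet.ncard

/-- Saving A Critical Set: some valid `k`-step strategy saves `C`. -/
def SACS (I : Instance) : Prop :=
  ∃ h : Fin I.k → Fin I.n, IsValid I.G I.s h ∧ IsSeparator I.G {I.s} (I.C : Set (Fin I.n)) (Set.range h)

/-- The variant in which the fire may go on burning, away from `C`, after time step `2 * k`. -/
def SACSUntimed (I : Instance) : Prop :=
  ∃ h : Fin I.k → Fin I.n, IsPlayable I.G I.s h ∧ IsSeparator I.G {I.s} (I.C : Set (Fin I.n)) (Set.range h)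

/-! ### Random access machines with unit cost -/

/-- Registers, and one-dimensional arrays that are addressed indirectly. A program names only
finitely many of both. -/
structure State where
  reg : ℕ → ℕ
  arr : ℕ → ℕ → ℕ

/-- `reg x := v` -/
def State.setReg (σ : State) (x v : ℕ) : State :=
  { σ with reg := Function.update σ.reg x v }

/-- `arr a [i] := v` -/
def State.setArr (σ : State) (a i v : ℕ) : State :=
  { σ with arr := Function.update σ.arr a (Function.update (σ.arr a) i v) }

/-- Programs of the random access machine. There is no multiplication. -/
inductive Prog where
  | skip
  | const (x c : ℕ)
  | add (x y z : ℕ)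
  | sub (x y z : ℕ)
  | load (x a y : ℕ)
  | store (a x y : ℕ)
  | seq (p q : Prog)
  | ifLt (x y : ℕ) (p q : Prog)
  | whileLt (x y : ℕ) (p : Prog)

/-- `Exec p σ τ t`: started in the state `σ`, the program `p` halts in the state `τ` after exactly
`t` steps. Every basic instruction and every evaluation of a test is one step. -/
inductive Exec : Prog → State → State → ℕ → Prop where
  | skip (σ : State) : Exec .skip σ σ 1
  | const (σ : State) (x c : ℕ) : Exec (.const x c) σ (σ.setReg x c) 1
  | add (σ : State) (x y z : ℕ) : Exec (.add x y z) σ (σ.setReg x (σ.reg y + σ.reg z)) 1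
  | sub (σ : State) (x y z : ℕ) : Exec (.sub x y z) σ (σ.setReg x (σ.reg y - σ.reg z)) 1
  | load (σ : State) (x a y : ℕ) : Exec (.load x a y) σ (σ.setReg x (σ.arr a (σ.reg y))) 1
  | store (σ : State) (a x y : ℕ) : Exec (.store a x y) σ (σ.setArr a (σ.reg x) (σ.reg y)) 1
  | seq {p q : Prog} {σ τ υ : State} {t u : ℕ} :
      Exec p σ τ t → Exec q τ υ u → Exec (.seq p q) σ υ (t + u)
  | if_true {x y : ℕ} {p q : Prog} {σ τ : State} {t : ℕ} :
      σ.reg x < σ.reg y → Exec p σ τ t → Exec (.ifLt x y p q) σ τ (t + 1)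
  | if_false {x y : ℕ} {p q : Prog} {σ τ : State} {t : ℕ} :
      ¬ σ.reg x < σ.reg y → Exec q σ τ t → Exec (.ifLt x y p q) σ τ (t + 1)
  | while_true {x y : ℕ} {p : Prog} {σ τ υ : State} {t u : ℕ} :
      σ.reg x < σ.reg y → Exec p σ τ t → Exec (.whileLt x y p) τ υ u →
      Exec (.whileLt x y p) σ υ (t + u + 1)
  | while_false {x y : ℕ} {p : Prog} {σ : State} :
      ¬ σ.reg x < σ.reg y → Exec (.whileLt x y p) σ σ 1

/-- A presentation of an instance as input data: a list of the edges, each of them exactly once and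
written as a pair in one of the two orders, and a list of the vertices of `C`. -/
structure Encoding (I : Instance) where
  edges : List (Fin I.n × Fin I.n)
  edges_nodup : (edges.map fun e => s(e.1, e.2)).Nodup
  mem_edges : ∀ x : Sym2 (Fin I.n), x ∈ (edges.map fun e => s(e.1, e.2)) ↔ x ∈ I.G.edgeSet
  crit : List (Fin I.n)
  crit_nodup : crit.Nodup
  mem_crit : ∀ v, v ∈ crit ↔ v ∈ I.C

/-- The initial state. The registers `0, …, 4` hold `n`, `m`, `s`, `|C|`, `k`; the arrays `0` and `1`
hold the first and the second end points of the edges, and the array `2` holds the vertices of `C`.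
Everything else is `0`. -/
def Encoding.init {I : Instance} (E : Encoding I) : State where
  reg x := [I.n, E.edges.length, (I.s : ℕ), E.crit.length, I.k].getD x 0
  arr a i :=
    match a with
    | 0 => (E.edges.map fun e => (e.1 : ℕ)).getD i 0
    | 1 => (E.edges.map fun e => (e.2 : ℕ)).getD i 0
    | 2 => (E.crit.map fun v => (v : ℕ)).getD i 0
    | _ => 0

/-- The program `p` decides the problem `P`, with at most `T I` steps on the instance `I`, whatever
the order in which the input is listed. The answer is left in register `0`. -/
def DecidesWithin (p : Prog) (P : Instance → Prop) (T : Instance → ℕ) : Prop :=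
  ∀ (I : Instance) (E : Encoding I), ∃ (τ : State) (t : ℕ),
    Exec p E.init τ t ∧ t ≤ T I ∧ (P I → τ.reg 0 = 1) ∧ (¬ P I → τ.reg 0 = 0)

/-- Fixed-parameter tractability with respect to the parameter `k`. -/
def IsFPT (P : Instance → Prop) : Prop :=
  ∃ (p : Prog) (f : ℕ → ℕ) (d : ℕ), Computable f ∧
    DecidesWithin p P (fun I => f I.k * (I.n + I.m) ^ d)

end Firefighter

set_option linter.unusedSimpArgs false

/-! Timing is separated from spreading. In a playable strategy no vertex of the range ever burns, so
the fire spreads as if the whole range were protected from the start (`IsPlayable.burning_eq`).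
Playability then says that every vertex of the range has a position before the round in which the
fire touches it (`isPlayable_iff_onTime`).

The algorithm is a bounded search tree over partial strategies, in which some positions are filled
and the others are free. For a partial strategy the fire is followed for `k + 1` rounds by breadth
first search, with only the placed vertices protected. Further protection can delay the fire at a
vertex only by protecting one of its ancestors in the search tree (`IsFire.exists_anc`). So if a
critical vertex is touched, or a placed vertex is touched too early, every solution extending the
partial strategy places a new vertex on the tree path to it. There are at most `k + 2` such vertices
and `k` positions, and one branches over all pairs.

Suppose that nothing is bad. If the fire has to cease, then either it has ceased after round `k` and
the partial strategy can be completed, or a vertex first touched in round `k + 1` is a new target.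
Without that condition, vertices touched within `k` rounds are merged into a source, critical
vertices into a sink, and the remaining unprotected vertices are split. If the maximum flow is at
most the number of free positions, a minimum cut yields vertices that the fire does not touch within
`k` rounds, and these can be placed in any order (`exists_cut`, `exists_saves_of_partial`). If the
flow is larger, a solution has too few new vertices to interrupt it away from the fire. It must
therefore delay or protect the origin of one of the at most `k + 1` arcs on which the flow leaves
the source, and these origins become the targets (`exists_exit`).

A partial strategy thus has fewer than `(k + 2) ^ 3` children, each with one free position less, and
`(k + 2) ^ (3 * k)` rounds of a queue suffice. This is a potential argument (`Queue.succ`,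
`Queue.correct`). At most `4 * m + 2` nodes of the network can be reached from the source, so one
search takes `O(m (n + m))` steps, and one partial strategy costs `O(k n (m + 1) ^ 2)`. The program
is verified with invariants for its loops (`Runs.loop`) and symbolic evaluation of the code between
them (`Runs.ev`). -/

namespace Firefighter

/-! ### The fire in terms of the final set of protected vertices -/

section Touch

variable {V : Type*} {G : SimpleGraph V} {s : V}

/-- The vertices that the fire has touched after `i` rounds, if the vertices of `S` never burn:
these are touched, but do not pass on the fire. -/
def touch (G : SimpleGraph V) (s : V) (S : Set V) : ℕ → Set V
  | 0 => {s}
  | i + 1 => touch G s S i ∪ {v | ∃ u ∈ touch G s S i, u ∉ S ∧ G.Adj u v}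

theorem touch_mono (S : Set V) : Monotone (touch G s S) :=
  monotone_nat_of_le_succ fun _ => Set.subset_union_left

theorem touch_anti {S S' : Set V} (h : S ⊆ S') (i : ℕ) : touch G s S' i ⊆ touch G s S i := by
  induction i with
  | zero => exact subset_rfl
  | succ i ih =>
    rintro v (hv | ⟨u, hu, huS, huv⟩)
    · exact Or.inl (ih hv)
    · exact Or.inr ⟨u, ih hu, fun h' => huS (h h'), huv⟩

theorem mem_touch_succ {S : Set V} {u v : V} {i : ℕ} (hu : u ∈ touch G s S i) (huS : u ∉ S)
    (huv : G.Adj u v) : v ∈ touch G s S (i + 1) :=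
  Or.inr ⟨u, hu, huS, huv⟩

/-- After one quiet round all later rounds start from the same burning vertices. Comparing the
rounds `k` and `k + 1` therefore decides whether the fire has ceased for good. -/
theorem touch_diff_subset_of_succ {S : Set V} {k : ℕ}
    (h : touch G s S (k + 1) \ S ⊆ touch G s S k) (i : ℕ) : touch G s S i \ S ⊆ touch G s S k := by
  induction i with
  | zero => exact fun v hv => touch_mono S (Nat.zero_le k) hv.1
  | succ i ih =>
    rintro v ⟨hv | ⟨u, hu, huS, huv⟩, hvS⟩
    · exact ih ⟨hv, hvS⟩
    · exact h ⟨mem_touch_succ (ih ⟨hu, huS⟩) huS huv, hvS⟩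

/-- Every protected vertex is protected, at least once, before the fire can reach it. -/
def OnTime (G : SimpleGraph V) (s : V) {k : ℕ} (h : Fin k → V) : Prop :=
  ∀ v ∈ Set.range h, ∃ j : Fin k, h j = v ∧ v ∉ touch G s (Set.range h) j

/-! ### Playability in terms of the times of first contact -/

variable {k : ℕ} {h : Fin k → V}

theorem burning_mono (G : SimpleGraph V) (s : V) (h : Fin k → V) : Monotone (burning G s h) :=
  monotone_nat_of_le_succ fun _ => Set.subset_union_left

theorem notMem_protectedUpTo_of_notMem_range {v : V} (hv : v ∉ Set.range h) (i : ℕ) :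
    v ∉ protectedUpTo h i := fun ⟨j, _, hj⟩ => hv ⟨j, hj⟩

/-- Up to the placement this is playability and monotonicity of the fire; from then on the vertex is
protected. -/
theorem IsPlayable.notMem_burning (hp : IsPlayable G s h) {v : V} (hv : v ∈ Set.range h) (i : ℕ) :
    v ∉ burning G s h i := by
  obtain ⟨j, rfl⟩ := hv
  induction i with
  | zero => exact fun h0 => hp j (burning_mono G s h (Nat.zero_le _) h0)
  | succ i ih =>
    rintro (hb | hb)
    · exact ih hb
    · rcases lt_or_ge (j : ℕ) (i + 1) with hj | hj
      · exact hb.1 ⟨j, hj, rfl⟩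
      · exact hp j (burning_mono G s h hj (Or.inr hb))

theorem burning_subset (i : ℕ) : touch G s (Set.range h) i \ Set.range h ⊆ burning G s h i := by
  induction i with
  | zero => exact fun v hv => hv.1
  | succ i ih =>
    rintro v ⟨hv | ⟨u, hu, huS, huv⟩, hvS⟩
    · exact Or.inl (ih ⟨hv, hvS⟩)
    · exact Or.inr ⟨notMem_protectedUpTo_of_notMem_range hvS _, u, ih ⟨hu, huS⟩, huv⟩

/-- The order of the placements disappears here: vertices that are protected later do not burn
earlier either, so they may count as protected from the beginning. -/
theorem IsPlayable.burning_eq (hp : IsPlayable G s h) (i : ℕ) :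
    burning G s h i = touch G s (Set.range h) i \ Set.range h := by
  refine subset_antisymm ?_ (burning_subset i)
  induction i with
  | zero => exact fun v hv => ⟨hv, fun h' => hp.notMem_burning h' 0 hv⟩
  | succ i ih =>
    intro v hv
    refine ⟨?_, fun h' => hp.notMem_burning h' _ hv⟩
    rcases hv with hv | ⟨-, u, hu, huv⟩
    · exact Or.inl (ih hv).1
    · exact mem_touch_succ (ih hu).1 (ih hu).2 huv

/-- A strategy may place a vertex repeatedly, and only its first placement counts. If the vertex
were touched before that placement, it would be unprotected and burn, so a later placement would be
illegal. Conversely, timely protection of every vertex of the range confines the fire to touched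
vertices outside the range. -/
theorem isPlayable_iff_onTime : IsPlayable G s h ↔ OnTime G s h := by
  constructor
  · intro hp v hv
    classical
    have hex : ∃ j : ℕ, ∃ hj : j < k, h ⟨j, hj⟩ = v := by
      obtain ⟨j, rfl⟩ := hv
      exact ⟨j, j.2, rfl⟩
    obtain ⟨hj, hjv⟩ := Nat.find_spec hex
    have hmin : ∀ i < Nat.find hex, ¬ ∃ hi : i < k, h ⟨i, hi⟩ = v := fun i hi => Nat.find_min hex hi
    refine ⟨⟨_, hj⟩, hjv, ?_⟩
    have key : ∀ i ≤ Nat.find hex, v ∉ touch G s (Set.range h) i := by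
      intro i
      induction i with
      | zero =>
        intro _ h0
        exact hp.notMem_burning hv 0 h0
      | succ i ih =>
        rintro hi (h1 | ⟨u, hu, huS, huv⟩)
        · exact ih (by omega) h1
        · refine hp.notMem_burning hv (i + 1) (Or.inr ⟨?_, u, burning_subset i ⟨hu, huS⟩, huv⟩)
          rintro ⟨j, hji, hjv'⟩
          exact hmin j (by omega) ⟨j.2, hjv'⟩
    exact key _ le_rfl
  · intro ho
    have key : ∀ i, burning G s h i ⊆ touch G s (Set.range h) i \ Set.range h := by
      intro i
      induction i with
      | zero =>
        refine fun v hv => ⟨hv, fun h' => ?_⟩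
        obtain ⟨j, -, hj⟩ := ho v h'
        exact hj (touch_mono _ (Nat.zero_le _) hv)
      | succ i ih =>
        rintro v (hv | ⟨hvp, u, hu, huv⟩)
        · exact ⟨Or.inl (ih hv).1, (ih hv).2⟩
        · have hv : v ∈ touch G s (Set.range h) (i + 1) := mem_touch_succ (ih hu).1 (ih hu).2 huv
          refine ⟨hv, fun h' => ?_⟩
          obtain ⟨j, hjv, hj⟩ := ho v h'
          rcases lt_or_ge (j : ℕ) (i + 1) with hji | hji
          · exact hvp ⟨j, hji, hjv⟩
          · exact hj (touch_mono _ hji hv)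
    exact fun j hj => (key _ hj).2 ⟨j, rfl⟩

theorem mem_reachableSet_iff {S : Set V} (hs : s ∉ S) {v : V} :
    v ∈ reachableSet G {s} S ↔ ∃ i, v ∈ touch G s S i \ S := by
  constructor
  · rintro ⟨x, rfl, p, hp⟩
    have key : ∀ {a b : V} (p : G.Walk a b), (∀ w ∈ p.support, w ∉ S) →
        (∃ i, a ∈ touch G x S i \ S) → ∃ i, b ∈ touch G x S i \ S := by
      intro a b p
      induction p with
      | nil => exact fun _ h => h
      | cons hab p ih =>
        rintro hp ⟨i, hi⟩
        refine ih (fun w hw => hp w (by simp [hw])) ⟨i + 1, mem_touch_succ hi.1 hi.2 hab, ?_⟩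
        exact hp _ (by simp)
    exact key p hp ⟨0, rfl, hs⟩
  · rintro ⟨i, hi, hvS⟩
    refine ⟨s, rfl, ?_⟩
    induction i generalizing v with
    | zero =>
      obtain rfl : v = s := hi
      exact ⟨.nil, by simpa using hvS⟩
    | succ i ih =>
      rcases hi with hi | ⟨u, hu, huS, huv⟩
      · exact ih hi hvS
      · obtain ⟨p, hp⟩ := ih hu huS
        refine ⟨p.concat huv, fun w hw => ?_⟩
        rw [SimpleGraph.Walk.support_concat] at hw
        simp only [List.mem_append, List.mem_singleton] at hw
        rcases hw with hw | rfl
        · exact hp w hw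
        · exact hvS

end Touch

/-- The strategy `h` is on time and keeps the fire away from the critical set. -/
structure Saves (I : Instance) (h : Fin I.k → Fin I.n) : Prop where
  onTime : OnTime I.G I.s h
  avoid : ∀ v ∈ I.C, v ∉ Set.range h
  safe : ∀ i, ∀ v ∈ I.C, v ∉ touch I.G I.s (Set.range h) i

/-- The fire cannot spread after round `k`. -/
def Ceases (I : Instance) (S : Set (Fin I.n)) : Prop :=
  touch I.G I.s S (I.k + 1) \ S ⊆ touch I.G I.s S I.k

theorem saves_iff {I : Instance} {h : Fin I.k → Fin I.n} :
    Saves I h ↔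
      IsPlayable I.G I.s h ∧ IsSeparator I.G {I.s} (I.C : Set (Fin I.n)) (Set.range h) := by
  have hs : IsPlayable I.G I.s h → I.s ∉ Set.range h := fun hp hs => hp.notMem_burning hs 0 rfl
  constructor
  · rintro ⟨h1, h2, h3⟩
    have hp := isPlayable_iff_onTime.2 h1
    refine ⟨hp, ?_, ?_⟩
    · rintro v hv (rfl | hvC)
      · exact hs hp hv
      · exact h2 v hvC hv
    · ext v
      simp only [Set.mem_inter_iff, mem_reachableSet_iff (hs hp), Set.mem_empty_iff_false, iff_false]
      rintro ⟨⟨i, hi⟩, hvC⟩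
      exact h3 i v hvC hi.1
  · rintro ⟨hp, h1, h2⟩
    have h3 : ∀ v ∈ I.C, v ∉ Set.range h := fun v hvC hv => h1 hv (Or.inr hvC)
    refine ⟨isPlayable_iff_onTime.1 hp, h3, fun i v hvC hv => ?_⟩
    have : v ∈ reachableSet I.G {I.s} (Set.range h) ∩ I.C :=
      ⟨(mem_reachableSet_iff (hs hp)).2 ⟨i, hv, h3 v hvC⟩, hvC⟩
    rwa [h2] at this

theorem sacsUntimed_iff (I : Instance) : SACSUntimed I ↔ ∃ h, Saves I h := by
  simp only [SACSUntimed, saves_iff]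

theorem sacs_iff (I : Instance) : SACS I ↔ ∃ h, Saves I h ∧ Ceases I (Set.range h) := by
  simp only [SACS, saves_iff, IsValid]
  refine exists_congr fun h => ⟨?_, ?_⟩
  · rintro ⟨⟨hp, hb⟩, hsep⟩
    refine ⟨⟨hp, hsep⟩, fun v hv => ?_⟩
    rw [← hp.burning_eq, hb _ (Nat.le_succ _), hp.burning_eq] at hv
    exact hv.1
  · rintro ⟨⟨hp, hsep⟩, hc⟩
    refine ⟨⟨hp, fun i hi => subset_antisymm ?_ (burning_mono _ _ _ hi)⟩, hsep⟩
    rw [hp.burning_eq, hp.burning_eq]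
    exact fun v hv => ⟨touch_diff_subset_of_succ hc i hv, hv.2⟩

/-! ### Partial strategies -/

/-- A partial strategy assigns to a position either `0` or the successor of a vertex. This is the
set of vertices it places. -/
def placed (I : Instance) (pl : ℕ → ℕ) : Set (Fin I.n) := {v | ∃ p < I.k, pl p = v + 1}

def IsPartial (I : Instance) (pl : ℕ → ℕ) : Prop :=
  ∀ p < I.k, pl p = 0 ∨ ∃ v : Fin I.n, v ∉ I.C ∧ pl p = v + 1

/-- The free positions of a partial strategy. -/
def free (I : Instance) (pl : ℕ → ℕ) : Finset ℕ := {p ∈ Finset.range I.k | pl p = 0}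

/-- The strategy `h` extends the partial strategy `pl`, whose positions are on time. -/
def Extends (I : Instance) (h : Fin I.k → Fin I.n) (pl : ℕ → ℕ) : Prop :=
  ∀ (p : Fin I.k) (v : Fin I.n), pl p = v + 1 → h p = v ∧ v ∉ touch I.G I.s (Set.range h) p

theorem Extends.placed_subset {I : Instance} {h : Fin I.k → Fin I.n} {pl : ℕ → ℕ}
    (hx : Extends I h pl) : placed I pl ⊆ Set.range h :=
  fun v ⟨p, hp, hv⟩ => ⟨⟨p, hp⟩, (hx ⟨p, hp⟩ v hv).1⟩

/-! ### Completion of partial strategies -/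

theorem exists_ne_of_room {I : Instance} (h : I.C.card + 2 ≤ I.n) :
    ∃ u, u ∉ I.C ∧ u ≠ I.s := by
  by_contra! hc
  have : (Finset.univ : Finset (Fin I.n)) ⊆ insert I.s I.C := fun u _ => by
    by_cases hu : u ∈ I.C
    · exact Finset.mem_insert_of_mem hu
    · rw [hc u hu]; exact Finset.mem_insert_self _ _
  have h1 := Finset.card_le_card this
  have h2 := Finset.card_insert_le I.s I.C
  simp only [Finset.card_univ, Fintype.card_fin] at h1
  omega

/-- Firefighters cannot stay idle: if `k` is positive, the first one needs a vertex that is neither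
critical nor the source. -/
theorem room_of_saves {I : Instance} {h : Fin I.k → Fin I.n} (hs : Saves I h) :
    I.k = 0 ∨ I.C.card + 2 ≤ I.n := by
  rcases Nat.eq_zero_or_pos I.k with hk | hk
  · exact Or.inl hk
  right
  set u := h ⟨0, hk⟩
  have hu : u ∈ Set.range h := ⟨_, rfl⟩
  have huC : u ∉ I.C := fun h' => hs.avoid u h' hu
  have hus : u ≠ I.s := fun h' => by
    obtain ⟨j, -, hj⟩ := hs.onTime u hu
    exact hj (touch_mono _ (Nat.zero_le _) h')
  have h1 : (insert I.s (insert u I.C)).card ≤ I.n := by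
    simpa using Finset.card_le_univ (insert I.s (insert u I.C))
  rw [Finset.card_insert_of_notMem, Finset.card_insert_of_notMem huC] at h1
  · exact h1
  · simp [I.s_notMem, Ne.symm hus]

/-- If nobody has to be protected, it does no harm to protect a vertex that burns last. -/
theorem exists_saves_of_empty {I : Instance} (hroom : I.C.card + 2 ≤ I.n)
    (hsafe : ∀ i, ∀ v ∈ I.C, v ∉ touch I.G I.s ∅ i) :
    ∃ h, Saves I h ∧ (Ceases I ∅ → Ceases I (Set.range h)) := by
  classical
  rcases Nat.eq_zero_or_pos I.k with hk | hk
  · have : IsEmpty (Fin I.k) := by rw [hk]; infer_instance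
    refine ⟨isEmptyElim, ?_, ?_⟩
    · refine ⟨?_, ?_, ?_⟩
      · rintro v ⟨j, -⟩; exact isEmptyElim j
      · rintro v - ⟨j, -⟩; exact isEmptyElim j
      · simpa [Set.range_eq_empty] using hsafe
    · simp [Set.range_eq_empty]
  obtain ⟨u₀, hu₀⟩ := exists_ne_of_room hroom
  let A : Finset (Fin I.n) := {u | u ∉ I.C ∧ u ≠ I.s}
  -- The number of rounds up to `k` in which `u` is still untouched; a maximiser is touched last.
  let d : Fin I.n → ℕ := fun u => ({i ∈ Finset.range (I.k + 1) | u ∉ touch I.G I.s ∅ i}).card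
  obtain ⟨u, huA, hmax⟩ := Finset.exists_max_image A d ⟨u₀, by simpa [A] using hu₀⟩
  have hu : u ∉ I.C ∧ u ≠ I.s := by simpa [A] using huA
  have : Nonempty (Fin I.k) := ⟨⟨0, hk⟩⟩
  have hrange : Set.range (fun _ : Fin I.k => u) = {u} := Set.range_const
  refine ⟨fun _ => u, ⟨?_, ?_, ?_⟩, ?_⟩
  · rintro v ⟨j, rfl⟩
    exact ⟨⟨0, hk⟩, rfl, hu.2⟩
  · rintro v hv ⟨j, rfl⟩
    exact hu.1 hv
  · exact fun i v hv hv' => hsafe i v hv (touch_anti (Set.empty_subset _) i hv')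
  · intro hc
    rw [hrange]
    have key : ∀ i ≤ I.k, touch I.G I.s ∅ i ⊆ touch I.G I.s {u} i := by
      intro i
      induction i with
      | zero => exact fun _ => subset_rfl
      | succ i ih =>
        rintro hi v (hv | ⟨w, hw, -, hwv⟩)
        · exact Or.inl (ih (by omega) hv)
        by_cases hv : v ∈ touch I.G I.s ∅ i
        · exact Or.inl (ih (by omega) hv)
        by_cases hwu : w = u
        · exfalso
          subst hwu
          have hvA : v ∈ A := by
            simp only [A, Finset.mem_filter, Finset.mem_univ, true_and]
            exact ⟨fun hvC => hsafe (i + 1) v hvC (mem_touch_succ hw (by simp) hwv),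
              fun hvs => hv (touch_mono _ (Nat.zero_le _) hvs)⟩
          have : d w < d v := by
            refine Finset.card_lt_card ⟨fun j hj => ?_, fun hsub => ?_⟩
            · simp only [Finset.mem_filter] at hj ⊢
              refine ⟨hj.1, fun hvj => ?_⟩
              rcases le_total i j with hij | hij
              · exact hj.2 (touch_mono _ hij hw)
              · exact hv (touch_mono _ hij hvj)
            · have hvi : i ∈ ({i ∈ Finset.range (I.k + 1) | v ∉ touch I.G I.s ∅ i} : Finset ℕ) := by
                simp only [Finset.mem_filter, Finset.mem_range]
                exact ⟨by omega, hv⟩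
              exact (Finset.mem_filter.1 (hsub hvi)).2 hw
          exact absurd (hmax v hvA) (by omega)
        · exact mem_touch_succ (ih (by omega) hw) hwu hwv
    intro v hv
    exact key _ le_rfl (hc ⟨touch_anti (Set.empty_subset _) _ hv.1, by simp⟩)

/-- A partial strategy can be completed to a strategy that saves `C` by any set `F` of at most as
many vertices as there are free positions, if these are far away from the fire. -/
theorem exists_saves_of_partial {I : Instance} {pl : ℕ → ℕ} (hpl : IsPartial I pl)
    {F : Finset (Fin I.n)} (hF : F.card ≤ (free I pl).card) (hFC : ∀ v ∈ F, v ∉ I.C)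
    (hroom : I.k = 0 ∨ I.C.card + 2 ≤ I.n)
    (hon : ∀ v ∈ placed I pl, ∃ p < I.k, pl p = v + 1 ∧ v ∉ touch I.G I.s (placed I pl) p)
    (hfar : ∀ v ∈ F, v ∉ touch I.G I.s (placed I pl) I.k)
    (hsafe : ∀ i, ∀ v ∈ I.C, v ∉ touch I.G I.s (placed I pl ∪ F) i) :
    ∃ h, Saves I h ∧ (Ceases I (placed I pl ∪ F) → Ceases I (Set.range h)) := by
  classical
  -- Superfluous free positions repeat a vertex that is protected anyway. If there is none, a
  -- harmless vertex has to be found.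
  rcases Set.eq_empty_or_nonempty (placed I pl ∪ (F : Set (Fin I.n))) with hS | ⟨x, hx⟩
  · rw [hS] at hsafe ⊢
    rcases hroom with hk | hroom
    · have : IsEmpty (Fin I.k) := by rw [hk]; infer_instance
      refine ⟨isEmptyElim, ⟨?_, ?_, ?_⟩, ?_⟩
      · rintro v ⟨j, -⟩; exact isEmptyElim j
      · rintro v - ⟨j, -⟩; exact isEmptyElim j
      · simpa [Set.range_eq_empty] using hsafe
      · simp [Set.range_eq_empty]
    · exact exists_saves_of_empty hroom hsafe
  obtain ⟨g, hg⟩ : ∃ g : ℕ → Fin I.n, (∀ p ∈ free I pl, g p ∈ placed I pl ∪ (F : Set (Fin I.n))) ∧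
      ∀ v ∈ F, ∃ p ∈ free I pl, g p = v := by
    obtain ⟨e⟩ : Nonempty (F ↪ free I pl) := Function.Embedding.nonempty_of_card_le (by simpa using hF)
    -- An injection of `F` into the free positions places `F`; the remaining free positions repeat
    -- `x`.
    refine ⟨fun p => if hp : ∃ v : F, (e v : ℕ) = p then (Classical.choose hp : F) else x, ?_, ?_⟩
    · intro p hp
      by_cases h : ∃ v : F, (e v : ℕ) = p
      · simp only [h, dite_true]
        exact Or.inr (Classical.choose h).2
      · simpa only [h, dite_false] using hx
    · intro v hv
      refine ⟨e ⟨v, hv⟩, (e ⟨v, hv⟩).2, ?_⟩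
      have h : ∃ w : F, (e w : ℕ) = e ⟨v, hv⟩ := ⟨⟨v, hv⟩, rfl⟩
      simp only [h, dite_true]
      have := Classical.choose_spec h
      rw [e.injective (Subtype.ext this)]
  let h : Fin I.k → Fin I.n := fun p =>
    if hp : ∃ v : Fin I.n, pl p = v + 1 then Classical.choose hp else g p
  have h_of : ∀ (p : Fin I.k) (v : Fin I.n), pl p = v + 1 → h p = v := by
    intro p v hv
    have hp : ∃ v : Fin I.n, pl p = v + 1 := ⟨v, hv⟩
    simp only [h, hp, dite_true]
    have := hv.symm.trans (Classical.choose_spec hp)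
    exact Fin.ext (by omega)
  have h_free : ∀ p : Fin I.k, (p : ℕ) ∈ free I pl → h p = g p := by
    intro p hp
    have : ¬ ∃ v : Fin I.n, pl p = v + 1 := by
      rintro ⟨v, hv⟩
      simp [free, hv] at hp
    simp only [h, this, dite_false]
  have hrange : Set.range h = placed I pl ∪ F := by
    ext v
    constructor
    · rintro ⟨p, rfl⟩
      rcases hpl p p.2 with h0 | ⟨v, -, hv⟩
      · have : (p : ℕ) ∈ free I pl := by simp [free, h0]
        rw [h_free p this]
        exact hg.1 _ this
      · rw [h_of p v hv]
        exact Or.inl ⟨p, p.2, hv⟩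
    · rintro (⟨p, hp, hv⟩ | hv)
      · exact ⟨⟨p, hp⟩, h_of ⟨p, hp⟩ v hv⟩
      · obtain ⟨p, hp, rfl⟩ := hg.2 v hv
        have hpk : p < I.k := by simp only [free, Finset.mem_filter, Finset.mem_range] at hp; exact hp.1
        exact ⟨⟨p, hpk⟩, h_free ⟨p, hpk⟩ hp⟩
  refine ⟨h, ⟨?_, ?_, ?_⟩, by rw [hrange]; exact id⟩
  · intro v hv
    rw [hrange] at hv ⊢
    rcases hv with hv | hv
    · obtain ⟨p, hp, hpv, ht⟩ := hon v hv
      exact ⟨⟨p, hp⟩, h_of ⟨p, hp⟩ v hpv, fun h' => ht (touch_anti Set.subset_union_left _ h')⟩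
    · obtain ⟨p, hp, hgp⟩ := hg.2 v hv
      have hpk : p < I.k := by simp only [free, Finset.mem_filter, Finset.mem_range] at hp; exact hp.1
      exact ⟨⟨p, hpk⟩, by rw [h_free ⟨p, hpk⟩ hp, hgp], fun h' =>
        hfar v hv (touch_mono _ hpk.le (touch_anti Set.subset_union_left _ h'))⟩
  · intro v hv hv'
    rw [hrange] at hv'
    rcases hv' with ⟨p, hp, hpv⟩ | hv'
    · rcases hpl p hp with h0 | ⟨w, hw, hpw⟩
      · omega
      · have : v = w := Fin.ext (by omega)
        exact hw (this ▸ hv)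
    · exact hFC v hv' hv
  · rw [hrange]; exact hsafe

end Firefighter

namespace Firefighter

/-! ### The input arrays -/

section Input

variable {I : Instance} (E : Encoding I)

def Encoding.e1 (i : ℕ) : ℕ := (E.edges.map fun e => (e.1 : ℕ)).getD i 0
def Encoding.e2 (i : ℕ) : ℕ := (E.edges.map fun e => (e.2 : ℕ)).getD i 0
def Encoding.cr (i : ℕ) : ℕ := (E.crit.map Fin.val).getD i 0
def Encoding.m : ℕ := E.edges.length

theorem Encoding.m_eq : E.m = I.m := by
  classical
  have h : I.G.edgeSet = ((E.edges.map fun e => s(e.1, e.2)).toFinset : Set (Sym2 (Fin I.n))) := by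
    ext x
    simp only [List.coe_toFinset, Set.mem_ofPred_eq]
    exact (E.mem_edges x).symm
  rw [Instance.m, h, Set.ncard_coe_finset, List.toFinset_card_of_nodup E.edges_nodup]
  simp [Encoding.m]

theorem Encoding.crit_length : E.crit.length = I.C.card := by
  classical
  rw [← List.toFinset_card_of_nodup E.crit_nodup]
  congr 1
  ext v
  simp [E.mem_crit]

theorem Encoding.init_arr_two : E.init.arr 2 = E.cr := by
  funext i
  -- The list of critical vertices is coerced to a list of numbers in `Encoding.init`, and this
  -- coercion unfolds to a monadic bind.
  have : ∀ l : List (Fin I.n), (l >>= fun a => pure (a : ℕ)) = l.map Fin.val := by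
    intro l
    induction l <;> simp_all
  simp [Encoding.init, Encoding.cr, ← this]

theorem Encoding.e1_eq {e : ℕ} (he : e < E.m) : E.e1 e = (E.edges[e]'he).1 := by
  simp only [Encoding.m] at he
  simp [Encoding.e1, he]

theorem Encoding.e2_eq {e : ℕ} (he : e < E.m) : E.e2 e = (E.edges[e]'he).2 := by
  simp only [Encoding.m] at he
  simp [Encoding.e2, he]

theorem Encoding.e1_lt {e : ℕ} (he : e < E.m) : E.e1 e < I.n := by
  rw [E.e1_eq he]; exact Fin.is_lt _

theorem Encoding.e2_lt {e : ℕ} (he : e < E.m) : E.e2 e < I.n := by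
  rw [E.e2_eq he]; exact Fin.is_lt _

theorem Encoding.adj_iff (u v : Fin I.n) : I.G.Adj u v ↔
    ∃ e < E.m, (E.e1 e = u ∧ E.e2 e = v) ∨ (E.e1 e = v ∧ E.e2 e = u) := by
  rw [← SimpleGraph.mem_edgeSet, ← E.mem_edges]
  simp only [List.mem_map, Sym2.eq_iff]
  constructor
  · rintro ⟨x, hx, hxuv⟩
    obtain ⟨e, he, rfl⟩ := List.getElem_of_mem hx
    refine ⟨e, he, ?_⟩
    rw [E.e1_eq he, E.e2_eq he]
    simpa [Fin.ext_iff] using hxuv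
  · rintro ⟨e, he, hxuv⟩
    refine ⟨E.edges[e]'he, List.getElem_mem _, ?_⟩
    rw [E.e1_eq he, E.e2_eq he] at hxuv
    simpa [Fin.ext_iff] using hxuv

theorem Encoding.cr_lt {i : ℕ} (hi : i < E.crit.length) : ∃ v : Fin I.n, v ∈ I.C ∧ E.cr i = v := by
  refine ⟨E.crit[i], (E.mem_crit _).1 (List.getElem_mem _), ?_⟩
  rw [Encoding.cr, List.getD_eq_getElem _ _ (by simpa using hi), List.getElem_map]

theorem Encoding.exists_cr {v : Fin I.n} (hv : v ∈ I.C) : ∃ i < E.crit.length, E.cr i = v := by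
  obtain ⟨i, hi, h⟩ := List.getElem_of_mem ((E.mem_crit v).2 hv)
  refine ⟨i, hi, ?_⟩
  rw [Encoding.cr, List.getD_eq_getElem _ _ (by simpa using hi), List.getElem_map, h]

end Input

/-! ### Breadth first search -/

/-- `lev` and `par` describe `R` rounds of a breadth first search from `x₀` in the digraph with the
arcs `T a → H a`, `a < L`, on the nodes below `N`. The level is `0` for nodes that are not
reached, and one more than the distance otherwise; `par` is the last arc of a shortest path. -/
structure IsBfs (N L R x₀ : ℕ) (T H lev par : ℕ → ℕ) : Prop where
  source : lev x₀ = 1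
  eq_source : ∀ x < N, lev x = 1 → x = x₀
  le : ∀ x < N, lev x ≤ R + 1
  parent : ∀ x < N, 2 ≤ lev x → par x < L ∧ H (par x) = x ∧ lev (T (par x)) + 1 = lev x
  forward : ∀ a < L, 0 < lev (T a) → lev (T a) ≤ R → 0 < lev (H a) ∧ lev (H a) ≤ lev (T a) + 1

/-- If only `R` nodes can be reached, then the nodes reached in `R` rounds are closed. -/
theorem IsBfs.closed {N L R x₀ : ℕ} {T H lev par : ℕ → ℕ} (hb : IsBfs N L R x₀ T H lev par)
    (hT : ∀ a < L, T a < N) {K : Finset ℕ} (hK : K.card ≤ R) (hx : x₀ ∈ K)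
    (hKc : ∀ a < L, T a ∈ K → H a ∈ K) (hx₀ : x₀ < N) :
    ∀ a < L, 0 < lev (T a) → 0 < lev (H a) := by
  have hreach : ∀ j, ∀ x < N, lev x = j + 1 →
      x ∈ K ∧ ∀ i ≤ j, ∃ y < N, y ∈ K ∧ lev y = i + 1 := by
    intro j
    induction j with
    | zero =>
      intro x hxN hl
      obtain rfl := hb.eq_source x hxN hl
      exact ⟨hx, fun i hi => ⟨x, hxN, hx, by omega⟩⟩
    | succ j ih =>
      intro x hxN hl
      obtain ⟨h1, h2, h3⟩ := hb.parent x hxN (by omega)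
      obtain ⟨h4, h5⟩ := ih _ (hT _ h1) (by omega)
      have hxK : x ∈ K := h2 ▸ hKc _ h1 h4
      refine ⟨hxK, fun i hi => ?_⟩
      rcases Nat.lt_or_ge j i with hij | hij
      · exact ⟨x, hxN, hxK, by omega⟩
      · exact h5 i hij
  intro a ha h0
  refine (hb.forward a ha h0 ?_).1
  -- A node of level `R + 1` has ancestors of all levels `1, …, R + 1`. These are `R + 1` distinct
  -- elements of `K`, too many.
  by_contra! hR
  have hl : lev (T a) = R + 1 := le_antisymm (hb.le _ (hT a ha)) hR
  obtain ⟨-, h2⟩ := hreach R _ (hT a ha) hl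
  choose! f hf using h2
  have hinj : Set.InjOn f (Finset.range (R + 1) : Set ℕ) := by
    intro i hi j hj hij
    simp only [Finset.coe_range, Set.mem_Iio] at hi hj
    have h3 := (hf i (by omega)).2.2
    have h4 := (hf j (by omega)).2.2
    rw [hij] at h3
    omega
  have := Finset.card_le_card_of_injOn f (s := Finset.range (R + 1)) (t := K)
    (fun i hi => (hf i (by simpa [Nat.lt_succ_iff] using hi)).2.1) hinj
  simp at this
  omega

/-- Its use is for flows: once a closed set separates the source from the sink, no later search can
reach the sink. -/
theorem IsBfs.mem_of_closed {N L R x₀ : ℕ} {T H lev par : ℕ → ℕ}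
    (hb : IsBfs N L R x₀ T H lev par) (hT : ∀ a < L, T a < N) {U : Set ℕ} (hx : x₀ ∈ U)
    (hU : ∀ a < L, T a ∈ U → H a ∈ U) : ∀ x < N, 0 < lev x → x ∈ U := by
  have key : ∀ j, ∀ x < N, lev x = j + 1 → x ∈ U := by
    intro j
    induction j with
    | zero => exact fun x hxN hl => hb.eq_source x hxN hl ▸ hx
    | succ j ih =>
      intro x hxN hl
      obtain ⟨h1, h2, h3⟩ := hb.parent x hxN (by omega)
      exact h2 ▸ hU _ h1 (ih _ (hT _ h1) (by omega))
  exact fun x hx h0 => key (lev x - 1) x hx (by omega)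

/-! ### The fire as a breadth first search -/

/-- `lev` and `anc` describe the first `k + 1` rounds of the fire: the level is one more than the
time of the first contact, or `0`, and `anc` yields a neighbour that passes on the fire. -/
structure IsFire (I : Instance) (S : Set (Fin I.n)) (lev anc : ℕ → ℕ) : Prop where
  mem_touch_iff : ∀ (v : Fin I.n) (r : ℕ), r ≤ I.k + 1 →
    (v ∈ touch I.G I.s S r ↔ 0 < lev v ∧ lev v ≤ r + 1)
  le : ∀ v : Fin I.n, lev v ≤ I.k + 2
  anc_lt : ∀ v : Fin I.n, anc v < I.n
  anc_spec : ∀ v : Fin I.n, 2 ≤ lev v →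
    ∃ u : Fin I.n, anc v = u ∧ u ∉ S ∧ I.G.Adj u v ∧ lev u + 1 = lev v

/-- The array `prot` contains the successor of a position of each placed vertex. -/
def IsProt (I : Instance) (pl prot : ℕ → ℕ) : Prop :=
  ∀ v : Fin I.n, (prot v = 0 ∧ v ∉ placed I pl) ∨ ∃ p < I.k, prot v = p + 1 ∧ pl p = v + 1

theorem IsProt.eq_zero_iff {I : Instance} {pl prot : ℕ → ℕ} (h : IsProt I pl prot) (v : Fin I.n) :
    prot v = 0 ↔ v ∉ placed I pl := by
  rcases h v with ⟨h1, h2⟩ | ⟨p, hp, h1, h2⟩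
  · simp [h1, h2]
  · simp only [h1, Nat.add_eq_zero_iff, one_ne_zero, and_false, false_iff, not_not]
    exact ⟨p, hp, h2⟩

/-- The arcs along which the fire spreads; those from protected vertices start in the node `n`. -/
structure FireArcs {I : Instance} (E : Encoding I) (prot T H : ℕ → ℕ) : Prop where
  tail₁ : ∀ e < E.m, T e = if 0 < prot (E.e1 e) then I.n else E.e1 e
  head₁ : ∀ e < E.m, H e = E.e2 e
  tail₂ : ∀ e < E.m, T (e + E.m) = if 0 < prot (E.e2 e) then I.n else E.e2 e
  head₂ : ∀ e < E.m, H (e + E.m) = E.e1 e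

variable {I : Instance}

theorem FireArcs.exists_of_adj {E : Encoding I} {prot T H : ℕ → ℕ} (hA : FireArcs E prot T H)
    {u v : Fin I.n} (huv : I.G.Adj u v) (hu : prot u = 0) :
    ∃ a < 2 * E.m, T a = u ∧ H a = v := by
  obtain ⟨e, he, ⟨h1, h2⟩ | ⟨h1, h2⟩⟩ := (E.adj_iff u v).1 huv
  · exact ⟨e, by omega, by rw [hA.tail₁ e he, h1, hu]; simp, by rw [hA.head₁ e he, h2]⟩
  · exact ⟨e + E.m, by omega, by rw [hA.tail₂ e he, h2, hu]; simp, by rw [hA.head₂ e he, h1]⟩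

theorem FireArcs.head_lt {E : Encoding I} {prot T H : ℕ → ℕ} (hA : FireArcs E prot T H)
    {a : ℕ} (ha : a < 2 * E.m) : H a < I.n := by
  rcases lt_or_ge a E.m with h | h
  · rw [hA.head₁ a h]; exact E.e2_lt h
  · obtain ⟨e, rfl⟩ := Nat.exists_eq_add_of_le' h
    rw [hA.head₂ e (by omega)]; exact E.e1_lt (by omega)

theorem FireArcs.tail_le {E : Encoding I} {prot T H : ℕ → ℕ} (hA : FireArcs E prot T H)
    {a : ℕ} (ha : a < 2 * E.m) : T a ≤ I.n := by
  rcases lt_or_ge a E.m with h | h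
  · rw [hA.tail₁ a h]; have := E.e1_lt h; split_ifs <;> omega
  · obtain ⟨e, rfl⟩ := Nat.exists_eq_add_of_le' h
    rw [hA.tail₂ e (by omega)]; have := E.e2_lt (e := e) (by omega); split_ifs <;> omega

theorem FireArcs.adj_of_tail_lt {E : Encoding I} {prot T H : ℕ → ℕ} (hA : FireArcs E prot T H)
    {a : ℕ} (ha : a < 2 * E.m) (hT : T a < I.n) :
    prot (T a) = 0 ∧ ∃ u v : Fin I.n, T a = u ∧ H a = v ∧ I.G.Adj u v := by
  rcases lt_or_ge a E.m with h | h
  · have h1 := hA.tail₁ a h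
    split_ifs at h1 with h2
    · omega
    · refine ⟨by rw [h1]; omega, ⟨_, E.e1_lt h⟩, ⟨_, E.e2_lt h⟩, h1, hA.head₁ a h, ?_⟩
      exact (E.adj_iff _ _).2 ⟨a, h, Or.inl ⟨rfl, rfl⟩⟩
  · obtain ⟨e, rfl⟩ := Nat.exists_eq_add_of_le' h
    have he : e < E.m := by omega
    have h1 := hA.tail₂ e he
    split_ifs at h1 with h2
    · omega
    · refine ⟨by rw [h1]; omega, ⟨_, E.e2_lt he⟩, ⟨_, E.e1_lt he⟩, h1, hA.head₂ e he, ?_⟩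
      exact (E.adj_iff _ _).2 ⟨e, he, Or.inr ⟨rfl, rfl⟩⟩

theorem isFire_of_isBfs {E : Encoding I} {pl prot T H lev par flev anc : ℕ → ℕ}
    (hp : IsProt I pl prot) (hA : FireArcs E prot T H)
    (hb : IsBfs (I.n + 1) (2 * E.m) (I.k + 1) I.s T H lev par)
    (hlev : ∀ v < I.n, flev v = lev v)
    (hanc : ∀ v < I.n, anc v = if 1 < lev v then T (par v) else v) :
    IsFire I (placed I pl) flev anc := by
  -- No arc ends in the node `n`, so it is never reached. Moving the tails of arcs out of protected
  -- vertices there amounts to deleting these arcs.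
  have hn : lev I.n = 0 := by
    by_contra h0
    have hne : lev I.n ≠ 1 := fun h1 => by
      have := hb.eq_source _ (Nat.lt_succ_self _) h1
      have := I.s.2
      omega
    obtain ⟨h1, h2, -⟩ := hb.parent I.n (Nat.lt_succ_self _) (by omega)
    have := hA.head_lt h1
    omega
  have hpar : ∀ v : Fin I.n, 2 ≤ lev v → ∃ u : Fin I.n, T (par v) = u ∧ u ∉ placed I pl ∧
      I.G.Adj u v ∧ lev u + 1 = lev v := by
    intro v hv
    obtain ⟨h1, h2, h3⟩ := hb.parent v (by omega) hv
    have hT : T (par v) < I.n := by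
      refine lt_of_le_of_ne (hA.tail_le h1) fun h => ?_
      rw [h, hn] at h3
      omega
    obtain ⟨h4, u, w, hu, hw, huw⟩ := hA.adj_of_tail_lt h1 hT
    have : w = v := Fin.ext (by omega)
    subst this
    refine ⟨u, hu, ?_, huw, by rw [← hu]; exact h3⟩
    rw [hu] at h4
    exact (hp.eq_zero_iff u).1 h4
  have key : ∀ r, r ≤ I.k + 1 → ∀ v : Fin I.n,
      v ∈ touch I.G I.s (placed I pl) r ↔ 0 < lev v ∧ lev v ≤ r + 1 := by
    intro r
    induction r with
    | zero =>
      intro _ v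
      constructor
      · intro hv
        obtain rfl : v = I.s := hv
        simp [hb.source]
      · rintro ⟨h1, h2⟩
        exact Fin.ext (hb.eq_source v (by omega) (by omega))
    | succ r ih =>
      intro hr v
      constructor
      · rintro (hv | ⟨u, hu, huS, huv⟩)
        · have := (ih (by omega) v).1 hv
          omega
        · have h1 := (ih (by omega) u).1 hu
          obtain ⟨a, ha, h2, h3⟩ := hA.exists_of_adj huv ((hp.eq_zero_iff u).2 huS)
          have := hb.forward a ha
          rw [h2, h3] at this
          have := this (by omega) (by omega)
          omega
      · rintro ⟨h1, h2⟩
        by_cases h3 : lev v ≤ r + 1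
        · exact Or.inl ((ih (by omega) v).2 ⟨h1, h3⟩)
        · obtain ⟨u, -, huS, huv, hl⟩ := hpar v (by omega)
          exact mem_touch_succ ((ih (by omega) u).2 ⟨by omega, by omega⟩) huS huv
  refine ⟨?_, ?_, ?_, ?_⟩
  · intro v r hr
    rw [hlev v v.2]
    exact key r hr v
  · intro v
    rw [hlev v v.2]
    exact hb.le v (by omega)
  · intro v
    rw [hanc v v.2]
    split_ifs with h
    · obtain ⟨u, hu, -⟩ := hpar v h
      rw [hu]; exact u.2
    · exact v.2
  · intro v hv
    rw [hlev v v.2] at hv ⊢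
    obtain ⟨u, hu, h1, h2, h3⟩ := hpar v hv
    exact ⟨u, by rw [hanc v v.2, if_pos (by omega), hu], h1, h2, by rw [hlev u u.2]; exact h3⟩

/-! ### Vertices that a solution has to hit -/

variable {S S' : Set (Fin I.n)} {lev anc : ℕ → ℕ}

theorem IsFire.lev_source (hf : IsFire I S lev anc) : lev I.s = 1 := by
  have := (hf.mem_touch_iff I.s 0 (Nat.zero_le _)).1 rfl
  omega

theorem IsFire.mem_touch (hf : IsFire I S lev anc) {v : Fin I.n} (hv : 0 < lev v) :
    v ∈ touch I.G I.s S (lev v - 1) :=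
  (hf.mem_touch_iff v _ (by have := hf.le v; omega)).2 ⟨hv, by omega⟩

/-- If more protection delays the fire at `v`, then it protects a vertex on the way to `v`. -/
theorem IsFire.exists_anc (hf : IsFire I S lev anc) {v : Fin I.n} (hv : 0 < lev v)
    (hd : v ∉ touch I.G I.s S' (lev v - 1)) :
    ∃ i ≤ lev v - 1, ∃ u : Fin I.n, anc^[i] v = u ∧ u ∈ S' ∧ u ∉ S := by
  generalize hl : lev v - 1 = d at hd
  induction d generalizing v with
  | zero =>
    -- Round `0` is the same for all protected sets, so the source cannot be delayed.
    have := hf.mem_touch hv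
    rw [hl] at this
    exact absurd this hd
  | succ d ih =>
    obtain ⟨u, hu, huS, huv, hlu⟩ := hf.anc_spec v (by omega)
    by_cases huS' : u ∈ S'
    · exact ⟨1, by omega, u, by simpa using hu, huS', huS⟩
    -- If the parent `u` is not protected by `S'`, it must be delayed itself, since otherwise it
    -- would ignite `v` in time.
    · obtain ⟨i, hi, w, hw, h1⟩ := ih (v := u) (by omega) (by omega)
        fun h => hd (mem_touch_succ h huS' huv)
      refine ⟨i + 1, by omega, w, ?_, h1⟩
      rw [Function.iterate_succ_apply, hu, hw]

/-- Some vertex on the way to one of the targets is placed by `h`, but not by `pl`. -/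
def Hits (I : Instance) (h : Fin I.k → Fin I.n) (pl anc targ : ℕ → ℕ) (nt : ℕ) : Prop :=
  ∃ a < nt, ∃ i < I.k + 2, ∃ u : Fin I.n,
    anc^[i] (targ a) = u ∧ u ∈ Set.range h ∧ u ∉ placed I pl

/-- The vertex `v` has to be delayed or saved. -/
def Bad (I : Instance) (prot lev : ℕ → ℕ) (v : Fin I.n) : Prop :=
  0 < lev v ∧ (lev v ≤ prot v ∨ v ∈ I.C)

variable {pl prot targ : ℕ → ℕ} {nt : ℕ} {h : Fin I.k → Fin I.n}

theorem hits_of_delayed (hf : IsFire I (placed I pl) lev anc) {a : ℕ} (ha : a < nt)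
    {v : Fin I.n} (hav : targ a = v) (hv : 0 < lev v)
    (hd : (v ∈ Set.range h ∧ v ∉ placed I pl) ∨ v ∉ touch I.G I.s (Set.range h) (lev v - 1)) :
    Hits I h pl anc targ nt := by
  rcases hd with hd | hd
  · exact ⟨a, ha, 0, by omega, v, by simpa using hav, hd⟩
  · obtain ⟨i, hi, u, hu, h1⟩ := hf.exists_anc hv hd
    exact ⟨a, ha, i, by have := hf.le v; omega, u, by rw [hav, hu], h1⟩

/-- A solution never lets the fire touch a critical vertex, and lets it touch a placed vertex only
after its position. In either case the contact in round `lev v - 1` is delayed. -/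
theorem hits_of_bad (hf : IsFire I (placed I pl) lev anc) (hp : IsProt I pl prot)
    (hs : Saves I h) (hx : Extends I h pl) {a : ℕ} (ha : a < nt) {v : Fin I.n} (hav : targ a = v)
    (hv : Bad I prot lev v) : Hits I h pl anc targ nt := by
  refine hits_of_delayed hf ha hav hv.1 (Or.inr fun ht => ?_)
  rcases hv.2 with hv' | hv'
  · rcases hp v with ⟨h1, -⟩ | ⟨p, hpk, h1, h2⟩
    · have := hv.1
      omega
    -- Levels and entries of `prot` are both shifted by one, so `lev v ≤ prot v = p + 1` puts the
    -- contact in a round not after `p`.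
    · exact (hx ⟨p, hpk⟩ v h2).2 (touch_mono _ (by simp; omega) ht)
  · exact hs.safe _ v hv' ht

/-- If `v` is not placed by `h` and yet is touched in round `k + 1`, then it is touched by round `k`
because the fire has ceased. With less protection this remains true, which contradicts its level `k
+ 2`. -/
theorem hits_of_ceases (hf : IsFire I (placed I pl) lev anc) (hp : IsProt I pl prot)
    (hx : Extends I h pl) (hc : Ceases I (Set.range h)) {a : ℕ} (ha : a < nt)
    {v : Fin I.n} (hav : targ a = v) (hv : lev v = I.k + 2) (hv0 : prot v = 0) :
    Hits I h pl anc targ nt := by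
  refine hits_of_delayed hf ha hav (by omega) ?_
  by_cases hvS : v ∈ Set.range h
  · exact Or.inl ⟨hvS, (hp.eq_zero_iff v).1 hv0⟩
  · refine Or.inr fun ht => ?_
    rw [hv] at ht
    have := touch_anti hx.placed_subset _ (hc ⟨ht, hvS⟩)
    rw [hf.mem_touch_iff v _ (by omega)] at this
    omega

theorem on_time_of_not_bad (hf : IsFire I (placed I pl) lev anc) (hp : IsProt I pl prot)
    (hb : ∀ v, ¬ Bad I prot lev v) :
    ∀ v ∈ placed I pl, ∃ p < I.k, pl p = v + 1 ∧ v ∉ touch I.G I.s (placed I pl) p := by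
  intro v hv
  rcases hp v with ⟨-, h2⟩ | ⟨p, hpk, h1, h2⟩
  · exact absurd hv h2
  · refine ⟨p, hpk, h2, fun ht => hb v ?_⟩
    rw [hf.mem_touch_iff v _ (by omega)] at ht
    exact ⟨ht.1, Or.inl (by omega)⟩

/-- If the fire ceases in time and nothing is bad, the partial strategy can be completed. -/
theorem exists_saves_of_ceased (hpl : IsPartial I pl) (hf : IsFire I (placed I pl) lev anc)
    (hp : IsProt I pl prot) (hroom : I.k = 0 ∨ I.C.card + 2 ≤ I.n) (hb : ∀ v, ¬ Bad I prot lev v)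
    (hc : ∀ v : Fin I.n, prot v = 0 → lev v ≠ I.k + 2) :
    ∃ h, Saves I h ∧ Ceases I (Set.range h) := by
  have hc' : Ceases I (placed I pl) := by
    rintro v ⟨hv, hvS⟩
    rw [hf.mem_touch_iff v _ (by omega)] at hv ⊢
    have := hc v ((hp.eq_zero_iff v).2 hvS)
    omega
  have key := exists_saves_of_partial (F := ∅) hpl (by simp) (by simp) hroom
    (on_time_of_not_bad hf hp hb) (by simp) ?_
  · simp only [Finset.coe_empty, Set.union_empty] at key
    obtain ⟨h, h1, h2⟩ := key
    exact ⟨h, h1, h2 hc'⟩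
  · simp only [Finset.coe_empty, Set.union_empty]
    intro i v hv ht
    by_cases hvS : v ∈ placed I pl
    · obtain ⟨p, hpk, hpv⟩ := hvS
      rcases hpl p hpk with h0 | ⟨w, hw, hpw⟩
      · omega
      · have : v = w := Fin.ext (by omega)
        exact hw (this ▸ hv)
    · have := touch_diff_subset_of_succ hc' i ⟨ht, hvS⟩
      rw [hf.mem_touch_iff v _ (by omega)] at this
      exact hb v ⟨this.1, Or.inr hv⟩

end Firefighter

namespace Firefighter

/-! ### Unit capacity flows by path reversal -/

/-- The arcs `T a → H a`, `a < L`, result from the arcs `T₀ a → H₀ a` by the reversal of `fl` paths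
from `σ` to `τ`. -/
structure IsFlow (L σ τ : ℕ) (T₀ H₀ : ℕ → ℕ) (fl : ℕ) (T H : ℕ → ℕ) : Prop where
  pair : ∀ a < L, (T a = T₀ a ∧ H a = H₀ a) ∨ (T a = H₀ a ∧ H a = T₀ a)
  count : ∀ U : Set ℕ, ∀ [DecidablePred (· ∈ U)], σ ∈ U → τ ∉ U →
    ((Finset.range L).filter (T · ∈ U)).card + fl = ((Finset.range L).filter (T₀ · ∈ U)).card
  source : ∀ a < L, T a = σ → T₀ a = σ

section Flow

variable {L σ τ fl : ℕ} {T₀ H₀ T H : ℕ → ℕ}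

/-- The clause `count` replaces flow conservation: along a path from `σ` to `τ` the contributions
telescope, and each reversal lowers the number of tails in a separating set by exactly one. Lost
tails come from reversed arcs that originally left `U`, which is weak duality. -/
theorem IsFlow.le_card_of_mem (hf : IsFlow L σ τ T₀ H₀ fl T H) (U : Set ℕ)
    [DecidablePred (· ∈ U)] (hσ : σ ∈ U) (hτ : τ ∉ U) :
    fl ≤ ((Finset.range L).filter (fun a => T₀ a ∈ U ∧ T a ∉ U)).card := by
  have h1 := hf.count U hσ hτ
  have h2 : (Finset.range L).filter (T₀ · ∈ U) ⊆ (Finset.range L).filter (T · ∈ U) ∪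
      (Finset.range L).filter (fun a => T₀ a ∈ U ∧ T a ∉ U) := by
    intro a
    simp only [Finset.mem_filter, Finset.mem_union]
    tauto
  have := (Finset.card_le_card h2).trans (Finset.card_union_le _ _)
  omega

/-- If no path is left, the value of the flow bounds a cut. -/
theorem IsFlow.card_cut_le (hf : IsFlow L σ τ T₀ H₀ fl T H) (U : Set ℕ)
    [DecidablePred (· ∈ U)] (hσ : σ ∈ U) (hτ : τ ∉ U) (hc : ∀ a < L, T a ∈ U → H a ∈ U) :
    ((Finset.range L).filter (fun a => T₀ a ∈ U ∧ H₀ a ∉ U)).card ≤ fl := by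
  have h1 := hf.count U hσ hτ
  have h2 : Disjoint ((Finset.range L).filter (T · ∈ U))
      ((Finset.range L).filter (fun a => T₀ a ∈ U ∧ H₀ a ∉ U)) := by
    rw [Finset.disjoint_left]
    intro a
    simp only [Finset.mem_filter, Finset.mem_range]
    rintro ⟨ha, h3⟩ ⟨-, h4, h5⟩
    have h6 := hc a ha h3
    rcases hf.pair a ha with ⟨h7, h8⟩ | ⟨h7, h8⟩
    · exact h5 (h8 ▸ h6)
    · exact h5 (h7 ▸ h3)
  have h3 : (Finset.range L).filter (T · ∈ U) ∪
      (Finset.range L).filter (fun a => T₀ a ∈ U ∧ H₀ a ∉ U) ⊆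
      (Finset.range L).filter (T₀ · ∈ U) := by
    intro a
    simp only [Finset.mem_filter, Finset.mem_union, Finset.mem_range]
    rintro (⟨ha, h4⟩ | h4)
    · refine ⟨ha, ?_⟩
      rcases hf.pair a ha with ⟨h7, h8⟩ | ⟨h7, h8⟩
      · exact h7 ▸ h4
      · exact h8 ▸ hc a ha h4
    · exact ⟨h4.1, h4.2.1⟩
  have := Finset.card_le_card h3
  rw [Finset.card_union_of_disjoint h2] at this
  omega

/-- This is the count for the cut `{σ}`. No reversal creates an arc out of `σ`, so nothing
compensates for the tails lost there. -/
theorem IsFlow.card_exits (hf : IsFlow L σ τ T₀ H₀ fl T H) (hστ : σ ≠ τ) :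
    ((Finset.range L).filter (fun a => T₀ a = σ ∧ T a ≠ σ)).card = fl := by
  classical
  have h1 := hf.count {σ} rfl (fun h => hστ h.symm)
  simp only [Set.mem_singleton_iff] at h1
  have h2 : (Finset.range L).filter (T₀ · = σ) = (Finset.range L).filter (T · = σ) ∪
      (Finset.range L).filter (fun a => T₀ a = σ ∧ T a ≠ σ) := by
    ext a
    simp only [Finset.mem_filter, Finset.mem_union, Finset.mem_range]
    have := hf.source a
    tauto
  rw [h2, Finset.card_union_of_disjoint] at h1
  · omega
  · rw [Finset.disjoint_left]
    intro a
    simp only [Finset.mem_filter]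
    tauto

/-- The situation while a path found by a breadth first search is being reversed, from its end to
the current node. -/
structure IsTrace (L N σ τ : ℕ) (T₀ H₀ : ℕ → ℕ) (fl : ℕ) (lev par T H : ℕ → ℕ) (cur : ℕ) : Prop where
  lt : cur < N
  pos : 0 < lev cur
  pair : ∀ a < L, (T a = T₀ a ∧ H a = H₀ a) ∨ (T a = H₀ a ∧ H a = T₀ a)
  count : ∀ U : Set ℕ, ∀ [DecidablePred (· ∈ U)], σ ∈ U → τ ∉ U →
    ((Finset.range L).filter (T · ∈ U)).card + (if cur ∈ U then 1 else 0) + fl =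
      ((Finset.range L).filter (T₀ · ∈ U)).card
  source : ∀ a < L, T a = σ → T₀ a = σ
  parent : ∀ x < N, 2 ≤ lev x → lev x ≤ lev cur →
    par x < L ∧ H (par x) = x ∧ lev (T (par x)) + 1 = lev x ∧ T (par x) < N

/-! ### Reversal of one augmenting path -/

variable {N : ℕ} {lev par : ℕ → ℕ} {cur : ℕ}

theorem IsFlow.isTrace (hf : IsFlow L σ τ T₀ H₀ fl T H) {R : ℕ} (hb : IsBfs N L R σ T H lev par)
    (hτN : τ < N) (hτ : 0 < lev τ) (hT : ∀ a < L, T a < N) :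
    IsTrace L N σ τ T₀ H₀ fl lev par T H τ where
  lt := hτN
  pos := hτ
  pair := hf.pair
  count U _ h1 h2 := by rw [if_neg h2]; exact hf.count U h1 h2
  source := hf.source
  parent x hx h1 _ := by
    obtain ⟨h2, h3, h4⟩ := hb.parent x hx h1
    exact ⟨h2, h3, h4, hT _ h2⟩

theorem card_filter_update (L a x : ℕ) (ha : a < L) (T : ℕ → ℕ) (U : Set ℕ) [DecidablePred (· ∈ U)] :
    ((Finset.range L).filter (Function.update T a x · ∈ U)).card + (if T a ∈ U then 1 else 0) =
      ((Finset.range L).filter (T · ∈ U)).card + (if x ∈ U then 1 else 0) := by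
  have hins : Finset.range L = insert a ((Finset.range L).erase a) :=
    (Finset.insert_erase (Finset.mem_range.2 ha)).symm
  have h1 : ∀ f : ℕ → ℕ, ((Finset.range L).filter (f · ∈ U)).card =
      (((Finset.range L).erase a).filter (f · ∈ U)).card + if f a ∈ U then 1 else 0 := by
    intro f
    conv_lhs => rw [hins, Finset.filter_insert]
    split_ifs with h
    · rw [Finset.card_insert_of_notMem (by simp)]
    · rfl
  rw [h1 T, h1 (Function.update T a x), Function.update_self]
  have h2 : ((Finset.range L).erase a).filter (Function.update T a x · ∈ U) =
      ((Finset.range L).erase a).filter (T · ∈ U) := by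
    refine Finset.filter_congr fun b hb => ?_
    rw [Function.update_of_ne (Finset.ne_of_mem_erase hb)]
  rw [h2]
  omega

/-- Turning the parent arc of `cur` replaces its old tail by `cur` in the count of tails, and the
old tail becomes the new current node; so the extra term for the current node keeps the sum
constant. Parents are only claimed up to the level of `cur`, because just the parent arcs of higher
nodes have been turned. -/
theorem IsTrace.step (h : IsTrace L N σ τ T₀ H₀ fl lev par T H cur) (hcσ : cur ≠ σ)
    (hl : 2 ≤ lev cur) :
    IsTrace L N σ τ T₀ H₀ fl lev par (Function.update T (par cur) cur)
      (Function.update H (par cur) (T (par cur))) (T (par cur)) := by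
  obtain ⟨h1, h2, h3, h4⟩ := h.parent cur h.lt hl le_rfl
  refine ⟨h4, by omega, ?_, ?_, ?_, ?_⟩
  · intro a ha
    by_cases hac : a = par cur
    · subst hac
      have := h.pair _ ha
      simp only [Function.update_self]
      rw [h2] at this
      tauto
    · simp only [Function.update_of_ne hac]
      exact h.pair a ha
  · intro U _ hσ hτ
    have h5 := h.count U hσ hτ
    have h6 := card_filter_update L (par cur) cur h1 T U
    omega
  · intro a ha hs
    by_cases hac : a = par cur
    · subst hac
      rw [Function.update_self] at hs
      exact absurd hs hcσ
    · rw [Function.update_of_ne hac] at hs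
      exact h.source a ha hs
  · intro x hx hx2 hxl
    obtain ⟨h5, h6, h7, h8⟩ := h.parent x hx hx2 (by omega)
    have hne : par x ≠ par cur := fun he => by
      rw [he, h2] at h6
      subst h6
      omega
    rw [Function.update_of_ne hne, Function.update_of_ne hne]
    exact ⟨h5, h6, h7, h8⟩

theorem IsTrace.isFlow (h : IsTrace L N σ τ T₀ H₀ fl lev par T H σ) :
    IsFlow L σ τ T₀ H₀ (fl + 1) T H where
  pair := h.pair
  count U _ h1 h2 := by
    have := h.count U h1 h2
    rw [if_pos h1] at this
    omega
  source := h.source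

end Flow

/-! ### The flow network of a partial strategy -/

section Network

/-- The node from which the arcs out of the vertex `v` start. The source `2 * n` stands for the
vertices near the fire, the sink `2 * n + 1` for the critical ones; the other unprotected vertices
`v` are split into the nodes `v` and `v + n`. -/
def tl (n k : ℕ) (prot inC lev : ℕ → ℕ) (v : ℕ) : ℕ :=
  if 0 < inC v then 2 * n + 1 else if 0 < prot v then 2 * n + 1 else
    if 0 < lev v ∧ lev v < k + 2 then 2 * n else v + n

/-- The node in which the arcs into the vertex `v` end. -/
def hd (n k : ℕ) (prot inC lev : ℕ → ℕ) (v : ℕ) : ℕ :=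
  if 0 < inC v then 2 * n + 1 else if 0 < prot v then 2 * n else
    if 0 < lev v ∧ lev v < k + 2 then 2 * n else v

variable {I : Instance} (E : Encoding I)

/-- The vertex in which an arc of the network starts. -/
def Encoding.org (a : ℕ) : ℕ := if a < I.n + E.m then E.e1 (a - I.n) else E.e2 (a - I.n - E.m)

/-- The vertex in which an arc of the network ends. -/
def Encoding.dst (a : ℕ) : ℕ := if a < I.n + E.m then E.e2 (a - I.n) else E.e1 (a - I.n - E.m)

/-- The split arc of a vertex has the number of the vertex. The edges follow in their listed
orientation and then in the opposite one. -/
def Encoding.netT (prot inC lev : ℕ → ℕ) (a : ℕ) : ℕ :=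
  if a < I.n then a else tl I.n I.k prot inC lev (E.org a)

def Encoding.netH (prot inC lev : ℕ → ℕ) (a : ℕ) : ℕ :=
  if a < I.n then a + I.n else hd I.n I.k prot inC lev (E.dst a)

variable {E}

theorem Encoding.exists_arc {u v : Fin I.n} (huv : I.G.Adj u v) :
    ∃ a < I.n + 2 * E.m, I.n ≤ a ∧ E.org a = u ∧ E.dst a = v := by
  obtain ⟨e, he, h | h⟩ := (E.adj_iff u v).1 huv
  · refine ⟨I.n + e, by omega, by omega, ?_⟩
    simp only [Encoding.org, Encoding.dst, Nat.add_lt_add_iff_left, he, if_true]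
    simpa using h
  · refine ⟨I.n + E.m + e, by omega, by omega, ?_⟩
    have h1 : ¬ I.n + E.m + e < I.n + E.m := by omega
    have h2 : I.n + E.m + e - I.n - E.m = e := by omega
    simp only [Encoding.org, Encoding.dst, h1, if_false, h2]
    exact h.symm

variable (E)

theorem Encoding.adj_arc {a : ℕ} (ha : a < I.n + 2 * E.m) (hn : I.n ≤ a) :
    ∃ u v : Fin I.n, E.org a = u ∧ E.dst a = v ∧ I.G.Adj u v := by
  by_cases h : a < I.n + E.m
  · have he : a - I.n < E.m := by omega
    refine ⟨⟨_, E.e1_lt he⟩, ⟨_, E.e2_lt he⟩, by simp [Encoding.org, h], by simp [Encoding.dst, h],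
      (E.adj_iff _ _).2 ⟨_, he, Or.inl ⟨rfl, rfl⟩⟩⟩
  · have he : a - I.n - E.m < E.m := by omega
    refine ⟨⟨_, E.e2_lt he⟩, ⟨_, E.e1_lt he⟩, by simp [Encoding.org, h], by simp [Encoding.dst, h],
      (E.adj_iff _ _).2 ⟨_, he, Or.inr ⟨rfl, rfl⟩⟩⟩

theorem Encoding.org_lt {a : ℕ} (ha : a < I.n + 2 * E.m) (hn : I.n ≤ a) : E.org a < I.n := by
  obtain ⟨u, -, h, -⟩ := E.adj_arc ha hn
  rw [h]; exact u.2

theorem Encoding.dst_lt {a : ℕ} (ha : a < I.n + 2 * E.m) (hn : I.n ≤ a) : E.dst a < I.n := by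
  obtain ⟨-, v, -, h, -⟩ := E.adj_arc ha hn
  rw [h]; exact v.2

theorem Encoding.netT_lt (prot inC lev : ℕ → ℕ) {a : ℕ} (ha : a < I.n + 2 * E.m) :
    E.netT prot inC lev a < 2 * I.n + 2 := by
  unfold Encoding.netT tl
  by_cases h : a < I.n
  · simp only [h, if_true]; omega
  · have := E.org_lt ha (by omega)
    simp only [h, if_false]
    split_ifs <;> omega

theorem Encoding.netH_lt (prot inC lev : ℕ → ℕ) {a : ℕ} (ha : a < I.n + 2 * E.m) :
    E.netH prot inC lev a < 2 * I.n + 2 := by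
  unfold Encoding.netH hd
  by_cases h : a < I.n
  · simp only [h, if_true]; omega
  · have := E.dst_lt ha (by omega)
    simp only [h, if_false]
    split_ifs <;> omega

/-- The nodes that belong to the end points of edges, and the source and the sink. -/
def Encoding.netNodes : Finset ℕ :=
  {2 * I.n, 2 * I.n + 1} ∪ ((Finset.range E.m).image E.e1 ∪ (Finset.range E.m).image E.e2) ∪
    ((Finset.range E.m).image (E.e1 · + I.n) ∪ (Finset.range E.m).image (E.e2 · + I.n))

/-- This bounds the rounds of a search in the network by `m` alone, which avoids a term quadratic in
`n` in the running time. -/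
theorem Encoding.card_netNodes_le : E.netNodes.card ≤ 4 * E.m + 2 := by
  have h : ∀ f : ℕ → ℕ, ((Finset.range E.m).image f).card ≤ E.m := fun f =>
    Finset.card_image_le.trans (by simp)
  have h1 := h E.e1
  have h2 := h E.e2
  have h3 := h (E.e1 · + I.n)
  have h4 := h (E.e2 · + I.n)
  have h5 := Finset.card_le_two (a := 2 * I.n) (b := 2 * I.n + 1)
  unfold Encoding.netNodes
  refine (Finset.card_union_le _ _).trans ?_
  have h6 := Finset.card_union_le {2 * I.n, 2 * I.n + 1}
    ((Finset.range E.m).image E.e1 ∪ (Finset.range E.m).image E.e2)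
  have h7 := Finset.card_union_le ((Finset.range E.m).image E.e1) ((Finset.range E.m).image E.e2)
  have h8 := Finset.card_union_le ((Finset.range E.m).image (E.e1 · + I.n))
    ((Finset.range E.m).image (E.e2 · + I.n))
  omega

theorem Encoding.mem_netNodes_iff (x : ℕ) : x ∈ E.netNodes ↔ x = 2 * I.n ∨ x = 2 * I.n + 1 ∨
    ∃ e < E.m, E.e1 e = x ∨ E.e2 e = x ∨ E.e1 e + I.n = x ∨ E.e2 e + I.n = x := by
  simp only [Encoding.netNodes, Finset.mem_union, Finset.mem_insert, Finset.mem_singleton,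
    Finset.mem_image, Finset.mem_range]
  constructor
  · rintro (((h | h) | (⟨e, he, h⟩ | ⟨e, he, h⟩)) | (⟨e, he, h⟩ | ⟨e, he, h⟩))
    · exact Or.inl h
    · exact Or.inr (Or.inl h)
    all_goals exact Or.inr (Or.inr ⟨e, he, by tauto⟩)
  · rintro (h | h | ⟨e, he, h | h | h | h⟩)
    · exact Or.inl (Or.inl (Or.inl h))
    · exact Or.inl (Or.inl (Or.inr h))
    · exact Or.inl (Or.inr (Or.inl ⟨e, he, h⟩))
    · exact Or.inl (Or.inr (Or.inr ⟨e, he, h⟩))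
    · exact Or.inr (Or.inl ⟨e, he, h⟩)
    · exact Or.inr (Or.inr ⟨e, he, h⟩)

theorem Encoding.exists_edge_of_arc {a : ℕ} (ha : a < I.n + 2 * E.m) (hn : I.n ≤ a) :
    ∃ e < E.m, (E.org a = E.e1 e ∧ E.dst a = E.e2 e) ∨ (E.org a = E.e2 e ∧ E.dst a = E.e1 e) := by
  by_cases h : a < I.n + E.m
  · exact ⟨a - I.n, by omega, Or.inl ⟨by simp [Encoding.org, h], by simp [Encoding.dst, h]⟩⟩
  · exact ⟨a - I.n - E.m, by omega, Or.inr ⟨by simp [Encoding.org, h], by simp [Encoding.dst, h]⟩⟩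

/-- An equivalence is needed because reversal exchanges the ends of arcs: the set is then closed in
every residual network. A split arc of an isolated vertex has both ends outside it. -/
theorem Encoding.net_mem_netNodes (prot inC lev : ℕ → ℕ) {a : ℕ} (ha : a < I.n + 2 * E.m) :
    E.netT prot inC lev a ∈ E.netNodes ↔ E.netH prot inC lev a ∈ E.netNodes := by
  by_cases h : a < I.n
  · simp only [Encoding.netT, Encoding.netH, h, if_true, E.mem_netNodes_iff]
    constructor
    · rintro (h1 | h1 | ⟨e, he, h1 | h1 | h1 | h1⟩)
      · omega
      · omega
      · exact Or.inr (Or.inr ⟨e, he, by omega⟩)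
      · exact Or.inr (Or.inr ⟨e, he, by omega⟩)
      · omega
      · omega
    · rintro (h1 | h1 | ⟨e, he, h1⟩)
      · omega
      · omega
      · have := E.e1_lt he
        have := E.e2_lt he
        exact Or.inr (Or.inr ⟨e, he, by omega⟩)
  · obtain ⟨e, he, h1⟩ := E.exists_edge_of_arc ha (by omega)
    simp only [Encoding.netT, Encoding.netH, h, if_false, E.mem_netNodes_iff]
    refine iff_of_true ?_ ?_
    · unfold tl
      split_ifs
      · simp
      · simp
      · simp
      · exact Or.inr (Or.inr ⟨e, he, by omega⟩)
    · unfold hd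
      split_ifs
      · simp
      · simp
      · simp
      · exact Or.inr (Or.inr ⟨e, he, by omega⟩)

/-! ### Cuts and flows of the network compared with strategies -/

variable {E} {pl prot inC lev anc T H : ℕ → ℕ} {fl : ℕ}

theorem IsFlow.tail_lt
    (hF : IsFlow (I.n + 2 * E.m) (2 * I.n) (2 * I.n + 1) (E.netT prot inC lev) (E.netH prot inC lev) fl T H)
    {a : ℕ} (ha : a < I.n + 2 * E.m) : T a < 2 * I.n + 2 := by
  have h1 := E.netT_lt prot inC lev ha
  have h2 := E.netH_lt prot inC lev ha
  rcases hF.pair a ha with h | h <;> omega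

theorem IsFlow.head_lt
    (hF : IsFlow (I.n + 2 * E.m) (2 * I.n) (2 * I.n + 1) (E.netT prot inC lev) (E.netH prot inC lev) fl T H)
    {a : ℕ} (ha : a < I.n + 2 * E.m) : H a < 2 * I.n + 2 := by
  have h1 := E.netT_lt prot inC lev ha
  have h2 := E.netH_lt prot inC lev ha
  rcases hF.pair a ha with h | h <;> omega

/-- The source reaches no node outside `netNodes`, whose number does not exceed the number of
rounds. So the search is exhaustive despite its limit. -/
theorem IsFlow.closed_of_isBfs
    (hF : IsFlow (I.n + 2 * E.m) (2 * I.n) (2 * I.n + 1) (E.netT prot inC lev) (E.netH prot inC lev) fl T H)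
    {lev' par : ℕ → ℕ}
    (hb : IsBfs (2 * I.n + 2) (I.n + 2 * E.m) (4 * E.m + 2) (2 * I.n) T H lev' par) :
    ∀ a < I.n + 2 * E.m, 0 < lev' (T a) → 0 < lev' (H a) := by
  refine hb.closed (fun a ha => hF.tail_lt ha) E.card_netNodes_le
    ((E.mem_netNodes_iff _).2 (Or.inl rfl)) ?_ (by omega)
  intro a ha
  have := E.net_mem_netNodes prot inC lev ha
  rcases hF.pair a ha with ⟨h1, h2⟩ | ⟨h1, h2⟩
  · rw [h1, h2]; exact this.1
  · rw [h1, h2]; exact this.2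

/-- A closed set of the residual network yields a set of vertices whose protection is sufficient. -/
theorem exists_cut (hf : IsFire I (placed I pl) lev anc) (hp : IsProt I pl prot)
    (hC : ∀ v : Fin I.n, 0 < inC v ↔ v ∈ I.C) (hb : ∀ v, ¬ Bad I prot lev v)
    (hF : IsFlow (I.n + 2 * E.m) (2 * I.n) (2 * I.n + 1) (E.netT prot inC lev) (E.netH prot inC lev) fl T H)
    {U : Set ℕ} (hσ : 2 * I.n ∈ U) (hτ : 2 * I.n + 1 ∉ U)
    (hc : ∀ a < I.n + 2 * E.m, T a ∈ U → H a ∈ U) :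
    ∃ F : Finset (Fin I.n), F.card ≤ fl ∧ (∀ v ∈ F, v ∉ I.C) ∧
      (∀ v ∈ F, v ∉ touch I.G I.s (placed I pl) I.k) ∧
      ∀ i, ∀ v ∈ I.C, v ∉ touch I.G I.s (placed I pl ∪ F) i := by
  classical
  let far : Fin I.n → Prop := fun v =>
    prot v = 0 ∧ v ∉ I.C ∧ ¬ (0 < lev v ∧ lev v < I.k + 2)
  let near : Fin I.n → Prop := fun v => prot v = 0 ∧ v ∉ I.C ∧ (0 < lev v ∧ lev v < I.k + 2)
  let cut := (Finset.range (I.n + 2 * E.m)).filter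
    (fun a => E.netT prot inC lev a ∈ U ∧ E.netH prot inC lev a ∉ U)
  -- Every arc of the cut is charged to one vertex: a split arc to its vertex, an arc into the sink
  -- to its origin because a critical vertex must not be protected, and any other arc to its
  -- destination.
  let chg : ℕ → ℕ := fun a => if a < I.n then a else
    if E.netH prot inC lev a = 2 * I.n + 1 then E.org a else E.dst a
  let F : Finset (Fin I.n) := {v | far v ∧ ∃ a ∈ cut, chg a = v}
  have hmem : ∀ v, v ∈ F ↔ far v ∧ ∃ a ∈ cut, chg a = v := by simp [F]
  have hFcard : F.card ≤ fl := by
    refine le_trans ?_ (hF.card_cut_le U hσ hτ hc)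
    refine le_trans ?_ (Finset.card_image_le (s := cut) (f := chg))
    rw [← Finset.card_map Fin.valEmbedding]
    refine Finset.card_le_card fun x hx => ?_
    obtain ⟨v, hv, rfl⟩ := Finset.mem_map.1 hx
    obtain ⟨-, a, ha, hav⟩ := (hmem v).1 hv
    exact Finset.mem_image.2 ⟨a, ha, hav⟩
  have tl_near : ∀ v : Fin I.n, near v → tl I.n I.k prot inC lev v = 2 * I.n := by
    rintro v ⟨h1, h2, h3⟩
    simp [tl, hC, h1, h2, h3]
  have tl_far : ∀ v : Fin I.n, far v → tl I.n I.k prot inC lev v = v + I.n := by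
    rintro v ⟨h1, h2, h3⟩
    simp [tl, hC, h1, h2, h3]
  have hd_far : ∀ v : Fin I.n, far v → hd I.n I.k prot inC lev v = v := by
    rintro v ⟨h1, h2, h3⟩
    simp [hd, hC, h1, h2, h3]
  have hd_C : ∀ v : Fin I.n, v ∈ I.C → hd I.n I.k prot inC lev v = 2 * I.n + 1 := by
    intro v h
    simp [hd, hC, h]
  refine ⟨F, hFcard, fun v hv => ((hmem v).1 hv).1.2.1, ?_, ?_⟩
  · intro v hv ht
    rw [hf.mem_touch_iff v _ (by omega)] at ht
    exact ((hmem v).1 hv).1.2.2 (by omega)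
  -- The invariant of the fire: a burning vertex starts its arcs in a node of `U`, so a step out of
  -- `U` uses an arc of the cut and meets a vertex of `F`.
  let good : Fin I.n → Prop := fun v => near v ∨ (far v ∧ v + I.n ∈ U)
  have key : ∀ i, ∀ v ∈ touch I.G I.s (placed I pl ∪ F) i,
      v ∉ I.C ∧ (v ∉ placed I pl ∪ (F : Set (Fin I.n)) → good v) := by
    intro i
    induction i with
    | zero =>
      intro v hv
      obtain rfl : v = I.s := hv
      refine ⟨I.s_notMem, fun h => Or.inl ⟨?_, I.s_notMem, ?_⟩⟩
      · exact (hp.eq_zero_iff _).2 fun h' => h (Or.inl h')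
      · rw [hf.lev_source]; omega
    | succ i ih =>
      rintro v (hv | ⟨u, hu, huS, huv⟩)
      · exact ih v hv
      have hgu := (ih u hu).2 huS
      obtain ⟨a, ha, han, hau, hav⟩ := E.exists_arc huv
      have han' : ¬ a < I.n := by omega
      have hTa : E.netT prot inC lev a ∈ U := by
        simp only [Encoding.netT, han', if_false, hau]
        rcases hgu with h | ⟨h, h'⟩
        · rw [tl_near u h]; exact hσ
        · rw [tl_far u h]; exact h'
      have hHa : E.netH prot inC lev a = hd I.n I.k prot inC lev v := by
        simp only [Encoding.netH, han', if_false, hav]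
      have hvC : v ∉ I.C := by
        intro hvC
        rcases hgu with h | ⟨h, h'⟩
        -- A near vertex is touched by round `k` and would pass the fire to a critical neighbour by
        -- round `k + 1`, making it bad. For this reason the fire is followed one round beyond `k`.
        · have h1 : u ∈ touch I.G I.s (placed I pl) I.k :=
            (hf.mem_touch_iff u _ (by omega)).2 ⟨h.2.2.1, by have := h.2.2.2; omega⟩
          have h2 := mem_touch_succ h1 (fun h' => huS (Or.inl h')) huv
          rw [hf.mem_touch_iff v _ le_rfl] at h2
          exact hb v ⟨h2.1, Or.inr hvC⟩
        · refine huS (Or.inr ((hmem u).2 ⟨h, a, ?_, ?_⟩))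
          · simp only [cut, Finset.mem_filter, Finset.mem_range]
            exact ⟨ha, hTa, by rw [hHa, hd_C v hvC]; exact hτ⟩
          · simp only [chg, han', if_false, hHa, hd_C v hvC, if_true, hau]
      refine ⟨hvC, fun hvS => ?_⟩
      have hv0 : prot v = 0 := (hp.eq_zero_iff _).2 fun h' => hvS (Or.inl h')
      by_cases hvn : 0 < lev v ∧ lev v < I.k + 2
      · exact Or.inl ⟨hv0, hvC, hvn⟩
      have hvf : far v := ⟨hv0, hvC, hvn⟩
      have hin : (v : ℕ) ∈ U := by
        by_contra hvU
        refine hvS (Or.inr ((hmem v).2 ⟨hvf, a, ?_, ?_⟩))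
        · simp only [cut, Finset.mem_filter, Finset.mem_range]
          exact ⟨ha, hTa, by rw [hHa, hd_far v hvf]; exact hvU⟩
        · have : ¬ (v : ℕ) = 2 * I.n + 1 := by omega
          simp only [chg, han', if_false, hHa, hd_far v hvf, this, hav]
      refine Or.inr ⟨hvf, ?_⟩
      by_contra hout
      refine hvS (Or.inr ((hmem v).2 ⟨hvf, v, ?_, ?_⟩))
      · refine Finset.mem_filter.2 ⟨Finset.mem_range.2 (by omega), ?_, ?_⟩
        · rw [Encoding.netT, if_pos v.2]; exact hin
        · rw [Encoding.netH, if_pos v.2]; exact hout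
      · simp [chg]
  exact fun i v hv ht => (key i v ht).1 hv

theorem exists_saves_of_flow (hpl : IsPartial I pl) (hf : IsFire I (placed I pl) lev anc)
    (hp : IsProt I pl prot) (hC : ∀ v : Fin I.n, 0 < inC v ↔ v ∈ I.C)
    (hroom : I.k = 0 ∨ I.C.card + 2 ≤ I.n) (hb : ∀ v, ¬ Bad I prot lev v)
    (hF : IsFlow (I.n + 2 * E.m) (2 * I.n) (2 * I.n + 1) (E.netT prot inC lev) (E.netH prot inC lev) fl T H)
    (hfl : fl ≤ (free I pl).card)
    {U : Set ℕ} (hσ : 2 * I.n ∈ U) (hτ : 2 * I.n + 1 ∉ U)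
    (hc : ∀ a < I.n + 2 * E.m, T a ∈ U → H a ∈ U) :
    ∃ h, Saves I h := by
  obtain ⟨F, h1, h2, h3, h4⟩ := exists_cut hf hp hC hb hF hσ hτ hc
  obtain ⟨h, hs, -⟩ := exists_saves_of_partial hpl (h1.trans hfl) h2 hroom
    (on_time_of_not_bad hf hp hb) h3 h4
  exact ⟨h, hs⟩

/-- A flow that exceeds the number of free positions has to be interrupted near the fire. -/
theorem exists_exit {h : Fin I.k → Fin I.n} (hpl : IsPartial I pl)
    (hp : IsProt I pl prot) (hC : ∀ v : Fin I.n, 0 < inC v ↔ v ∈ I.C)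
    (hF : IsFlow (I.n + 2 * E.m) (2 * I.n) (2 * I.n + 1) (E.netT prot inC lev) (E.netH prot inC lev) fl T H)
    (hfl : (free I pl).card < fl) (hs : Saves I h) (hx : Extends I h pl) :
    ∃ a < I.n + 2 * E.m, E.netT prot inC lev a = 2 * I.n ∧ T a ≠ 2 * I.n ∧
      ∃ w : Fin I.n, E.org a = w ∧ 0 < lev w ∧
        ((w ∈ Set.range h ∧ w ∉ placed I pl) ∨ w ∉ touch I.G I.s (Set.range h) (lev w - 1)) := by
  classical
  by_contra! hno
  let far : Fin I.n → Prop := fun v =>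
    prot v = 0 ∧ v ∉ I.C ∧ ¬ (0 < lev v ∧ lev v < I.k + 2)
  let Rch : Fin I.n → Prop := fun v => v ∉ Set.range h ∧ ∃ i, v ∈ touch I.G I.s (Set.range h) i
  -- Under the solution `h`, the fire enters the in-nodes of far vertices that it reaches, and of
  -- vertices placed by `h`, but only the reached ones lead on to out-nodes.
  let U : Set ℕ := {x | x = 2 * I.n ∨
    ∃ v : Fin I.n, far v ∧ ((x = v ∧ (Rch v ∨ v ∈ Set.range h)) ∨ (x = v + I.n ∧ Rch v))}
  have hσ : 2 * I.n ∈ U := Or.inl rfl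
  have hτ : 2 * I.n + 1 ∉ U := by
    rintro (h1 | ⟨v, -, h1 | h1⟩) <;> omega
  have h1 := hF.le_card_of_mem U hσ hτ
  -- A filled position holds a placed vertex, so the new vertices of `h` sit in free positions.
  have hnew : ((Finset.univ : Finset (Fin I.n)).filter
      (fun v => v ∈ Set.range h ∧ v ∉ placed I pl)).card ≤ (free I pl).card := by
    refine le_trans (Finset.card_le_card (t := (free I pl).image
      (fun p => if hpk : p < I.k then h ⟨p, hpk⟩ else I.s)) ?_) Finset.card_image_le
    intro v hv
    obtain ⟨-, ⟨p, rfl⟩, hvp⟩ := Finset.mem_filter.1 hv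
    refine Finset.mem_image.2 ⟨p, ?_, by simp⟩
    simp only [free, Finset.mem_filter, Finset.mem_range]
    refine ⟨p.2, ?_⟩
    by_contra h0
    rcases hpl p p.2 with h2 | ⟨v, -, hv⟩
    · exact h0 h2
    · exact hvp ⟨p, p.2, by rw [(hx p v hv).1]; exact hv⟩
  refine absurd (hfl.trans_le (h1.trans ?_)) (lt_irrefl _)
  refine le_trans ?_ hnew
  rw [← Finset.card_map Fin.valEmbedding]
  refine Finset.card_le_card fun a ha => ?_
  simp only [Finset.mem_filter, Finset.mem_range] at ha
  obtain ⟨ha, hTU, hTU'⟩ := ha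
  have hflip : T a = E.netH prot inC lev a := by
    rcases hF.pair a ha with ⟨h2, -⟩ | ⟨h2, -⟩
    · exact absurd (h2 ▸ hTU) hTU'
    · exact h2
  rw [hflip] at hTU'
  by_cases han : a < I.n
  · simp only [Encoding.netT, Encoding.netH, han, if_true] at hTU hTU'
    rcases hTU with h2 | ⟨v, hv, ⟨rfl, h2⟩ | ⟨h2, -⟩⟩
    · omega
    · refine Finset.mem_map.2 ⟨v, ?_, rfl⟩
      simp only [Finset.mem_filter, Finset.mem_univ, true_and]
      refine ⟨?_, (hp.eq_zero_iff v).1 hv.1⟩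
      rcases h2 with h2 | h2
      · exact absurd (Or.inr ⟨v, hv, Or.inr ⟨rfl, h2⟩⟩) hTU'
      · exact h2
    · omega
  -- Only split arcs of newly placed vertices can leave `U`. The origin of an edge arc burns under
  -- `h`, so its other end is touched and not critical, and the arc ends in `U`.
  · exfalso
    obtain ⟨u, v, hu, hv, huv⟩ := E.adj_arc ha (by omega)
    have hT0 : E.netT prot inC lev a = tl I.n I.k prot inC lev u := by
      simp only [Encoding.netT, han, if_false, hu]
    have hH0 : E.netH prot inC lev a = hd I.n I.k prot inC lev v := by
      simp only [Encoding.netH, han, if_false, hv]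
    have hRu : Rch u := by
      rw [hT0] at hTU
      rcases hTU with h2 | ⟨w, hw, ⟨h2, -⟩ | ⟨h2, h3⟩⟩
      · have hlu : 0 < lev u ∧ prot u = 0 := by
          unfold tl at h2
          split_ifs at h2 with h3 h4 h5
          · omega
          · omega
          · exact ⟨h5.1, by omega⟩
          · omega
        have hTa : T a ≠ 2 * I.n := by
          rw [hflip]
          intro h3
          exact hTU' (Or.inl h3)
        -- The arc is an exit of the flow. By assumption its origin is neither newly placed nor
        -- delayed by `h`, hence it burns.
        obtain ⟨h3, h4⟩ := hno a ha (by rw [hT0, h2]) hTa u hu hlu.1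
        exact ⟨fun h5 => (hp.eq_zero_iff u).1 hlu.2 (h3 h5), _, h4⟩
      · unfold tl at h2
        split_ifs at h2 <;> omega
      · have : u = w := by
          unfold tl at h2
          split_ifs at h2 <;> apply Fin.ext <;> omega
        rw [this]; exact h3
    obtain ⟨huS, i, hi⟩ := hRu
    have htv := mem_touch_succ hi huS huv
    have hvC : v ∉ I.C := fun hvC => hs.safe _ v hvC htv
    rw [hH0] at hTU'
    unfold hd at hTU'
    simp only [hC, hvC, if_false] at hTU'
    split_ifs at hTU' with h2 h3
    · exact hTU' hσ
    · exact hTU' hσ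
    · refine hTU' (Or.inr ⟨v, ⟨by omega, hvC, h3⟩, Or.inl ⟨rfl, ?_⟩⟩)
      by_cases hvS : v ∈ Set.range h
      · exact Or.inr hvS
      · exact Or.inl ⟨hvS, _, htv⟩

end Network

end Firefighter

namespace Firefighter

/-! ### Verification of programs -/

@[simp] theorem State.setReg_reg (σ : State) (x v y : ℕ) :
    (σ.setReg x v).reg y = if y = x then v else σ.reg y := by
  simp [State.setReg, Function.update_apply]

@[simp] theorem State.setReg_arr (σ : State) (x v : ℕ) : (σ.setReg x v).arr = σ.arr := rfl

@[simp] theorem State.setArr_reg (σ : State) (a i v : ℕ) : (σ.setArr a i v).reg = σ.reg := rfl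

@[simp] theorem State.setArr_arr (σ : State) (a i v b : ℕ) :
    (σ.setArr a i v).arr b = if b = a then Function.update (σ.arr a) i v else σ.arr b := by
  simp only [State.setArr, Function.update_apply]

@[simp] theorem State.ite_reg (c : Prop) [Decidable c] (σ τ : State) (x : ℕ) :
    (if c then σ else τ).reg x = if c then σ.reg x else τ.reg x := by
  split_ifs <;> rfl

@[simp] theorem State.ite_arr (c : Prop) [Decidable c] (σ τ : State) (a : ℕ) :
    (if c then σ else τ).arr a = if c then σ.arr a else τ.arr a := by
  split_ifs <;> rfl

namespace Prog

/-- Whether the program may write to a register. -/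
def wr : Prog → ℕ → Bool
  | skip, _ => false
  | const x _, r => r == x
  | add x _ _, r => r == x
  | sub x _ _, r => r == x
  | load x _ _, r => r == x
  | store _ _ _, _ => false
  | seq p q, r => p.wr r || q.wr r
  | ifLt _ _ p q, r => p.wr r || q.wr r
  | whileLt _ _ p, r => p.wr r

/-- Whether the program may write to an array. -/
def wa : Prog → ℕ → Bool
  | store a _ _, r => r == a
  | seq p q, r => p.wa r || q.wa r
  | ifLt _ _ p q, r => p.wa r || q.wa r
  | whileLt _ _ p, r => p.wa r
  | _, _ => false

/-- Whether the program is without loops. -/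
def straight : Prog → Bool
  | seq p q => p.straight && q.straight
  | ifLt _ _ p q => p.straight && q.straight
  | whileLt _ _ _ => false
  | _ => true

/-- The number of instructions. -/
def size : Prog → ℕ
  | seq p q => p.size + q.size
  | ifLt _ _ p q => p.size + q.size + 1
  | whileLt _ _ p => p.size + 1
  | _ => 1

/-- The effect of a program without loops. -/
def ev : Prog → State → State
  | skip, σ => σ
  | const x c, σ => σ.setReg x c
  | add x y z, σ => σ.setReg x (σ.reg y + σ.reg z)
  | sub x y z, σ => σ.setReg x (σ.reg y - σ.reg z)
  | load x a y, σ => σ.setReg x (σ.arr a (σ.reg y))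
  | store a x y, σ => σ.setArr a (σ.reg x) (σ.reg y)
  | seq p q, σ => q.ev (p.ev σ)
  | ifLt x y p q, σ => if σ.reg x < σ.reg y then p.ev σ else q.ev σ
  | whileLt _ _ _, σ => σ

end Prog

/-- The states `σ` and `τ` agree on everything that `p` does not write to. -/
def Frame (p : Prog) (σ τ : State) : Prop :=
  (∀ x, p.wr x = false → τ.reg x = σ.reg x) ∧ ∀ a, p.wa a = false → τ.arr a = σ.arr a

theorem Frame.refl (p : Prog) (σ : State) : Frame p σ σ := ⟨fun _ _ => rfl, fun _ _ => rfl⟩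

theorem Frame.trans {p : Prog} {σ τ υ : State} (h : Frame p σ τ) (h' : Frame p τ υ) :
    Frame p σ υ :=
  ⟨fun x hx => (h'.1 x hx).trans (h.1 x hx), fun a ha => (h'.2 a ha).trans (h.2 a ha)⟩

theorem Frame.mono {p q : Prog} {σ τ : State} (h : Frame p σ τ)
    (hr : ∀ x, q.wr x = false → p.wr x = false) (ha : ∀ a, q.wa a = false → p.wa a = false) :
    Frame q σ τ :=
  ⟨fun x hx => h.1 x (hr x hx), fun a h' => h.2 a (ha a h')⟩

theorem Exec.frame {p : Prog} {σ τ : State} {t : ℕ} (h : Exec p σ τ t) : Frame p σ τ := by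
  induction h with
  | skip => exact Frame.refl _ _
  | const | add | sub | load | store =>
    constructor <;> intro x hx <;> simp_all [Prog.wr, Prog.wa]
  | seq _ _ ih1 ih2 =>
    refine Frame.trans (ih1.mono ?_ ?_) (ih2.mono ?_ ?_) <;> intro x hx <;>
      simp_all [Prog.wr, Prog.wa]
  | if_true _ _ ih => refine ih.mono ?_ ?_ <;> intro x hx <;> simp_all [Prog.wr, Prog.wa]
  | if_false _ _ ih => refine ih.mono ?_ ?_ <;> intro x hx <;> simp_all [Prog.wr, Prog.wa]
  | while_true _ _ _ ih1 ih2 => exact Frame.trans (ih1.mono (fun _ h => h) fun _ h => h) ih2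
  | while_false => exact Frame.refl _ _

/-- Started in `σ`, the program `p` halts within `T` steps in a state that satisfies `Q`. -/
def Runs (p : Prog) (σ : State) (T : ℕ) (Q : State → Prop) : Prop :=
  ∃ τ t, Exec p σ τ t ∧ t ≤ T ∧ Q τ

namespace Runs

variable {p q : Prog} {σ : State} {T T' : ℕ} {Q Q' : State → Prop}

theorem frame (h : Runs p σ T Q) : Runs p σ T fun τ => Q τ ∧ Frame p σ τ := by
  obtain ⟨τ, t, h1, h2, h3⟩ := h
  exact ⟨τ, t, h1, h2, h3, h1.frame⟩

theorem mono (h : Runs p σ T Q) (hT : T ≤ T') (hQ : ∀ τ, Q τ → Q' τ) : Runs p σ T' Q' := by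
  obtain ⟨τ, t, h1, h2, h3⟩ := h
  exact ⟨τ, t, h1, h2.trans hT, hQ τ h3⟩

theorem conseq (h : Runs p σ T Q) (hQ : ∀ τ, Frame p σ τ → Q τ → Q' τ) : Runs p σ T Q' :=
  h.frame.mono le_rfl fun τ hτ => hQ τ hτ.2 hτ.1

theorem seq (h : Runs p σ T Q) (h' : ∀ τ, Frame p σ τ → Q τ → Runs q τ T' Q') :
    Runs (.seq p q) σ (T + T') Q' := by
  obtain ⟨τ, t, h1, h2, h3⟩ := h
  obtain ⟨υ, u, h4, h5, h6⟩ := h' τ h1.frame h3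
  exact ⟨υ, t + u, .seq h1 h4, by omega, h6⟩

theorem ifLt {x y : ℕ} (h : σ.reg x < σ.reg y → Runs p σ T Q)
    (h' : ¬ σ.reg x < σ.reg y → Runs q σ T Q) : Runs (.ifLt x y p q) σ (T + 1) Q := by
  by_cases hxy : σ.reg x < σ.reg y
  · obtain ⟨τ, t, h1, h2, h3⟩ := h hxy
    exact ⟨τ, t + 1, .if_true hxy h1, by omega, h3⟩
  · obtain ⟨τ, t, h1, h2, h3⟩ := h' hxy
    exact ⟨τ, t + 1, .if_false hxy h1, by omega, h3⟩

/-- Code without loops is replaced by the function `Prog.ev`, so loop bodies are verified by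
simplification, and their time bounds by evaluating `Prog.size`. -/
theorem ev (hs : p.straight = true) (hT : p.size ≤ T) (hQ : Q (p.ev σ)) : Runs p σ T Q := by
  have key : ∀ (p : Prog) (σ : State), p.straight = true → ∃ t ≤ p.size, Exec p σ (p.ev σ) t := by
    intro p
    induction p with
    | skip => exact fun σ _ => ⟨1, le_rfl, .skip σ⟩
    | const => exact fun σ _ => ⟨1, le_rfl, .const σ _ _⟩
    | add => exact fun σ _ => ⟨1, le_rfl, .add σ _ _ _⟩
    | sub => exact fun σ _ => ⟨1, le_rfl, .sub σ _ _ _⟩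
    | load => exact fun σ _ => ⟨1, le_rfl, .load σ _ _ _⟩
    | store => exact fun σ _ => ⟨1, le_rfl, .store σ _ _ _⟩
    | seq p q ihp ihq =>
      intro σ h
      simp only [Prog.straight, Bool.and_eq_true] at h
      obtain ⟨t, ht, h1⟩ := ihp σ h.1
      obtain ⟨u, hu, h2⟩ := ihq (p.ev σ) h.2
      exact ⟨t + u, by simp only [Prog.size]; omega, .seq h1 h2⟩
    | ifLt x y p q ihp ihq =>
      intro σ h
      simp only [Prog.straight, Bool.and_eq_true] at h
      by_cases hxy : σ.reg x < σ.reg y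
      · obtain ⟨t, ht, h1⟩ := ihp σ h.1
        exact ⟨t + 1, by simp only [Prog.size]; omega,
          by simpa only [Prog.ev, hxy, if_true] using Exec.if_true hxy h1⟩
      · obtain ⟨t, ht, h1⟩ := ihq σ h.2
        exact ⟨t + 1, by simp only [Prog.size]; omega,
          by simpa only [Prog.ev, hxy, if_false] using Exec.if_false hxy h1⟩
    | whileLt => exact fun σ h => by simp [Prog.straight] at h
  obtain ⟨t, ht, h⟩ := key p σ hs
  exact ⟨_, t, h, ht.trans hT, hQ⟩

end Runs

/-- `for i < n do p`, with the scratch register `5`. -/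
def Prog.loop (i n : ℕ) (p : Prog) : Prog :=
  .seq (.const i 0) (.whileLt i n (.seq p (.seq (.const 5 1) (.add i i 5))))

/-- The rule for loops. The invariant may use everything that the loop does not write to. -/
theorem Runs.loop {i n : ℕ} {p : Prog} {σ : State} {T : ℕ} (Inv : ℕ → State → Prop)
    {N : ℕ} (hN : σ.reg n = N) (hi : p.wr i = false) (hn : (Prog.loop i n p).wr n = false)
    (hi5 : i ≠ 5) (h0 : Inv 0 (σ.setReg i 0))
    (hstep : ∀ j < N, ∀ τ, Frame (Prog.loop i n p) σ τ → τ.reg i = j → Inv j τ →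
      Runs p τ T fun υ => Inv (j + 1) ((υ.setReg 5 1).setReg i (j + 1))) :
    Runs (Prog.loop i n p) σ (N * (T + 3) + 2) fun τ => Inv N τ := by
  subst hN
  have key : ∀ d j, j + d = σ.reg n → ∀ τ, Frame (Prog.loop i n p) σ τ → τ.reg i = j → Inv j τ →
      Runs (.whileLt i n (.seq p (.seq (.const 5 1) (.add i i 5)))) τ (d * (T + 3) + 1)
        fun τ => Inv (σ.reg n) τ := by
    intro d
    induction d with
    | zero =>
      intro j hj τ hτ hij hI
      have hτn := hτ.1 n hn
      refine ⟨τ, 1, .while_false (by omega), by omega, ?_⟩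
      rw [← hj]; exact hI
    | succ d ih =>
      intro j hj τ hτ hij hI
      have hτn := hτ.1 n hn
      obtain ⟨υ, t, h1, h2, h3⟩ := hstep j (by omega) τ hτ hij hI
      have hυi : υ.reg i = j := by rw [h1.frame.1 i hi, hij]
      have hE : Exec (.seq p (.seq (.const 5 1) (.add i i 5))) τ
          ((υ.setReg 5 1).setReg i (j + 1)) (t + (1 + 1)) := by
        refine .seq h1 (.seq (.const υ 5 1) ?_)
        have := Exec.add (υ.setReg 5 1) i i 5
        simpa [hi5, hυi] using this
      have hF : Frame (Prog.loop i n p) τ ((υ.setReg 5 1).setReg i (j + 1)) := by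
        refine hE.frame.mono ?_ ?_ <;> intro x hx <;>
          simp_all [Prog.loop, Prog.wr, Prog.wa]
      obtain ⟨ω, u, h4, h5, h6⟩ := ih (j + 1) (by omega) _ (hτ.trans hF) (by simp) h3
      exact ⟨ω, _, .while_true (by omega) hE h4, by rw [Nat.succ_mul]; omega, h6⟩
  have h1 : Frame (Prog.loop i n p) σ (σ.setReg i 0) :=
    (Exec.const σ i 0).frame.mono (fun x hx => by simp_all [Prog.loop, Prog.wr])
      (fun x hx => by simp_all [Prog.wa])
  have h2 := key (σ.reg n) 0 (by omega) _ h1 (by simp) h0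
  obtain ⟨ω, u, h4, h5, h6⟩ := h2
  exact ⟨ω, 1 + u, .seq (.const σ i 0) h4, by omega, h6⟩

infixr:55 " ;; " => Prog.seq

end Firefighter

namespace Firefighter

/-! ### The constants of the program -/

/-- The constant registers and arrays: besides the input, some numbers that are computed once, and
the array `3` with the indicator function of the critical set. -/
structure Env {I : Instance} (E : Encoding I) (σ : State) : Prop where
  n : σ.reg 0 = I.n
  m : σ.reg 1 = E.m
  s : σ.reg 2 = I.s
  k : σ.reg 4 = I.k
  zero : σ.reg 6 = 0
  one : σ.reg 7 = 1
  k1 : σ.reg 8 = I.k + 1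
  k2 : σ.reg 9 = I.k + 2
  source : σ.reg 10 = 2 * I.n
  sink : σ.reg 11 = 2 * I.n + 1
  arcs : σ.reg 12 = I.n + 2 * E.m
  fireArcs : σ.reg 13 = 2 * E.m
  rounds : σ.reg 14 = 4 * E.m + 2
  nodes : σ.reg 15 = 2 * I.n + 2
  fireNodes : σ.reg 16 = I.n + 1
  edge₁ : σ.arr 0 = E.e1
  edge₂ : σ.arr 1 = E.e2
  crit : ∀ v : Fin I.n, 0 < σ.arr 3 v ↔ v ∈ I.C

/-- Both side conditions are decidable for concrete programs, so the constants survive each piece of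
code by `decide`. Register `5` is exempt as the scratch register of all loops. -/
theorem Env.frame {I : Instance} {E : Encoding I} {σ τ : State} {p : Prog} (h : Env E σ)
    (hf : Frame p σ τ) (hr : ∀ x < 17, x ≠ 5 → p.wr x = false) (ha : ∀ a < 4, p.wa a = false) :
    Env E τ := by
  have h1 := fun x hx hx5 => hf.1 x (hr x hx hx5)
  have h2 := fun a hx => hf.2 a (ha a hx)
  constructor
  · rw [h1 _ (by decide) (by decide), h.n]
  · rw [h1 _ (by decide) (by decide), h.m]
  · rw [h1 _ (by decide) (by decide), h.s]
  · rw [h1 _ (by decide) (by decide), h.k]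
  · rw [h1 _ (by decide) (by decide), h.zero]
  · rw [h1 _ (by decide) (by decide), h.one]
  · rw [h1 _ (by decide) (by decide), h.k1]
  · rw [h1 _ (by decide) (by decide), h.k2]
  · rw [h1 _ (by decide) (by decide), h.source]
  · rw [h1 _ (by decide) (by decide), h.sink]
  · rw [h1 _ (by decide) (by decide), h.arcs]
  · rw [h1 _ (by decide) (by decide), h.fireArcs]
  · rw [h1 _ (by decide) (by decide), h.rounds]
  · rw [h1 _ (by decide) (by decide), h.nodes]
  · rw [h1 _ (by decide) (by decide), h.fireNodes]
  · rw [h2 _ (by decide), h.edge₁]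
  · rw [h2 _ (by decide), h.edge₂]
  · rw [h2 _ (by decide)]; exact h.crit

/-! ### Breadth first search -/

/-- The situation within the round `r`, after the first `j` arcs have been scanned. -/
structure BfsRound (N L r j x₀ : ℕ) (T H lev par : ℕ → ℕ) : Prop where
  source : lev x₀ = 1
  eq_source : ∀ x < N, lev x = 1 → x = x₀
  le : ∀ x < N, lev x ≤ r + 2
  parent : ∀ x < N, 2 ≤ lev x → par x < L ∧ H (par x) = x ∧ lev (T (par x)) + 1 = lev x
  forward : ∀ a < L, 0 < lev (T a) → lev (T a) ≤ r → 0 < lev (H a) ∧ lev (H a) ≤ lev (T a) + 1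
  scanned : ∀ a < j, lev (T a) = r + 1 → 0 < lev (H a)

section Bfs

variable {N L r j x₀ : ℕ} {T H lev par : ℕ → ℕ}

theorem IsBfs.round (h : IsBfs N L r x₀ T H lev par) : BfsRound N L r 0 x₀ T H lev par where
  source := h.source
  eq_source := h.eq_source
  le x hx := (h.le x hx).trans (Nat.le_succ _)
  parent := h.parent
  forward := h.forward
  scanned _ ha := absurd ha (Nat.not_lt_zero _)

theorem BfsRound.isBfs (h : BfsRound N L r L x₀ T H lev par) (hH : ∀ a < L, H a < N) :
    IsBfs N L (r + 1) x₀ T H lev par where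
  source := h.source
  eq_source := h.eq_source
  le := h.le
  parent := h.parent
  forward a ha h0 _ := by
    rcases Nat.lt_or_ge r (lev (T a)) with h1 | h1
    · have := h.le (H a) (hH a ha)
      exact ⟨h.scanned a ha (by omega), by omega⟩
    · exact h.forward a ha h0 h1

theorem BfsRound.skip (h : BfsRound N L r j x₀ T H lev par) (hj : lev (T j) = r + 1 → 0 < lev (H j)) :
    BfsRound N L r (j + 1) x₀ T H lev par where
  source := h.source
  eq_source := h.eq_source
  le := h.le
  parent := h.parent
  forward := h.forward
  scanned a ha := by
    rcases Nat.lt_succ_iff_lt_or_eq.1 ha with h1 | rfl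
    · exact h.scanned a h1
    · exact hj

/-- The program only tests that the level of the tail is positive and below `r + 2`. Tails of level
at most `r` already have reached heads, so a fresh head forces the level `r + 1`; nodes found in the
current round have level `r + 2` and are not expanded yet. -/
theorem BfsRound.step (h : BfsRound N L r j x₀ T H lev par) (hjL : j < L)
    (h0 : 0 < lev (T j)) (hl : lev (T j) < r + 2) (hHj : lev (H j) = 0) :
    BfsRound N L r (j + 1) x₀ T H (Function.update lev (H j) (r + 2))
      (Function.update par (H j) j) := by
  have hlj : lev (T j) = r + 1 := by
    by_contra hne
    have := h.forward j hjL h0 (by omega)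
    omega
  have hup : ∀ x, lev x ≠ 0 → Function.update lev (H j) (r + 2) x = lev x := fun x hx =>
    Function.update_of_ne (fun he => hx (by rw [he, hHj])) _ _
  have hTup : ∀ a < L, Function.update lev (H j) (r + 2) (T a) ≤ r + 1 →
      Function.update lev (H j) (r + 2) (T a) = lev (T a) := by
    intro a _ hle
    by_cases he : T a = H j
    · rw [he, Function.update_self] at hle
      omega
    · exact Function.update_of_ne he _ _
  refine ⟨?_, ?_, ?_, ?_, ?_, ?_⟩
  · rw [hup _ (by rw [h.source]; omega), h.source]
  · intro x hx hx1
    by_cases he : x = H j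
    · subst he
      rw [Function.update_self] at hx1
      omega
    · rw [Function.update_of_ne he] at hx1
      exact h.eq_source x hx hx1
  · intro x hx
    rw [Function.update_apply]
    split_ifs
    · exact le_rfl
    · exact h.le x hx
  · intro x hx hx2
    by_cases he : x = H j
    · subst he
      simp only [Function.update_self]
      refine ⟨hjL, trivial, ?_⟩
      rw [hup _ (by omega)]
      omega
    · rw [Function.update_of_ne he] at hx2 ⊢
      rw [Function.update_of_ne he]
      obtain ⟨h1, h2, h3⟩ := h.parent x hx hx2
      exact ⟨h1, h2, by rw [hup _ (by omega)]; exact h3⟩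
  · intro a ha h1 h2
    have he := hTup a ha (by omega)
    rw [he] at h1 h2 ⊢
    have h3 := h.forward a ha h1 h2
    rw [hup _ (by omega)]
    exact h3
  · intro a ha h1
    rw [Function.update_apply]
    split_ifs with he
    · omega
    · have haL : a < L := by omega
      rw [hTup a haL (by omega)] at h1
      rcases Nat.lt_succ_iff_lt_or_eq.1 ha with h2 | rfl
      · exact h.scanned a h2 h1
      · exact absurd rfl he

end Bfs

namespace Prog

/-- Scan one arc: the arcs are in the arrays `5` and `6`, levels in `7`, parents in `8`. -/
def bfsArc : Prog :=
  load 32 5 26 ;; load 33 7 32 ;;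
  ifLt 6 33 (ifLt 33 31 (load 34 6 26 ;; load 35 7 34 ;;
    ifLt 35 7 (store 7 34 31 ;; store 8 34 26) skip) skip) skip

/-- Breadth first search from the node in register `21`; the registers `22`, `23`, `24` hold the
number of arcs, of rounds and of nodes. -/
def bfs : Prog :=
  loop 25 24 (store 7 25 6) ;; store 7 21 7 ;;
  loop 25 23 (add 30 25 7 ;; add 31 30 7 ;; loop 26 22 bfsArc)

end Prog

theorem runs_bfs {σ : State} (h0 : σ.reg 6 = 0) (h1 : σ.reg 7 = 1) {N L R x₀ : ℕ}
    (hx : σ.reg 21 = x₀) (hL : σ.reg 22 = L) (hR : σ.reg 23 = R) (hN : σ.reg 24 = N)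
    (hH : ∀ a < L, σ.arr 6 a < N) :
    Runs .bfs σ (N * 4 + R * (L * 15 + 7) + 5)
      fun τ => IsBfs N L R x₀ (σ.arr 5) (σ.arr 6) (τ.arr 7) (τ.arr 8) := by
  have hclear : Runs (.loop 25 24 (.store 7 25 6)) σ (N * (1 + 3) + 2)
      fun τ => ∀ x < N, τ.arr 7 x = 0 := by
    refine Runs.loop (fun j τ => ∀ x < j, τ.arr 7 x = 0) hN (by decide) (by decide) (by decide)
      (by simp) ?_
    intro j _ τ hτ hj hI
    refine Runs.ev (by decide) (by decide) ?_
    have h6 : τ.reg 6 = 0 := by rw [hτ.1 6 (by decide), h0]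
    intro x hx
    simp only [Prog.ev, State.setReg_arr, State.setArr_arr, if_true, hj, h6, Function.update_apply]
    split_ifs with h
    · rfl
    · exact hI x (by omega)
  have hround : ∀ τ, Frame (.loop 25 24 (.store 7 25 6) ;; .store 7 21 7) σ τ →
      IsBfs N L 0 x₀ (σ.arr 5) (σ.arr 6) (τ.arr 7) (τ.arr 8) →
      Runs (.loop 25 23 (.add 30 25 7 ;; .add 31 30 7 ;; .loop 26 22 .bfsArc)) τ
        (R * ((1 + (1 + (L * (12 + 3) + 2))) + 3) + 2)
        fun τ => IsBfs N L R x₀ (σ.arr 5) (σ.arr 6) (τ.arr 7) (τ.arr 8) := by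
    intro τ hτ hI
    have hRτ : τ.reg 23 = R := by rw [hτ.1 23 (by decide), hR]
    refine Runs.loop (fun r τ => IsBfs N L r x₀ (σ.arr 5) (σ.arr 6) (τ.arr 7) (τ.arr 8)) hRτ
      (by decide) (by decide) (by decide) (by simpa using hI) ?_
    intro r _ υ hυ hr hI
    have h7 : υ.reg 7 = 1 := by rw [hυ.1 7 (by decide), hτ.1 7 (by decide), h1]
    refine Runs.seq (Q := fun ω => ω = υ.setReg 30 (r + 1)) (.ev (by decide) (by decide)
      (by simp [Prog.ev, hr, h7])) ?_
    rintro _ - rfl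
    refine Runs.seq (Q := fun ω => ω = (υ.setReg 30 (r + 1)).setReg 31 (r + 2))
      (.ev (by decide) (by decide) (by simp [Prog.ev, h7])) ?_
    rintro _ - rfl
    have hL' : ((υ.setReg 30 (r + 1)).setReg 31 (r + 2)).reg 22 = L := by
      simp [hυ.1 22 (by decide), hτ.1 22 (by decide), hL]
    refine (Runs.loop (fun j τ => BfsRound N L r j x₀ (σ.arr 5) (σ.arr 6) (τ.arr 7) (τ.arr 8)) hL'
      (by decide) (by decide) (by decide) (by simpa using hI.round) ?_).mono le_rfl ?_
    · intro j hj ω hω hjω hI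
      have h6 : ω.reg 6 = 0 := by
        rw [hω.1 6 (by decide)]
        simp [hυ.1 6 (by decide), hτ.1 6 (by decide), h0]
      have h7' : ω.reg 7 = 1 := by rw [hω.1 7 (by decide)]; simpa using h7
      have h31 : ω.reg 31 = r + 2 := by rw [hω.1 31 (by decide)]; simp
      have h5a : ω.arr 5 = σ.arr 5 := by
        rw [hω.2 5 (by decide)]; simp [hυ.2 5 (by decide), hτ.2 5 (by decide)]
      have h6a : ω.arr 6 = σ.arr 6 := by
        rw [hω.2 6 (by decide)]; simp [hυ.2 6 (by decide), hτ.2 6 (by decide)]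
      refine Runs.ev (by decide) (by decide) ?_
      simp only [Prog.bfsArc, Prog.ev, State.setReg_reg, State.setReg_arr, hjω, h5a, h6a, h6, h7', h31,
        Nat.reduceEqDiff, if_true, if_false]
      split_ifs with h2 h3 h4
      · simp only [State.setArr_arr, State.setReg_arr, State.setReg_reg, State.setArr_reg, Nat.reduceEqDiff, if_true,
          if_false, hjω]
        exact hI.step hj h2 h3 (by omega)
      · simp only [State.setReg_arr]
        exact hI.skip fun _ => by omega
      · simp only [State.setReg_arr]
        exact hI.skip fun _ => by omega
      · simp only [State.setReg_arr]
        exact hI.skip fun _ => by omega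
    · intro ω hI
      simpa using hI.isBfs hH
  have hstart : Runs (.loop 25 24 (.store 7 25 6) ;; .store 7 21 7) σ (N * (1 + 3) + 2 + 1)
      fun τ => IsBfs N L 0 x₀ (σ.arr 5) (σ.arr 6) (τ.arr 7) (τ.arr 8) := by
    refine hclear.seq fun τ hτ hI => .ev (by decide) (by decide) ?_
    have h2 : τ.reg 21 = x₀ := by rw [hτ.1 21 (by decide), hx]
    have h3 : τ.reg 7 = 1 := by rw [hτ.1 7 (by decide), h1]
    simp only [Prog.ev, State.setArr_arr, if_true, h2, h3]
    have hz : ∀ x < N, Function.update (τ.arr 7) x₀ 1 x = if x = x₀ then 1 else 0 := by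
      intro x hx
      rw [Function.update_apply]
      split_ifs
      · rfl
      · exact hI x hx
    refine ⟨by simp, ?_, ?_, ?_, ?_⟩
    · intro x hx h
      rw [hz x hx] at h
      by_contra hne
      simp [hne] at h
    · intro x hx
      rw [hz x hx]
      split_ifs <;> omega
    · intro x hx h
      rw [hz x hx] at h
      split_ifs at h <;> omega
    · intro a ha h h'
      omega
  obtain ⟨τ, t, h2, h3, h4⟩ := hstart.frame
  obtain ⟨υ, u, h5, h6, h7⟩ := hround τ h4.2 h4.1
  -- The program associates to the right, whereas `hstart` treats its first two parts as one.
  cases h2 with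
  | seq h8 h9 =>
    refine ⟨υ, _, .seq h8 (.seq h9 h5), ?_, h7⟩
    have : (1 + (1 + (L * (12 + 3) + 2))) + 3 = L * 15 + 7 := by omega
    rw [this] at h6
    omega

end Firefighter

namespace Firefighter

/-! ### Processing a partial strategy: the fire -/

namespace Prog

/-- Load the partial strategy that starts at the cell in register `27`: compute the array `prot` in
the array `4` and the number of free positions in register `19`. -/
def loadPartial : Prog :=
  loop 25 0 (store 4 25 6) ;; const 19 0 ;;
  loop 25 4 (add 30 27 25 ;; load 31 14 30 ;;
    ifLt 6 31 (sub 32 31 7 ;; add 33 25 7 ;; store 4 32 33) (add 19 19 7))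

def fireArcs : Prog :=
  loop 25 1 (load 30 0 25 ;; load 31 1 25 ;; load 32 4 30 ;; load 33 4 31 ;;
    ifLt 6 32 (add 34 0 6) (add 34 30 6) ;; ifLt 6 33 (add 35 0 6) (add 35 31 6) ;;
    store 5 25 34 ;; store 6 25 31 ;; add 36 25 1 ;; store 5 36 35 ;; store 6 36 30)

/-- The flow computation overwrites the arrays `5`, `7` and `8`, so levels and ancestors are moved
to safety, with the arcs of the tree resolved to vertices. -/
def copyFire : Prog :=
  loop 25 0 (load 30 7 25 ;; store 9 25 30 ;;
    ifLt 7 30 (load 31 8 25 ;; load 32 5 31 ;; store 10 25 32) (store 10 25 25))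

/-- Compute the levels of the fire, in the array `9`, and the array `10` of its tree. -/
def fire : Prog :=
  fireArcs ;; (add 21 2 6 ;; add 22 13 6 ;; add 23 8 6 ;; add 24 16 6) ;; bfs ;; copyFire

/-- Look for a bad vertex; the array `11` lists the targets, and register `18` is their number. -/
def findBad : Prog :=
  const 18 0 ;;
  loop 25 0 (load 30 9 25 ;; load 31 4 25 ;; load 32 3 25 ;;
    ifLt 6 30 (ifLt 31 30 skip (store 11 6 25 ;; const 18 1) ;;
      ifLt 6 32 (store 11 6 25 ;; const 18 1) skip) skip)

end Prog

variable {I : Instance} {E : Encoding I} {σ : State} {pl : ℕ → ℕ}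

theorem runs_loadPartial (hE : Env E σ)
    (hcell : ∀ p < I.k, σ.arr 14 (σ.reg 27 + p) = pl p) :
    Runs .loadPartial σ (I.n * 4 + I.k * 10 + 5)
      fun τ => IsProt I pl (τ.arr 4) ∧ τ.reg 19 = (free I pl).card := by
  have h1 : Runs (.loop 25 0 (.store 4 25 6)) σ (I.n * (1 + 3) + 2)
      fun τ => ∀ x < I.n, τ.arr 4 x = 0 := by
    refine Runs.loop (fun j τ => ∀ x < j, τ.arr 4 x = 0) hE.n (by decide) (by decide) (by decide)
      (by simp) ?_
    intro j _ τ hτ hj hI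
    have hE := hE.frame hτ (by decide) (by decide)
    refine Runs.ev (by decide) (by decide) ?_
    intro x hx
    simp only [Prog.ev, State.setReg_arr, State.setArr_arr, if_true, hj, hE.zero,
      Function.update_apply]
    split_ifs with h
    · rfl
    · exact hI x (by omega)
  refine Runs.mono (h1.seq fun τ hτ hI => Runs.seq (T := 1) (Q := fun υ => υ = τ.setReg 19 0)
    (.ev (by decide) (by decide) rfl) ?_) (T := I.n * (1 + 3) + 2 + (1 + (I.k * (7 + 3) + 2)))
    (by omega) fun _ h => h
  rintro _ - rfl
  have hE : Env E (τ.setReg 19 0) := (hE.frame hτ (by decide) (by decide)).frame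
    (p := .const 19 0) (Exec.const τ 19 0).frame (by decide) (by decide)
  refine (Runs.loop (fun j υ => (∀ v : Fin I.n, (υ.arr 4 v = 0 ∧ ∀ p < j, pl p ≠ v + 1) ∨
    ∃ p < j, υ.arr 4 v = p + 1 ∧ pl p = v + 1) ∧
    υ.reg 19 = ({p ∈ Finset.range j | pl p = 0} : Finset ℕ).card) hE.k (by decide) (by decide)
    (by decide) ?_ ?_).mono le_rfl ?_
  · refine ⟨fun v => Or.inl ⟨by simpa using hI v v.2, by simp⟩, by simp⟩
  · intro j hj υ hυ hjυ ⟨hI1, hI2⟩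
    have hE := hE.frame hυ (by decide) (by decide)
    have hc : υ.arr 14 (υ.reg 27 + j) = pl j := by
      rw [hυ.2 14 (by decide), hυ.1 27 (by decide)]
      simp only [State.setReg_arr, State.setReg_reg, Nat.reduceEqDiff, if_false]
      rw [hτ.2 14 (by decide), hτ.1 27 (by decide)]
      exact hcell j hj
    refine Runs.ev (by decide) (by decide) ?_
    simp only [Prog.ev, State.setReg_reg, State.setReg_arr, State.setArr_arr, State.setArr_reg,
      Nat.reduceEqDiff, if_true, if_false, hjυ, hc, hE.zero, hE.one, Finset.range_add_one,
      Finset.filter_insert]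
    split_ifs with h0
    · omega
    · simp only [State.setReg_reg, State.setReg_arr, State.setArr_arr, State.setArr_reg,
        Nat.reduceEqDiff, if_true, if_false, hI2, and_true]
      intro v
      by_cases hv : (v : ℕ) = pl j - 1
      · exact Or.inr ⟨j, by omega, by rw [hv, Function.update_self], by omega⟩
      · rw [Function.update_of_ne hv]
        rcases hI1 v with ⟨h2, h3⟩ | ⟨p, h2, h3⟩
        · refine Or.inl ⟨h2, fun p hp => ?_⟩
          rcases Nat.lt_succ_iff_lt_or_eq.1 hp with h4 | rfl
          · exact h3 p h4
          · omega
        · exact Or.inr ⟨p, by omega, h3⟩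
    · simp only [State.setReg_reg, State.setReg_arr, Nat.reduceEqDiff, if_true, if_false, hI2]
      refine ⟨fun v => ?_, by rw [Finset.card_insert_of_notMem (by simp)]⟩
      rcases hI1 v with ⟨h2, h3⟩ | ⟨p, h2, h3⟩
      · refine Or.inl ⟨h2, fun p hp => ?_⟩
        rcases Nat.lt_succ_iff_lt_or_eq.1 hp with h4 | rfl
        · exact h3 p h4
        · omega
      · exact Or.inr ⟨p, by omega, h3⟩
    · omega
  · rintro υ ⟨hI1, hI2⟩
    refine ⟨fun v => ?_, hI2⟩
    rcases hI1 v with ⟨h2, h3⟩ | h2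
    · exact Or.inl ⟨h2, fun ⟨p, hp, hpv⟩ => h3 p hp hpv⟩
    · exact Or.inr h2

theorem runs_fireArcs (hE : Env E σ) :
    Runs .fireArcs σ (E.m * 18 + 2) fun τ => FireArcs E (σ.arr 4) (τ.arr 5) (τ.arr 6) := by
  refine (Runs.loop (T := 15) (fun j τ => ∀ e < j,
    τ.arr 5 e = (if 0 < σ.arr 4 (E.e1 e) then I.n else E.e1 e) ∧ τ.arr 6 e = E.e2 e ∧
    τ.arr 5 (e + E.m) = (if 0 < σ.arr 4 (E.e2 e) then I.n else E.e2 e) ∧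
    τ.arr 6 (e + E.m) = E.e1 e) hE.m (by decide) (by decide) (by decide) (by simp) ?_).mono
    le_rfl fun τ h => ⟨fun e he => (h e he).1, fun e he => (h e he).2.1,
      fun e he => (h e he).2.2.1, fun e he => (h e he).2.2.2⟩
  intro j hj τ hτ hjτ hI
  have hE := hE.frame hτ (by decide) (by decide)
  have hp : τ.arr 4 = σ.arr 4 := hτ.2 4 (by decide)
  refine Runs.ev (by decide) (by decide) ?_
  intro e he
  rcases Nat.lt_succ_iff_lt_or_eq.1 he with h | rfl
  · have h1 : e ≠ j := by omega
    have h2 : e ≠ j + E.m := by omega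
    have h3 : e + E.m ≠ j := by omega
    have h4 : e + E.m ≠ j + E.m := by omega
    simpa [Prog.ev, hjτ, hE.zero, hE.m, hE.n, hE.edge₁, hE.edge₂, hp, h1, h2, h3, h4,
      Function.update_apply] using hI e h
  · have h2 : E.m ≠ 0 := by omega
    simp [Prog.ev, hjτ, hE.zero, hE.m, hE.n, hE.edge₁, hE.edge₂, hp, h2, Function.update_apply]

theorem runs_copyFire (hE : Env E σ) :
    Runs .copyFire σ (I.n * 10 + 2) fun τ => (∀ v < I.n, τ.arr 9 v = σ.arr 7 v) ∧
      ∀ v < I.n, τ.arr 10 v = if 1 < σ.arr 7 v then σ.arr 5 (σ.arr 8 v) else v := by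
  refine (Runs.loop (T := 7) (fun j τ => ∀ v < j, τ.arr 9 v = σ.arr 7 v ∧
    τ.arr 10 v = if 1 < σ.arr 7 v then σ.arr 5 (σ.arr 8 v) else v) hE.n (by decide) (by decide)
    (by decide) (by simp) ?_).mono le_rfl fun τ h => ⟨fun v hv => (h v hv).1,
      fun v hv => (h v hv).2⟩
  intro j hj τ hτ hjτ hI
  have hE := hE.frame hτ (by decide) (by decide)
  refine Runs.ev (by decide) (by decide) ?_
  intro v hv
  have hI := hI v
  simp only [Prog.ev, State.ite_arr, State.ite_reg, State.setReg_reg, State.setReg_arr, State.setArr_arr, State.setArr_reg,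
    Nat.reduceEqDiff, if_true, if_false, hjτ, hE.one, hτ.2 7 (by decide), hτ.2 8 (by decide),
    hτ.2 5 (by decide), Function.update_apply]
  by_cases hvj : v = j
  · subst hvj
    split_ifs <;> simp
  · have := hI (by omega)
    split_ifs <;> simp_all

theorem runs_fire (hE : Env E σ) (hp : IsProt I pl (σ.arr 4)) :
    Runs .fire σ (E.m * 18 + (I.n + 1) * 4 + (I.k + 1) * (2 * E.m * 15 + 7) + I.n * 10 + 13)
      fun τ => IsFire I (placed I pl) (τ.arr 9) (τ.arr 10) := by
  refine Runs.mono ((runs_fireArcs hE).seq fun τ hτ hA => Runs.seq (T := 4) (Q := fun υ =>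
    υ.reg 21 = I.s ∧ υ.reg 22 = 2 * E.m ∧ υ.reg 23 = I.k + 1 ∧ υ.reg 24 = I.n + 1 ∧ υ.arr = τ.arr)
    (.ev (by decide) (by decide) ?_) fun υ hυ hq => ?_)
    (T := (E.m * 18 + 2) + (4 + ((I.n + 1) * 4 + (I.k + 1) * (2 * E.m * 15 + 7) + 5 +
      (I.n * 10 + 2)))) (by omega) fun _ h => h
  · have hE := hE.frame hτ (by decide) (by decide)
    simp [Prog.ev, hE.zero, hE.s, hE.fireArcs, hE.k1, hE.fireNodes]
  · obtain ⟨h1, h2, h3, h4, h5⟩ := hq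
    have hE := (hE.frame hτ (by decide) (by decide)).frame hυ (by decide) (by decide)
    refine (runs_bfs hE.zero hE.one h1 h2 h3 h4 ?_).seq fun ω hω hb => ?_
    · intro a ha
      rw [h5]
      exact (hA.head_lt ha).trans (Nat.lt_succ_self _)
    · have hE := hE.frame hω (by decide) (by decide)
      refine (runs_copyFire hE).mono le_rfl fun ρ hρ => ?_
      rw [h5] at hb
      have h6 : ω.arr 5 = τ.arr 5 := by rw [hω.2 5 (by decide), h5]
      rw [h6] at hρ
      exact isFire_of_isBfs hp hA hb hρ.1 hρ.2

/-- One bad vertex is enough for branching; later finds overwrite earlier ones in the first cell of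
the list of targets. -/
theorem runs_findBad (hE : Env E σ) :
    Runs .findBad σ (I.n * 16 + 3) fun τ =>
      (τ.reg 18 = 0 ∧ ∀ v, ¬ Bad I (σ.arr 4) (σ.arr 9) v) ∨
      (τ.reg 18 = 1 ∧ ∃ v : Fin I.n, Bad I (σ.arr 4) (σ.arr 9) v ∧ τ.arr 11 0 = v) := by
  refine Runs.mono (Runs.seq (T := 1) (Q := fun τ => τ = σ.setReg 18 0)
    (.ev (by decide) (by decide) rfl) ?_) (T := 1 + (I.n * (13 + 3) + 2)) (by omega) fun _ h => h
  rintro _ - rfl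
  have hE : Env E (σ.setReg 18 0) := hE.frame (p := .const 18 0) (Exec.const σ 18 0).frame
    (by decide) (by decide)
  refine (Runs.loop (fun j τ =>
    (τ.reg 18 = 0 ∧ ∀ v : Fin I.n, (v : ℕ) < j → ¬ Bad I (σ.arr 4) (σ.arr 9) v) ∨
      (τ.reg 18 = 1 ∧ ∃ v : Fin I.n, Bad I (σ.arr 4) (σ.arr 9) v ∧ τ.arr 11 0 = v)) hE.n
    (by decide) (by decide) (by decide) (by simp) ?_).mono le_rfl ?_
  · intro j hj τ hτ hjτ hI
    have hE := hE.frame hτ (by decide) (by decide)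
    have h4 : τ.arr 4 = σ.arr 4 := hτ.2 4 (by decide)
    have h9 : τ.arr 9 = σ.arr 9 := hτ.2 9 (by decide)
    have hC := hE.crit ⟨j, hj⟩
    simp only at hC
    refine Runs.ev (by decide) (by decide) ?_
    have hbad : Bad I (σ.arr 4) (σ.arr 9) ⟨j, hj⟩ ↔
        0 < σ.arr 9 j ∧ (σ.arr 9 j ≤ σ.arr 4 j ∨ 0 < τ.arr 3 j) := by
      simp only [Bad, hC]
    have hkeep : ¬ Bad I (σ.arr 4) (σ.arr 9) ⟨j, hj⟩ → (τ.reg 18 = 0 ∧ ∀ v : Fin I.n, (v : ℕ) < j + 1 →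
        ¬ Bad I (σ.arr 4) (σ.arr 9) v) ∨
        (τ.reg 18 = 1 ∧ ∃ v : Fin I.n, Bad I (σ.arr 4) (σ.arr 9) v ∧ τ.arr 11 0 = v) := by
      intro hnb
      refine hI.imp (fun h => ⟨h.1, fun v hv => ?_⟩) id
      rcases Nat.lt_succ_iff_lt_or_eq.1 hv with h' | h'
      · exact h.2 v h'
      · have : v = ⟨j, hj⟩ := Fin.ext h'
        rwa [this]
    rw [hbad] at hkeep
    simp only [Prog.ev, State.setReg_reg, State.setReg_arr, State.setArr_arr, State.setArr_reg,
      Nat.reduceEqDiff, if_true, if_false, hjτ, hE.zero, h4, h9]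
    split_ifs with g1 g2 g3 g3 <;>
      simp only [State.setReg_reg, State.setReg_arr, State.setArr_arr, State.setArr_reg,
      Nat.reduceEqDiff, if_true, if_false, hjτ, hE.zero] at *
    · exact Or.inr ⟨trivial, ⟨j, hj⟩, hbad.2 ⟨g1, Or.inr g3⟩, by simp⟩
    · exact hkeep (by omega)
    · exact Or.inr ⟨trivial, ⟨j, hj⟩, hbad.2 ⟨g1, Or.inr g3⟩, by simp⟩
    · exact Or.inr ⟨trivial, ⟨j, hj⟩, hbad.2 ⟨g1, Or.inl (by omega)⟩, by simp⟩
    · exact hkeep (by omega)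
  · intro τ h
    exact h.imp (fun h => ⟨h.1, fun v => h.2 v v.2⟩) id

end Firefighter

namespace Firefighter

/-! ### Processing a partial strategy: targets -/

/-- The data that are available if the current partial strategy has no bad vertices. -/
structure Node {I : Instance} (E : Encoding I) (pl : ℕ → ℕ) (σ : State) : Prop where
  env : Env E σ
  partial_ : IsPartial I pl
  prot : IsProt I pl (σ.arr 4)
  free : σ.reg 19 = (free I pl).card
  fire : IsFire I (placed I pl) (σ.arr 9) (σ.arr 10)
  not_bad : ∀ v, ¬ Bad I (σ.arr 4) (σ.arr 9) v
  nt : σ.reg 18 = 0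

/-- A step from `σ` to `τ` treats the partial strategy `pl`: either it finds out that there is a
solution, and sets the register `17`, or it computes a list of targets that every solution hits. -/
structure Branches (I : Instance) (Sol : (Fin I.k → Fin I.n) → Prop) (pl : ℕ → ℕ) (σ τ : State) :
    Prop where
  ans : τ.reg 17 = σ.reg 17 ∨
    (τ.reg 17 = 1 ∧ ((I.k = 0 ∨ I.C.card + 2 ≤ I.n) → ∃ h, Sol h))
  nt_le : τ.reg 18 ≤ I.k + 1
  targ_lt : ∀ a < τ.reg 18, τ.arr 11 a < I.n
  complete : τ.reg 17 = 1 ∨ ∀ h, Sol h → Extends I h pl →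
    Hits I h pl (τ.arr 10) (τ.arr 11) (τ.reg 18)

namespace Prog

/-- Level `k + 2` means first contact in round `k + 1`. An unprotected vertex of this level shows
that the fire has not ceased, and a single one suffices as a target. -/
def timedStage : Prog :=
  loop 25 0 (load 30 9 25 ;; load 31 4 25 ;;
    ifLt 8 30 (ifLt 31 7 (store 11 6 25 ;; const 18 1) skip) skip) ;;
  ifLt 18 7 (const 17 1) skip

/-- Compute the end nodes of arcs, in the arrays `16` and `17`. -/
def netEnds : Prog :=
  loop 25 0 (load 30 9 25 ;; load 31 4 25 ;; load 32 3 25 ;; add 33 11 6 ;; add 34 10 6 ;;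
    ifLt 6 32 (add 34 11 6)
      (ifLt 31 7 (add 33 25 0 ;; add 34 25 6 ;;
        ifLt 6 30 (ifLt 30 9 (add 33 10 6 ;; add 34 10 6) skip) skip) skip) ;;
    store 16 25 33 ;; store 17 25 34)

def splitArcs : Prog :=
  loop 25 0 (add 30 25 0 ;; store 5 25 25 ;; store 6 25 30 ;; store 12 25 25)

def edgeArcs : Prog :=
  loop 25 1 (load 30 0 25 ;; load 31 1 25 ;; load 32 16 30 ;; load 33 17 31 ;; load 34 16 31 ;;
    load 35 17 30 ;; add 36 25 0 ;; add 37 36 1 ;;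
    store 5 36 32 ;; store 12 36 32 ;; store 6 36 33 ;; store 13 36 30 ;;
    store 5 37 34 ;; store 12 37 34 ;; store 6 37 35 ;; store 13 37 31)

/-- Reverse the path to the sink that was found by a breadth first search. -/
def trace : Prog :=
  add 40 11 6 ;;
  loop 25 14 (ifLt 40 10
    (load 31 8 40 ;; load 32 5 31 ;; store 5 31 40 ;; store 6 31 32 ;; add 40 32 6)
    (ifLt 10 40
      (load 31 8 40 ;; load 32 5 31 ;; store 5 31 40 ;; store 6 31 32 ;; add 40 32 6) skip))

/-- Try to augment the flow `k + 1` times; its value is in the register `20`. -/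
def flow : Prog :=
  (add 21 10 6 ;; add 22 12 6 ;; add 23 14 6 ;; add 24 15 6 ;; const 20 0) ;;
  loop 28 8 (bfs ;; load 30 7 11 ;; ifLt 6 30 (trace ;; add 20 20 7) skip)

/-- List the vertices where the flow leaves the source. -/
def exits : Prog :=
  loop 25 12 (load 30 12 25 ;; load 31 5 25 ;;
    ifLt 30 10 skip (ifLt 10 30 skip
      (ifLt 31 10 (load 32 13 25 ;; store 11 18 32 ;; add 18 18 7)
        (ifLt 10 31 (load 32 13 25 ;; store 11 18 32 ;; add 18 18 7) skip))))

def untimedStage : Prog :=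
  netEnds ;; splitArcs ;; edgeArcs ;; flow ;; ifLt 19 20 exits (const 17 1)

end Prog

/-! ### Correctness of the last stage in both variants -/

variable {I : Instance} {E : Encoding I} {σ : State} {pl : ℕ → ℕ}

theorem runs_timedStage (hN : Node E pl σ) : Runs .timedStage σ (I.n * 12 + 5)
    fun τ => Branches I (fun h => Saves I h ∧ Ceases I (Set.range h)) pl σ τ := by
  have hE := hN.env
  refine Runs.mono (T := I.n * (9 + 3) + 2 + 3) (Runs.seq (Q := fun τ =>
    (τ.reg 18 = 0 ∧ ∀ v : Fin I.n, σ.arr 4 v = 0 → σ.arr 9 v ≠ I.k + 2) ∨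
      (τ.reg 18 = 1 ∧ ∃ v : Fin I.n, (σ.arr 4 v = 0 ∧ σ.arr 9 v = I.k + 2) ∧ τ.arr 11 0 = v))
      ((Runs.loop (fun j τ =>
    (τ.reg 18 = 0 ∧ ∀ v : Fin I.n, (v : ℕ) < j → σ.arr 4 v = 0 → σ.arr 9 v ≠ I.k + 2) ∨
      (τ.reg 18 = 1 ∧ ∃ v : Fin I.n, (σ.arr 4 v = 0 ∧ σ.arr 9 v = I.k + 2) ∧ τ.arr 11 0 = v))
      hE.n (by decide) (by decide) (by decide) ?_ ?_).mono le_rfl ?_) ?_) (by omega) fun _ h => h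
  · simp [hN.nt]
  · intro j hj τ hτ hjτ hI
    have hE := hE.frame hτ (by decide) (by decide)
    have h4 : τ.arr 4 = σ.arr 4 := hτ.2 4 (by decide)
    have h9 : τ.arr 9 = σ.arr 9 := hτ.2 9 (by decide)
    have hle := hN.fire.le ⟨j, hj⟩
    simp only at hle
    refine Runs.ev (by decide) (by decide) ?_
    by_cases hj' : σ.arr 4 j = 0 ∧ σ.arr 9 j = I.k + 2
    · refine Or.inr ⟨?_, ⟨j, hj⟩, hj', ?_⟩ <;>
        simp [Prog.ev, hjτ, hE.k1, hE.one, hE.zero, h4, h9, hj']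
    · have hsame : ¬ (I.k + 1 < σ.arr 9 j ∧ σ.arr 4 j < 1) := by omega
      refine hI.imp (fun h => ⟨?_, fun v hv => ?_⟩) fun h => ⟨?_, ?_⟩
      · simp [Prog.ev, hjτ, hE.k1, hE.one, hE.zero, h4, h9, h.1]
        omega
      · rcases Nat.lt_succ_iff_lt_or_eq.1 hv with h' | h'
        · exact h.2 v h'
        · rw [h']
          omega
      · simp [Prog.ev, hjτ, hE.k1, hE.one, hE.zero, h4, h9, h.1]
      · obtain ⟨-, v, hv, ht⟩ := h
        refine ⟨v, hv, ?_⟩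
        simp only [Prog.ev, State.setReg_reg, State.setReg_arr, Nat.reduceEqDiff, if_true, if_false,
          hjτ, hE.k1, hE.one, h4, h9]
        split_ifs
        · omega
        · exact ht
        · exact ht
  · exact fun τ h => h.imp (fun h => ⟨h.1, fun v => h.2 v v.2⟩) id
  · intro τ hτ h
    have hE := hE.frame hτ (by decide) (by decide)
    have h17 : τ.reg 17 = σ.reg 17 := hτ.1 17 (by decide)
    have h10 : τ.arr 10 = σ.arr 10 := hτ.2 10 (by decide)
    refine Runs.ev (by decide) (by decide) ?_
    rcases h with ⟨h1, h2⟩ | ⟨h1, v, h2, h3⟩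
    · have hev : (Prog.ifLt 18 7 (.const 17 1) .skip).ev τ = τ.setReg 17 1 := by
        simp [Prog.ev, h1, hE.one]
      rw [hev]
      refine ⟨Or.inr ⟨by simp, fun hroom => ?_⟩, by simp [h1], by simp [h1], Or.inl (by simp)⟩
      exact exists_saves_of_ceased hN.partial_ hN.fire hN.prot hroom hN.not_bad h2
    · have hev : (Prog.ifLt 18 7 (.const 17 1) .skip).ev τ = τ := by
        simp [Prog.ev, h1, hE.one]
      rw [hev]
      refine ⟨Or.inl h17, by omega, ?_, Or.inr fun h hs hx => ?_⟩
      · intro a ha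
        obtain rfl : a = 0 := by omega
        rw [h3]; exact v.2
      · rw [h10]
        exact hits_of_ceases hN.fire hN.prot hx hs.2 (by omega) h3 h2.2 h2.1

theorem runs_netEnds (hE : Env E σ) : Runs .netEnds σ (I.n * 22 + 2) fun τ =>
    ∀ v < I.n, τ.arr 16 v = tl I.n I.k (σ.arr 4) (σ.arr 3) (σ.arr 9) v ∧
      τ.arr 17 v = hd I.n I.k (σ.arr 4) (σ.arr 3) (σ.arr 9) v := by
  refine Runs.loop (T := 19) (fun j τ => ∀ v < j,
    τ.arr 16 v = tl I.n I.k (σ.arr 4) (σ.arr 3) (σ.arr 9) v ∧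
      τ.arr 17 v = hd I.n I.k (σ.arr 4) (σ.arr 3) (σ.arr 9) v) hE.n (by decide) (by decide)
    (by decide) (by simp) ?_
  intro j hj τ hτ hjτ hI
  have hE := hE.frame hτ (by decide) (by decide)
  refine Runs.ev (by decide) (by decide) ?_
  intro v hv
  by_cases hvj : v = j
  · subst hvj
    by_cases h1 : 0 < σ.arr 3 v <;> by_cases h2 : 0 < σ.arr 4 v <;> by_cases h3 : 0 < σ.arr 9 v <;>
      by_cases h4 : σ.arr 9 v < I.k + 2 <;>
    simp [Prog.ev, hjτ, hE.zero, hE.one, hE.n, hE.source, hE.sink, hE.k2, hτ.2 3 (by decide),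
      hτ.2 4 (by decide), hτ.2 9 (by decide), tl, hd, h1, h2, h3, h4]
    all_goals omega
  · have := hI v (by omega)
    simpa [Prog.ev, hjτ, hvj] using this

theorem runs_splitArcs (hE : Env E σ) : Runs .splitArcs σ (I.n * 7 + 2) fun τ =>
    ∀ v < I.n, τ.arr 5 v = v ∧ τ.arr 6 v = v + I.n ∧ τ.arr 12 v = v := by
  refine Runs.loop (T := 4) (fun j τ => ∀ v < j,
    τ.arr 5 v = v ∧ τ.arr 6 v = v + I.n ∧ τ.arr 12 v = v) hE.n (by decide) (by decide)
    (by decide) (by simp) ?_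
  intro j hj τ hτ hjτ hI
  have hE := hE.frame hτ (by decide) (by decide)
  refine Runs.ev (by decide) (by decide) ?_
  intro v hv
  by_cases hvj : v = j
  · subst hvj
    simp [Prog.ev, hjτ, hE.n]
  · have := hI v (by omega)
    simpa [Prog.ev, hjτ, hvj] using this

/-- The network is stored in the arrays `5`, `6` and `12`, `13`. -/
structure IsNet (E : Encoding I) (prot inC lev : ℕ → ℕ) (σ : State) : Prop where
  tail : ∀ a < I.n + 2 * E.m, σ.arr 5 a = E.netT prot inC lev a
  head : ∀ a < I.n + 2 * E.m, σ.arr 6 a = E.netH prot inC lev a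
  tail₀ : ∀ a < I.n + 2 * E.m, σ.arr 12 a = E.netT prot inC lev a
  org : ∀ a < I.n + 2 * E.m, I.n ≤ a → σ.arr 13 a = E.org a

theorem runs_edgeArcs (hE : Env E σ) {prot inC lev : ℕ → ℕ}
    (h1 : ∀ v < I.n, σ.arr 16 v = tl I.n I.k prot inC lev v ∧
      σ.arr 17 v = hd I.n I.k prot inC lev v)
    (h2 : ∀ v < I.n, σ.arr 5 v = v ∧ σ.arr 6 v = v + I.n ∧ σ.arr 12 v = v) :
    Runs .edgeArcs σ (E.m * 19 + 2) fun τ => IsNet E prot inC lev τ := by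
  refine (Runs.loop (T := 16) (fun j τ =>
    (∀ v < I.n, τ.arr 5 v = v ∧ τ.arr 6 v = v + I.n ∧ τ.arr 12 v = v) ∧
    ∀ e < j, (τ.arr 5 (I.n + e) = tl I.n I.k prot inC lev (E.e1 e) ∧
      τ.arr 6 (I.n + e) = hd I.n I.k prot inC lev (E.e2 e) ∧
      τ.arr 12 (I.n + e) = tl I.n I.k prot inC lev (E.e1 e) ∧ τ.arr 13 (I.n + e) = E.e1 e) ∧
      τ.arr 5 (I.n + e + E.m) = tl I.n I.k prot inC lev (E.e2 e) ∧
      τ.arr 6 (I.n + e + E.m) = hd I.n I.k prot inC lev (E.e1 e) ∧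
      τ.arr 12 (I.n + e + E.m) = tl I.n I.k prot inC lev (E.e2 e) ∧
      τ.arr 13 (I.n + e + E.m) = E.e2 e) hE.m (by decide) (by decide) (by decide)
      ⟨by simpa using h2, by simp⟩ ?_).mono le_rfl ?_
  · rintro j hj τ hτ hjτ ⟨hI1, hI2⟩
    have hE := hE.frame hτ (by decide) (by decide)
    have ht1 : τ.arr 16 = σ.arr 16 := hτ.2 16 (by decide)
    have ht2 : τ.arr 17 = σ.arr 17 := hτ.2 17 (by decide)
    have g1 := h1 _ (E.e1_lt hj)
    have g2 := h1 _ (E.e2_lt hj)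
    have hm : E.m ≠ 0 := by omega
    refine Runs.ev (by decide) (by decide) ⟨fun v hv => ?_, fun e he => ?_⟩
    · have n1 : v ≠ j + I.n := by omega
      have n2 : v ≠ j + I.n + E.m := by omega
      simpa [Prog.ev, hjτ, hE.n, hE.m, n1, n2, Function.update_apply] using hI1 v hv
    · rcases Nat.lt_succ_iff_lt_or_eq.1 he with h | rfl
      · have n1 : I.n + e ≠ j + I.n := by omega
        have n2 : I.n + e ≠ j + I.n + E.m := by omega
        have n3 : I.n + e + E.m ≠ j + I.n := by omega
        have n4 : I.n + e + E.m ≠ j + I.n + E.m := by omega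
        simpa only [Prog.ev, State.setReg_reg, State.setReg_arr, State.setArr_arr,
          State.setArr_reg, Nat.reduceEqDiff, if_true, if_false, hjτ, hE.n, hE.m, n1, n2, n3, n4,
          Function.update_apply] using hI2 e h
      · have n1 : I.n + e = e + I.n := by omega
        have n2 : e + I.n ≠ e + I.n + E.m := by omega
        have n3 : e + I.n + E.m ≠ e + I.n := by omega
        simp only [Prog.ev, State.setReg_reg, State.setReg_arr, State.setArr_arr,
          State.setArr_reg, Nat.reduceEqDiff, if_true, if_false, hjτ, hE.n, hE.m, n1, n2, n3,
          Function.update_apply, hE.edge₁, hE.edge₂, ht1, ht2, g1, g2, and_self]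
  · rintro τ ⟨hI1, hI2⟩
    have key : ∀ a < I.n + 2 * E.m, I.n ≤ a →
        τ.arr 5 a = E.netT prot inC lev a ∧ τ.arr 6 a = E.netH prot inC lev a ∧
        τ.arr 12 a = E.netT prot inC lev a ∧ τ.arr 13 a = E.org a := by
      intro a ha hn
      have hn' : ¬ a < I.n := by omega
      by_cases h : a < I.n + E.m
      · have := (hI2 (a - I.n) (by omega)).1
        rw [Nat.add_sub_cancel' hn] at this
        simpa only [Encoding.netT, Encoding.netH, Encoding.org, Encoding.dst, hn', h, if_true,
          if_false] using this
      · have := (hI2 (a - I.n - E.m) (by omega)).2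
        have h3 : I.n + (a - I.n - E.m) + E.m = a := by omega
        rw [h3] at this
        simpa only [Encoding.netT, Encoding.netH, Encoding.org, Encoding.dst, hn', h, if_true,
          if_false] using this
    refine ⟨fun a ha => ?_, fun a ha => ?_, fun a ha => ?_, fun a ha hn => (key a ha hn).2.2.2⟩
    all_goals by_cases hn : a < I.n
    · rw [(hI1 a hn).1, Encoding.netT, if_pos hn]
    · exact (key a ha (by omega)).1
    · rw [(hI1 a hn).2.1, Encoding.netH, if_pos hn]
    · exact (key a ha (by omega)).2.1
    · rw [(hI1 a hn).2.2, Encoding.netT, if_pos hn]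
    · exact (key a ha (by omega)).2.2.1

/-- The number of rounds is fixed in advance. The level of the current node falls by one in each
round and is at most `4 * m + 3` at the sink, so the source, of level `1`, is reached in time, and
the remaining rounds do nothing. -/
theorem runs_trace (hE : Env E σ) {L N fl : ℕ} {T₀ H₀ : ℕ → ℕ}
    (ht : IsTrace L N (2 * I.n) (2 * I.n + 1) T₀ H₀ fl (σ.arr 7) (σ.arr 8) (σ.arr 5) (σ.arr 6)
      (2 * I.n + 1))
    (hle : σ.arr 7 (2 * I.n + 1) ≤ 4 * E.m + 3)
    (hone : ∀ x < N, σ.arr 7 x = 1 → x = 2 * I.n) :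
    Runs .trace σ ((4 * E.m + 2) * 16 + 3) fun τ =>
      IsFlow L (2 * I.n) (2 * I.n + 1) T₀ H₀ (fl + 1) (τ.arr 5) (τ.arr 6) := by
  refine Runs.mono (T := 1 + ((4 * E.m + 2) * (13 + 3) + 2)) (Runs.seq (T := 1)
    (Q := fun τ => τ = σ.setReg 40 (2 * I.n + 1)) (.ev (by decide) (by decide) ?_) ?_)
    (by omega) fun _ h => h
  · simp [Prog.ev, hE.zero, hE.sink]
  rintro _ hσ rfl
  have hE := hE.frame hσ (by decide) (by decide)
  refine (Runs.loop (fun j τ => IsTrace L N (2 * I.n) (2 * I.n + 1) T₀ H₀ fl (σ.arr 7) (σ.arr 8)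
    (τ.arr 5) (τ.arr 6) (τ.reg 40) ∧ (τ.reg 40 = 2 * I.n ∨ σ.arr 7 (τ.reg 40) + j ≤ 4 * E.m + 3))
    hE.rounds (by decide) (by decide) (by decide) ?_ ?_).mono le_rfl ?_
  · refine ⟨by simpa using ht, Or.inr (by simpa using hle)⟩
  · rintro j hj τ hτ hjτ ⟨hI, hl⟩
    have hE := hE.frame hτ (by decide) (by decide)
    have h7 : τ.arr 7 = σ.arr 7 := hτ.2 7 (by decide)
    have h8 : τ.arr 8 = σ.arr 8 := hτ.2 8 (by decide)
    refine Runs.ev (by decide) (by decide) ?_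
    by_cases hc : τ.reg 40 = 2 * I.n
    · have hn : ¬ τ.reg 40 < τ.reg 10 := by rw [hE.source]; omega
      have hn' : ¬ τ.reg 10 < τ.reg 40 := by rw [hE.source]; omega
      simp only [Prog.ev, hn, hn', if_false]
      simp only [State.setReg_arr, State.setReg_reg, Nat.reduceEqDiff, if_false]
      exact ⟨hI, Or.inl hc⟩
    · have hev : ∀ p : Prog, (Prog.ifLt 40 10 p (.ifLt 10 40 p .skip)).ev τ = p.ev τ := by
        intro p
        simp only [Prog.ev, hE.source]
        split_ifs
        · rfl
        · rfl
        · omega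
      rw [hev]
      have h2 : 2 ≤ σ.arr 7 (τ.reg 40) := by
        have := hI.pos
        by_contra hlt
        exact hc (hone _ hI.lt (by omega))
      have hs := hI.step hc h2
      have hp := (hI.parent _ hI.lt h2 le_rfl).2.2.1
      simp only [Prog.ev, State.setReg_arr, State.setReg_reg, State.setArr_arr, State.setArr_reg,
        Nat.reduceEqDiff, if_false, if_true, h8, hE.zero, add_zero]
      exact ⟨hs, Or.inr (by omega)⟩
  · rintro τ ⟨hI, hl⟩
    have hc : τ.reg 40 = 2 * I.n := by
      rcases hl with h | h
      · exact h
      · have := hI.pos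
        exact hone _ hI.lt (by omega)
    rw [hc] at hI
    exact hI.isFlow

/-- The time bound for one augmentation. -/
def augTime (n m : ℕ) : ℕ :=
  (2 * n + 2) * 4 + (4 * m + 2) * ((n + 2 * m) * 15 + 7) + 5 + (1 + ((4 * m + 2) * 16 + 3 + 1 + 1))

/-- The value is capped at `k + 1`, which already exceeds any number of free positions. A smaller
value means that some search has failed, and the nodes reached by it form a closed set without the
sink. -/
theorem runs_flow (hE : Env E σ) {prot inC lev : ℕ → ℕ} (hnet : IsNet E prot inC lev σ) :
    Runs .flow σ (5 + ((I.k + 1) * (augTime I.n E.m + 3) + 2)) fun τ =>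
      IsFlow (I.n + 2 * E.m) (2 * I.n) (2 * I.n + 1) (E.netT prot inC lev) (E.netH prot inC lev)
        (τ.reg 20) (τ.arr 5) (τ.arr 6) ∧
      (τ.reg 20 = I.k + 1 ∨ (τ.reg 20 ≤ I.k + 1 ∧ ∃ U : Set ℕ, 2 * I.n ∈ U ∧ 2 * I.n + 1 ∉ U ∧
        ∀ a < I.n + 2 * E.m, τ.arr 5 a ∈ U → τ.arr 6 a ∈ U)) := by
  refine Runs.seq (Q := fun τ => τ.reg 20 = 0 ∧ τ.reg 21 = 2 * I.n ∧ τ.reg 22 = I.n + 2 * E.m ∧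
    τ.reg 23 = 4 * E.m + 2 ∧ τ.reg 24 = 2 * I.n + 2 ∧ τ.arr = σ.arr)
    (.ev (by decide) (by decide) ?_) ?_
  · simp [Prog.ev, hE.zero, hE.source, hE.arcs, hE.rounds, hE.nodes]
  rintro τ hτ ⟨h20, h21, h22, h23, h24, harr⟩
  have hE := hE.frame hτ (by decide) (by decide)
  refine Runs.loop (fun f τ =>
    IsFlow (I.n + 2 * E.m) (2 * I.n) (2 * I.n + 1) (E.netT prot inC lev) (E.netH prot inC lev)
        (τ.reg 20) (τ.arr 5) (τ.arr 6) ∧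
      (τ.reg 20 = f ∨ (τ.reg 20 ≤ f ∧ ∃ U : Set ℕ, 2 * I.n ∈ U ∧ 2 * I.n + 1 ∉ U ∧
        ∀ a < I.n + 2 * E.m, τ.arr 5 a ∈ U → τ.arr 6 a ∈ U))) hE.k1 (by decide) (by decide)
    (by decide) ?_ ?_
  · simp only [State.setReg_arr, State.setReg_reg, Nat.reduceEqDiff, if_false, h20, harr, true_or,
      and_true]
    refine ⟨fun a ha => Or.inl ⟨hnet.tail a ha, hnet.head a ha⟩, ?_, fun a ha => ?_⟩
    · intro U _ _ _
      simp only [add_zero]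
      congr 1
      ext a
      simp only [Finset.mem_filter, Finset.mem_range]
      exact and_congr_right fun ha => by rw [hnet.tail a ha]
    · rw [hnet.tail a ha]
      exact id
  · rintro f hf υ hυ hfυ ⟨hF, hcl⟩
    have hE := hE.frame hυ (by decide) (by decide)
    have g21 : υ.reg 21 = 2 * I.n := by rw [hυ.1 21 (by decide), h21]
    have g22 : υ.reg 22 = I.n + 2 * E.m := by rw [hυ.1 22 (by decide), h22]
    have g23 : υ.reg 23 = 4 * E.m + 2 := by rw [hυ.1 23 (by decide), h23]
    have g24 : υ.reg 24 = 2 * I.n + 2 := by rw [hυ.1 24 (by decide), h24]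
    have hT : ∀ a < I.n + 2 * E.m, υ.arr 5 a < 2 * I.n + 2 := fun a ha => hF.tail_lt ha
    refine (runs_bfs hE.zero hE.one g21 g22 g23 g24 fun a ha => hF.head_lt ha).seq fun ω hω hb => ?_
    have hE := hE.frame hω (by decide) (by decide)
    have w20 : ω.reg 20 = υ.reg 20 := hω.1 20 (by decide)
    have w5 : ω.arr 5 = υ.arr 5 := hω.2 5 (by decide)
    have w6 : ω.arr 6 = υ.arr 6 := hω.2 6 (by decide)
    refine Runs.seq (T := 1) (Q := fun ρ => ρ = ω.setReg 30 (ω.arr 7 (2 * I.n + 1)))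
      (.ev (by decide) (by decide) (by simp [Prog.ev, hE.sink])) ?_
    rintro _ hρ rfl
    have hE' := hE.frame hρ (by decide) (by decide)
    refine Runs.ifLt (fun hlt => ?_) fun hlt => ?_
    · rw [hE'.zero] at hlt
      simp only [State.setReg_reg, if_true] at hlt
      refine Runs.mono ((runs_trace (L := I.n + 2 * E.m) (N := 2 * I.n + 2) (fl := υ.reg 20)
        (T₀ := E.netT prot inC lev) (H₀ := E.netH prot inC lev) hE' ?_ ?_ ?_).seq (T' := 1)
        fun θ hθ hF' => ?_) le_rfl fun _ h => h
      · simp only [State.setReg_arr, w5, w6]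
        exact hF.isTrace hb (by omega) hlt hT
      · simp only [State.setReg_arr]
        have := hb.le (2 * I.n + 1) (by omega)
        omega
      · simp only [State.setReg_arr]
        exact hb.eq_source
      · have hE'' := hE'.frame hθ (by decide) (by decide)
        have t20 : θ.reg 20 = υ.reg 20 := by
          rw [hθ.1 20 (by decide)]; simpa using w20
        refine Runs.ev (by decide) (by decide) ?_
        simp only [Prog.ev, State.setReg_arr, State.setReg_reg, Nat.reduceEqDiff, if_true, if_false,
          hE''.one, t20]
        refine ⟨hF', ?_⟩
        rcases hcl with h | ⟨-, U, hU1, hU2, hU3⟩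
        · exact Or.inl (by omega)
        -- After a failed search the closed set is still present, so no later search can succeed.
        · exact absurd (hb.mem_of_closed hT hU1 hU3 _ (by omega) hlt) hU2
    · rw [hE'.zero] at hlt
      simp only [State.setReg_reg, if_true] at hlt
      refine Runs.ev (by decide) (by simp [Prog.size]) ?_
      simp only [Prog.ev, State.setReg_arr, State.setReg_reg, Nat.reduceEqDiff, if_true, if_false,
        w5, w6, w20]
      -- The closed set consists of the nodes of positive level in the failed search.
      refine ⟨hF, Or.inr ⟨by omega, {x | 0 < ω.arr 7 x}, ?_, hlt, ?_⟩⟩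
      · show 0 < ω.arr 7 (2 * I.n)
        rw [hb.source]
        exact Nat.one_pos
      · exact hF.closed_of_isBfs hb

theorem runs_exits (hE : Env E σ) {prot inC lev : ℕ → ℕ} (hnt : σ.reg 18 = 0)
    (h12 : ∀ a < I.n + 2 * E.m, σ.arr 12 a = E.netT prot inC lev a)
    (h13 : ∀ a < I.n + 2 * E.m, I.n ≤ a → σ.arr 13 a = E.org a) :
    Runs .exits σ ((I.n + 2 * E.m) * 18 + 2) fun τ =>
      τ.reg 18 = ((Finset.range (I.n + 2 * E.m)).filter
        (fun a => E.netT prot inC lev a = 2 * I.n ∧ σ.arr 5 a ≠ 2 * I.n)).card ∧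
      (∀ a < I.n + 2 * E.m, E.netT prot inC lev a = 2 * I.n ∧ σ.arr 5 a ≠ 2 * I.n →
        ∃ i < τ.reg 18, τ.arr 11 i = E.org a) ∧
      ∀ i < τ.reg 18, τ.arr 11 i < I.n := by
  have hL := hE.arcs
  refine Runs.loop (T := 15) (fun j τ =>
      τ.reg 18 = ((Finset.range j).filter
        (fun a => E.netT prot inC lev a = 2 * I.n ∧ σ.arr 5 a ≠ 2 * I.n)).card ∧
      (∀ a < j, E.netT prot inC lev a = 2 * I.n ∧ σ.arr 5 a ≠ 2 * I.n →
        ∃ i < τ.reg 18, τ.arr 11 i = E.org a) ∧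
      ∀ i < τ.reg 18, τ.arr 11 i < I.n) hL (by decide) (by decide)
    (by decide) (by simp [hnt]) ?_
  rintro j hj τ hτ hjτ ⟨hI1, hI2, hI3⟩
  have hE := hE.frame hτ (by decide) (by decide)
  have g5 : τ.arr 5 = σ.arr 5 := hτ.2 5 (by decide)
  have g12 : τ.arr 12 j = E.netT prot inC lev j := by rw [hτ.2 12 (by decide), h12 j hj]
  refine Runs.ev (by decide) (by decide) ?_
  rw [Finset.range_add_one, Finset.filter_insert]
  by_cases hx : E.netT prot inC lev j = 2 * I.n ∧ σ.arr 5 j ≠ 2 * I.n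
  -- An exit is not a split arc: those start in nodes below `n`.
  · have hn : I.n ≤ j := by
      by_contra hlt
      rw [Encoding.netT, if_pos (by omega)] at hx
      omega
    have g13 : τ.arr 13 j = E.org j := by rw [hτ.2 13 (by decide), h13 j hj hn]
    have horg := E.org_lt hj hn
    have hne : σ.arr 5 j < 2 * I.n ∨ 2 * I.n < σ.arr 5 j := by omega
    have hev : ∀ p : Prog, (Prog.ifLt 31 10 p (.ifLt 10 31 p .skip)).ev
        ((τ.setReg 30 (2 * I.n)).setReg 31 (σ.arr 5 j)) =
        p.ev ((τ.setReg 30 (2 * I.n)).setReg 31 (σ.arr 5 j)) := by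
      intro p
      simp only [Prog.ev, State.setReg_reg, Nat.reduceEqDiff, if_true, if_false, hE.source]
      split_ifs
      · rfl
      · rfl
      · omega
    have hall : (Prog.load 30 12 25 ;; .load 31 5 25 ;;
        .ifLt 30 10 .skip (.ifLt 10 30 .skip
          (.ifLt 31 10 (.load 32 13 25 ;; .store 11 18 32 ;; .add 18 18 7)
            (.ifLt 10 31 (.load 32 13 25 ;; .store 11 18 32 ;; .add 18 18 7) .skip)))).ev τ =
        (Prog.load 32 13 25 ;; .store 11 18 32 ;; .add 18 18 7).ev
          ((τ.setReg 30 (2 * I.n)).setReg 31 (σ.arr 5 j)) := by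
      rw [← hev]
      conv_lhs => simp only [Prog.ev]
      conv_rhs => simp only [Prog.ev]
      simp only [State.setReg_reg, State.setReg_arr, Nat.reduceEqDiff, if_true, if_false, hjτ, g12,
        hx.1, g5, hE.source, lt_irrefl]
    rw [hall, if_pos hx, Finset.card_insert_of_notMem (by simp)]
    simp only [Prog.ev, State.setReg_reg, State.setReg_arr, State.setArr_arr, State.setArr_reg,
      Nat.reduceEqDiff, if_true, if_false, hjτ, g13, hE.one]
    refine ⟨by omega, fun a ha hax => ?_, fun i hi => ?_⟩
    · rcases Nat.lt_succ_iff_lt_or_eq.1 ha with h | rfl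
      · obtain ⟨i, hi, hia⟩ := hI2 a h hax
        exact ⟨i, by omega, by rw [Function.update_of_ne (by omega), hia]⟩
      · exact ⟨τ.reg 18, by omega, by rw [Function.update_self]⟩
    · rw [Function.update_apply]
      split_ifs
      · exact horg
      · exact hI3 i (by omega)
  · rw [if_neg hx]
    have hcond : ¬ (¬ E.netT prot inC lev j < 2 * I.n ∧ ¬ 2 * I.n < E.netT prot inC lev j ∧
      (σ.arr 5 j < 2 * I.n ∨ 2 * I.n < σ.arr 5 j)) := by omega
    have hr : (Prog.load 30 12 25 ;; .load 31 5 25 ;;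
        .ifLt 30 10 .skip (.ifLt 10 30 .skip
          (.ifLt 31 10 (.load 32 13 25 ;; .store 11 18 32 ;; .add 18 18 7)
            (.ifLt 10 31 (.load 32 13 25 ;; .store 11 18 32 ;; .add 18 18 7) .skip)))).ev τ =
        (τ.setReg 30 (E.netT prot inC lev j)).setReg 31 (σ.arr 5 j) := by
      simp only [Prog.ev, State.setReg_reg, State.setReg_arr, Nat.reduceEqDiff, if_true, if_false,
        hjτ, g12, g5, hE.source]
      split_ifs <;> first | rfl | omega
    rw [hr]
    simp only [State.setReg_reg, State.setReg_arr, Nat.reduceEqDiff, if_false]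
    refine ⟨hI1, fun a ha hax => ?_, hI3⟩
    rcases Nat.lt_succ_iff_lt_or_eq.1 ha with h | rfl
    · exact hI2 a h hax
    · exact absurd hax hx

/-- The time bound for the flow and the list of exits. -/
def untimedTime (n m k : ℕ) : ℕ :=
  n * 22 + 2 + (n * 7 + 2 + (m * 19 + 2 + (5 + ((k + 1) * (augTime n m + 3) + 2) +
    ((n + 2 * m) * 18 + 2 + 1))))

theorem runs_untimedStage (hN : Node E pl σ) : Runs .untimedStage σ (untimedTime I.n E.m I.k)
    fun τ => Branches I (Saves I) pl σ τ := by
  have hE0 := hN.env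
  refine (runs_netEnds hE0).seq fun σ₁ hσ₁ h1 => ?_
  have hE1 := hE0.frame hσ₁ (by decide) (by decide)
  refine (runs_splitArcs hE1).seq fun σ₂ hσ₂ h2 => ?_
  have hE2 := hE1.frame hσ₂ (by decide) (by decide)
  refine (runs_edgeArcs hE2 (prot := σ.arr 4) (inC := σ.arr 3) (lev := σ.arr 9) ?_ h2).seq
    fun σ₃ hσ₃ hnet => ?_
  · rw [hσ₂.2 16 (by decide), hσ₂.2 17 (by decide)]
    exact h1
  have hE3 := hE2.frame hσ₃ (by decide) (by decide)
  refine (runs_flow hE3 hnet).seq fun σ₄ hσ₄ ⟨hF, hcl⟩ => ?_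
  have hE4 := hE3.frame hσ₄ (by decide) (by decide)
  have r17 : σ₄.reg 17 = σ.reg 17 := by
    rw [hσ₄.1 17 (by decide), hσ₃.1 17 (by decide), hσ₂.1 17 (by decide), hσ₁.1 17 (by decide)]
  have r18 : σ₄.reg 18 = 0 := by
    rw [hσ₄.1 18 (by decide), hσ₃.1 18 (by decide), hσ₂.1 18 (by decide), hσ₁.1 18 (by decide),
      hN.nt]
  have r19 : σ₄.reg 19 = (free I pl).card := by
    rw [hσ₄.1 19 (by decide), hσ₃.1 19 (by decide), hσ₂.1 19 (by decide), hσ₁.1 19 (by decide),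
      hN.free]
  have a10 : σ₄.arr 10 = σ.arr 10 := by
    rw [hσ₄.2 10 (by decide), hσ₃.2 10 (by decide), hσ₂.2 10 (by decide), hσ₁.2 10 (by decide)]
  have hfree : (free I pl).card ≤ I.k := by
    simpa [free] using Finset.card_filter_le (Finset.range I.k) (fun p => pl p = 0)
  refine Runs.ifLt (fun hlt => ?_) fun hlt => ?_
  · have h12 : σ₄.arr 12 = σ₃.arr 12 := hσ₄.2 12 (by decide)
    have h13 : σ₄.arr 13 = σ₃.arr 13 := hσ₄.2 13 (by decide)
    refine (runs_exits (prot := σ.arr 4) (inC := σ.arr 3) (lev := σ.arr 9) hE4 r18 (by rw [h12]; exact hnet.tail₀) (by rw [h13]; exact hnet.org)).conseq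
      fun τ hτ ⟨hc, hex, hlt'⟩ => ?_
    have t10 : τ.arr 10 = σ.arr 10 := by rw [hτ.2 10 (by decide), a10]
    -- There are as many exits as units of flow, hence at most `k + 1` targets.
    have hfl : τ.reg 18 = σ₄.reg 20 := by
      rw [hc, ← hF.card_exits (by omega)]
    refine ⟨Or.inl (by rw [hτ.1 17 (by decide), r17]), by omega, hlt', Or.inr fun h hs hx => ?_⟩
    obtain ⟨a, ha, h3, h4, w, hw, hlw, hd⟩ := exists_exit hN.partial_ hN.prot hN.env.crit hF
      (by omega) hs hx
    obtain ⟨i, hi, hia⟩ := hex a ha ⟨h3, h4⟩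
    rw [t10]
    exact hits_of_delayed hN.fire hi (hia.trans hw) hlw hd
  · refine Runs.ev (by decide) (by simp [Prog.size]) ?_
    refine ⟨Or.inr ⟨by simp [Prog.ev], fun hroom => ?_⟩, by simp [Prog.ev, r18],
      by simp [Prog.ev, r18], Or.inl (by simp [Prog.ev])⟩
    -- The value `k + 1` is impossible in this branch, since it would exceed the number of free
    -- positions.
    rcases hcl with h | ⟨-, U, hU1, hU2, hU3⟩
    · omega
    · exact exists_saves_of_flow hN.partial_ hN.fire hN.prot hN.env.crit hroom hN.not_bad hF
        (by omega) hU1 hU2 hU3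

end Firefighter

namespace Firefighter

/-! ### The children of a partial strategy -/

namespace Prog

/-- The last part of the treatment of a partial strategy, in both variants of the problem. -/
def stage : Bool → Prog
  | true => timedStage
  | false => untimedStage

/-- Treat the partial strategy in the cell in register `27`. -/
def process (b : Bool) : Prog :=
  loadPartial ;; fire ;; findBad ;; ifLt 18 7 (stage b) skip

/-- Append a copy of the current partial strategy in which the vertex in register `45` is placed at
the position in register `44`. -/
def addChild : Prog :=
  loop 46 4 (add 30 27 46 ;; load 31 14 30 ;; add 32 41 46 ;; store 14 32 31) ;;
  (add 32 41 44 ;; add 33 45 7 ;; store 14 32 33 ;; add 41 41 4 ;; add 29 29 7)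

def childrenAt : Prog :=
  loop 44 4 (add 30 27 44 ;; load 31 14 30 ;; ifLt 31 7 addChild skip)

/-- Levels are at most `k + 2`, so `k + 2` rounds cover the whole tree path to the source. A walk
that arrives earlier stays at the source; the repeated children are harmless and included in the
bound. -/
def chain : Prog :=
  loop 47 9 (load 30 4 45 ;; load 31 3 45 ;; ifLt 30 7 (ifLt 31 7 childrenAt skip) skip ;;
    load 45 10 45)

/-- Append the partial strategies that place one more vertex, an ancestor of a target. -/
def children : Prog :=
  loop 48 18 (load 45 11 48 ;; chain)

end Prog

/-- The strategies that are looked for, in both variants of the problem. -/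
def Sol (I : Instance) : Bool → (Fin I.k → Fin I.n) → Prop
  | true => fun h => Saves I h ∧ Ceases I (Set.range h)
  | false => Saves I

theorem Sol.saves {I : Instance} {h : Fin I.k → Fin I.n} : ∀ {b}, Sol I b h → Saves I h
  | true => And.left
  | false => id

variable {I : Instance} {E : Encoding I} {σ : State} {pl : ℕ → ℕ}

theorem runs_stage (b : Bool) (hN : Node E pl σ) :
    Runs (.stage b) σ (I.n * 12 + 5 + untimedTime I.n E.m I.k) (Branches I (Sol I b) pl σ) := by
  cases b
  · exact (runs_untimedStage hN).mono (by omega) fun _ h => h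
  · exact (runs_timedStage hN).mono (by omega) fun _ h => h

/-- The time bound for the treatment of a partial strategy. -/
def processTime (n m k : ℕ) : ℕ :=
  n * 4 + k * 10 + 5 + (m * 18 + (n + 1) * 4 + (k + 1) * (2 * m * 15 + 7) + n * 10 + 13 +
    (n * 16 + 3 + (n * 12 + 5 + untimedTime n m k + 1)))

theorem runs_process (b : Bool) (hE : Env E σ) (hpl : IsPartial I pl)
    (hcell : ∀ p < I.k, σ.arr 14 (σ.reg 27 + p) = pl p) :
    Runs (.process b) σ (processTime I.n E.m I.k) fun τ =>
      Branches I (Sol I b) pl σ τ ∧ IsProt I pl (τ.arr 4) ∧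
        ∀ v : Fin I.n, τ.arr 10 v < I.n := by
  refine (runs_loadPartial hE hcell).seq fun σ₁ hσ₁ ⟨hp, hfree⟩ => ?_
  have hE1 := hE.frame hσ₁ (by decide) (by decide)
  refine (runs_fire hE1 hp).seq fun σ₂ hσ₂ hF => ?_
  have hE2 := hE1.frame hσ₂ (by decide) (by decide)
  refine (runs_findBad hE2).seq fun σ₃ hσ₃ hB => ?_
  have hE3 := hE2.frame hσ₃ (by decide) (by decide)
  have g9 : σ₃.arr 9 = σ₂.arr 9 := hσ₃.2 9 (by decide)
  have g10 : σ₃.arr 10 = σ₂.arr 10 := hσ₃.2 10 (by decide)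
  have g4 : σ₂.arr 4 = σ₁.arr 4 := hσ₂.2 4 (by decide)
  have g4' : σ₃.arr 4 = σ₁.arr 4 := by rw [hσ₃.2 4 (by decide), g4]
  have g17 : σ₃.reg 17 = σ.reg 17 := by
    rw [hσ₃.1 17 (by decide), hσ₂.1 17 (by decide), hσ₁.1 17 (by decide)]
  have g19 : σ₃.reg 19 = (free I pl).card := by
    rw [hσ₃.1 19 (by decide), hσ₂.1 19 (by decide), hfree]
  rw [g4] at hB
  refine Runs.ifLt (fun hlt => ?_) fun hlt => ?_
  · rw [hE3.one] at hlt
    obtain ⟨h1, h2⟩ : σ₃.reg 18 = 0 ∧ ∀ v, ¬ Bad I (σ₁.arr 4) (σ₂.arr 9) v := by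
      rcases hB with h | h
      · exact h
      · omega
    refine (runs_stage b ⟨hE3, hpl, g4' ▸ hp, g19, by rw [g9, g10]; exact hF,
      by rw [g4', g9]; exact h2, h1⟩).conseq fun τ hτ hbr => ⟨⟨?_, hbr.nt_le, hbr.targ_lt,
        hbr.complete⟩, ?_, ?_⟩
    · rw [← g17]; exact hbr.ans
    · rw [hτ.2 4 (by cases b <;> decide), g4']; exact hp
    · rw [hτ.2 10 (by cases b <;> decide), g10]; exact hF.anc_lt
  · rw [hE3.one] at hlt
    obtain ⟨h1, v, h2, h3⟩ : σ₃.reg 18 = 1 ∧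
        ∃ v : Fin I.n, Bad I (σ₁.arr 4) (σ₂.arr 9) v ∧ σ₃.arr 11 0 = v := by
      rcases hB with h | h
      · omega
      · exact h
    refine Runs.ev rfl (by simp [Prog.size]; omega) ⟨⟨Or.inl g17, ?_, ?_, Or.inr fun h hs hx => ?_⟩, ?_, ?_⟩
    · simp only [Prog.ev]; omega
    · intro a ha
      simp only [Prog.ev] at ha ⊢
      obtain rfl : a = 0 := by omega
      rw [h3]; exact v.2
    · simp only [Prog.ev, g10]
      exact hits_of_bad hF hp hs.saves hx (by omega) h3 h2
    · simp only [Prog.ev, g4']; exact hp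
    · simp only [Prog.ev, g10]; exact hF.anc_lt

/-- Partial strategies have been appended to a queue of `len₀` partial strategies in the cells `c₀`:
they arise from `pl` by the placement of one vertex, there are at most `N`, and all placements in `D`
have been made. -/
structure Grown (I : Instance) (pl : ℕ → ℕ) (len₀ : ℕ) (c₀ : ℕ → ℕ) (D : ℕ → Fin I.n → Prop)
    (N len nb : ℕ) (c : ℕ → ℕ) : Prop where
  le_len : len₀ ≤ len
  len_le : len ≤ len₀ + N
  nb : nb = len * I.k
  old : ∀ y < len₀ * I.k, c y = c₀ y
  new : ∀ q < len, len₀ ≤ q → ∃ p < I.k, ∃ u : Fin I.n, u ∉ I.C ∧ pl p = 0 ∧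
    ∀ p' < I.k, c (q * I.k + p') = Function.update pl p (u + 1) p'
  made : ∀ p u, D p u → ∃ q < len, ∀ p' < I.k, c (q * I.k + p') = Function.update pl p (u + 1) p'

section Grown

variable {len₀ N N' len nb : ℕ} {c₀ c c' : ℕ → ℕ} {D D' : ℕ → Fin I.n → Prop}

theorem Grown.mono (h : Grown I pl len₀ c₀ D N len nb c) (hN : N ≤ N') (hD : ∀ p u, D' p u → D p u) :
    Grown I pl len₀ c₀ D' N' len nb c :=
  ⟨h.le_len, h.len_le.trans (by omega), h.nb, h.old, h.new, fun p u hpu => h.made p u (hD p u hpu)⟩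

theorem Grown.snoc (h : Grown I pl len₀ c₀ D N len nb c) {p : ℕ} (hp : p < I.k) {u : Fin I.n}
    (hu : u ∉ I.C) (hp0 : pl p = 0) (hold : ∀ y < len * I.k, c' y = c y)
    (hnew : ∀ p' < I.k, c' (len * I.k + p') = Function.update pl p (u + 1) p') :
    Grown I pl len₀ c₀ (fun p' u' => D p' u' ∨ (p' = p ∧ u' = u)) (N + 1) (len + 1) (nb + I.k) c' := by
  have hlt : ∀ q < len, ∀ p' < I.k, q * I.k + p' < len * I.k := by
    intro q hq p' hp'
    calc q * I.k + p' < (q + 1) * I.k := by rw [Nat.succ_mul]; omega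
      _ ≤ len * I.k := Nat.mul_le_mul_right _ hq
  refine ⟨by have := h.le_len; omega, by have := h.len_le; omega, by rw [h.nb, Nat.succ_mul], ?_, ?_,
    ?_⟩
  · intro y hy
    rw [hold y (hy.trans_le (Nat.mul_le_mul_right _ h.le_len)), h.old y hy]
  · intro q hq hle
    rcases Nat.lt_succ_iff_lt_or_eq.1 hq with hq | rfl
    · obtain ⟨p, hp, u, hu, h0, he⟩ := h.new q hq hle
      exact ⟨p, hp, u, hu, h0, fun p' hp' => (hold _ (hlt q hq p' hp')).trans (he p' hp')⟩
    · exact ⟨p, hp, u, hu, hp0, hnew⟩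
  · rintro p' u' (hD | ⟨rfl, rfl⟩)
    · obtain ⟨q, hq, he⟩ := h.made p' u' hD
      exact ⟨q, by omega, fun p' hp' => (hold _ (hlt q hq p' hp')).trans (he p' hp')⟩
    · exact ⟨len, by omega, hnew⟩

end Grown

section Children

variable {len₀ N : ℕ} {c₀ : ℕ → ℕ} {D : ℕ → Fin I.n → Prop}

theorem runs_addChild (hE : Env E σ) (hbase : σ.reg 27 + I.k ≤ len₀ * I.k)
    (hc₀ : ∀ p < I.k, c₀ (σ.reg 27 + p) = pl p)
    (hG : Grown I pl len₀ c₀ D N (σ.reg 29) (σ.reg 41) (σ.arr 14)) {p : ℕ} (hp : p < I.k)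
    (hp44 : σ.reg 44 = p) {u : Fin I.n} (hu45 : σ.reg 45 = u) (hu : u ∉ I.C) (hp0 : pl p = 0) :
    Runs .addChild σ (I.k * 7 + 7) fun τ =>
      Grown I pl len₀ c₀ (fun p' u' => D p' u' ∨ (p' = p ∧ u' = u)) (N + 1) (τ.reg 29) (τ.reg 41)
        (τ.arr 14) := by
  refine Runs.mono (T := I.k * (4 + 3) + 2 + 5) (Runs.seq (Q := fun τ =>
    (∀ y < σ.reg 41, τ.arr 14 y = σ.arr 14 y) ∧ ∀ p < I.k, τ.arr 14 (σ.reg 41 + p) = pl p)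
    (Runs.loop (fun j τ => (∀ y < σ.reg 41, τ.arr 14 y = σ.arr 14 y) ∧
      ∀ p < j, τ.arr 14 (σ.reg 41 + p) = pl p) hE.k (by decide) (by decide) (by decide)
      (by simp) ?_) ?_) (by omega) fun _ h => h
  · intro j hj τ hτ hjτ ⟨h1, h2⟩
    have r27 : τ.reg 27 = σ.reg 27 := hτ.1 27 (by decide)
    have r41 : τ.reg 41 = σ.reg 41 := hτ.1 41 (by decide)
    have hlt : σ.reg 27 + j < len₀ * I.k := by omega
    have hlt' : len₀ * I.k ≤ σ.reg 41 := hG.nb ▸ Nat.mul_le_mul_right _ hG.le_len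
    -- The cells being read lie below `len₀ * k` and the cells being written do not, so copying does
    -- not disturb its source.
    have hcell : τ.arr 14 (σ.reg 27 + j) = pl j := by
      rw [h1 _ (by omega), hG.old _ hlt, hc₀ j hj]
    refine Runs.ev (by decide) (by decide) ?_
    simp only [Prog.ev, State.setReg_reg, State.setReg_arr, State.setArr_arr, State.setArr_reg,
      Nat.reduceEqDiff, if_true, if_false, r27, r41, hjτ, hcell]
    refine ⟨fun y hy => ?_, fun p hp => ?_⟩
    · rw [Function.update_of_ne (by omega), h1 y hy]
    · rcases Nat.lt_succ_iff_lt_or_eq.1 hp with h | rfl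
      · rw [Function.update_of_ne (by omega), h2 p h]
      · rw [Function.update_self]
  · rintro τ hτ ⟨h1, h2⟩
    have hE := hE.frame hτ (by decide) (by decide)
    have r29 : τ.reg 29 = σ.reg 29 := hτ.1 29 (by decide)
    have r41 : τ.reg 41 = σ.reg 41 := hτ.1 41 (by decide)
    have r44 : τ.reg 44 = p := by rw [hτ.1 44 (by decide), hp44]
    have r45 : τ.reg 45 = u := by rw [hτ.1 45 (by decide), hu45]
    refine Runs.ev (by decide) (by decide) ?_
    simp only [Prog.ev, State.setReg_reg, State.setReg_arr, State.setArr_arr, State.setArr_reg,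
      Nat.reduceEqDiff, if_true, if_false, r29, r41, r44, r45, hE.one, hE.k]
    refine hG.snoc hp hu hp0 (fun y hy => ?_) fun p' hp' => ?_
    · rw [← hG.nb] at hy
      rw [Function.update_of_ne (by omega), h1 y hy]
    · rw [← hG.nb]
      by_cases hpp : p' = p
      · rw [hpp, Function.update_self, Function.update_self]
      · rw [Function.update_of_ne (by omega), Function.update_of_ne hpp, h2 p' hp']

theorem runs_childrenAt (hE : Env E σ) (hbase : σ.reg 27 + I.k ≤ len₀ * I.k)
    (hc₀ : ∀ p < I.k, c₀ (σ.reg 27 + p) = pl p)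
    (hG : Grown I pl len₀ c₀ D N (σ.reg 29) (σ.reg 41) (σ.arr 14)) {u : Fin I.n}
    (hu45 : σ.reg 45 = u) (hu : u ∉ I.C) :
    Runs .childrenAt σ (I.k * (I.k * 7 + 13) + 2) fun τ =>
      Grown I pl len₀ c₀ (fun p' u' => D p' u' ∨ (p' < I.k ∧ pl p' = 0 ∧ u' = u)) (N + I.k)
        (τ.reg 29) (τ.reg 41) (τ.arr 14) := by
  refine Runs.loop (T := I.k * 7 + 10) (fun j τ =>
    Grown I pl len₀ c₀ (fun p' u' => D p' u' ∨ (p' < j ∧ pl p' = 0 ∧ u' = u)) (N + j)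
        (τ.reg 29) (τ.reg 41) (τ.arr 14)) hE.k (by decide) (by decide) (by decide) ?_ ?_
  · exact hG.mono le_rfl (by simp)
  · intro j hj τ hτ hjτ hI
    have hE := hE.frame hτ (by decide) (by decide)
    have r27 : τ.reg 27 = σ.reg 27 := hτ.1 27 (by decide)
    have r45 : τ.reg 45 = u := by rw [hτ.1 45 (by decide), hu45]
    have hcell : τ.arr 14 (σ.reg 27 + j) = pl j := by
      rw [hI.old _ (by omega), hc₀ j hj]
    refine Runs.mono (T := 1 + (1 + (I.k * 7 + 7 + 1))) (Runs.seq (p := .add 30 27 44) (σ := τ) (T := 1)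
      (T' := 1 + (I.k * 7 + 7 + 1)) (Q := fun υ => υ = τ.setReg 30 (σ.reg 27 + j))
      (.ev (by decide) (by decide) (by simp [Prog.ev, r27, hjτ])) ?_) (by omega) fun _ h => h
    rintro _ hυ rfl
    have hE := hE.frame hυ (by decide) (by decide)
    refine Runs.seq (T := 1)
      (Q := fun υ => υ = (τ.setReg 30 (σ.reg 27 + j)).setReg 31 (pl j))
      (.ev (by decide) (by decide) (by simp [Prog.ev, hcell])) ?_
    rintro _ hω rfl
    have hE := hE.frame hω (by decide) (by decide)
    refine Runs.ifLt (fun hlt => ?_) fun hlt => ?_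
    · simp only [hE.one] at hlt
      simp only [State.setReg_reg, if_true, Nat.lt_one_iff] at hlt
      refine (runs_addChild (N := N + j) (D := fun p' u' => D p' u' ∨ (p' < j ∧ pl p' = 0 ∧ u' = u))
        hE (len₀ := len₀) (c₀ := c₀) (pl := pl) (by simpa [r27] using hbase) (by simpa [r27] using hc₀)
        (by simpa using hI) hj (by simpa using hjτ) (u := u) (by simpa using r45) hu hlt).mono le_rfl
        fun υ hυ => ?_
      refine Grown.mono (by simpa using hυ) (by omega) ?_
      rintro p' u' (h | ⟨h1, h2, h3⟩)
      · exact Or.inl (Or.inl h)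
      · rcases Nat.lt_succ_iff_lt_or_eq.1 h1 with h4 | h4
        · exact Or.inl (Or.inr ⟨h4, h2, h3⟩)
        · exact Or.inr ⟨h4, h3⟩
    · simp only [hE.one] at hlt
      simp only [State.setReg_reg, if_true, Nat.lt_one_iff] at hlt
      refine Runs.ev (by decide) (by simp [Prog.size]) ?_
      refine Grown.mono (by simpa [Prog.ev] using hI) (by omega) ?_
      rintro p' u' (h | ⟨h1, h2, h3⟩)
      · exact Or.inl h
      · rcases Nat.lt_succ_iff_lt_or_eq.1 h1 with h4 | h4
        · exact Or.inr ⟨h4, h2, h3⟩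
        · exact absurd (h4 ▸ h2) hlt

/-- The placements that are made for the vertices on the path that starts at `t`. -/
def OnChain (I : Instance) (pl prot anc : ℕ → ℕ) (t i : ℕ) (p : ℕ) (u : Fin I.n) : Prop :=
  ∃ i' < i, anc^[i'] t = u ∧ prot u = 0 ∧ u ∉ I.C ∧ p < I.k ∧ pl p = 0

theorem runs_chain (hE : Env E σ) (hbase : σ.reg 27 + I.k ≤ len₀ * I.k)
    (hc₀ : ∀ p < I.k, c₀ (σ.reg 27 + p) = pl p)
    (hanc : ∀ v : Fin I.n, σ.arr 10 v < I.n)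
    (hG : Grown I pl len₀ c₀ D N (σ.reg 29) (σ.reg 41) (σ.arr 14)) {t : ℕ} (ht : t < I.n)
    (h45 : σ.reg 45 = t) :
    Runs .chain σ ((I.k + 2) * (I.k * (I.k * 7 + 13) + 10) + 2) fun τ =>
      Grown I pl len₀ c₀ (fun p u => D p u ∨ OnChain I pl (σ.arr 4) (σ.arr 10) t (I.k + 2) p u)
        (N + (I.k + 2) * I.k) (τ.reg 29) (τ.reg 41) (τ.arr 14) := by
  refine (Runs.loop (T := I.k * (I.k * 7 + 13) + 7) (fun i τ =>
    Grown I pl len₀ c₀ (fun p u => D p u ∨ OnChain I pl (σ.arr 4) (σ.arr 10) t i p u)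
        (N + i * I.k) (τ.reg 29) (τ.reg 41) (τ.arr 14) ∧
      τ.reg 45 = (σ.arr 10)^[i] t ∧ τ.reg 45 < I.n) hE.k2 (by decide) (by decide) (by decide)
      ?_ ?_).mono le_rfl fun τ h => h.1
  · simp only [State.setReg_reg, State.setReg_arr, Nat.reduceEqDiff, if_false, h45]
    exact ⟨hG.mono (by omega) (by simp [OnChain]), rfl, ht⟩
  · rintro i hi τ hτ hiτ ⟨hI, h45, hlt⟩
    have hE := hE.frame hτ (by decide) (by decide)
    have r27 : τ.reg 27 = σ.reg 27 := hτ.1 27 (by decide)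
    have a4 : τ.arr 4 = σ.arr 4 := hτ.2 4 (by decide)
    have a10 : τ.arr 10 = σ.arr 10 := hτ.2 10 (by decide)
    obtain ⟨u, hu⟩ : ∃ u : Fin I.n, τ.reg 45 = u := ⟨⟨_, hlt⟩, rfl⟩
    refine Runs.mono (T := 1 + (1 + (I.k * (I.k * 7 + 13) + 2 + 1 + 1 + 1)))
      (Runs.seq (T := 1) (Q := fun υ => υ = τ.setReg 30 (σ.arr 4 u))
      (.ev (by decide) (by decide) (by simp [Prog.ev, a4, hu])) ?_) (by omega) fun _ h => h
    rintro _ hυ rfl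
    have hE := hE.frame hυ (by decide) (by decide)
    refine Runs.seq (T := 1) (Q := fun υ => υ = (τ.setReg 30 (σ.arr 4 u)).setReg 31 (τ.arr 3 u))
      (.ev (by decide) (by decide) (by simp [Prog.ev, hu])) ?_
    rintro _ hω rfl
    have hC := hE.crit u
    simp only [State.setReg_arr] at hC
    have hE := hE.frame hω (by decide) (by decide)
    have hlast : ∀ υ : State, υ.reg 45 = u → υ.arr 10 = σ.arr 10 →
        Grown I pl len₀ c₀ (fun p u' => (D p u' ∨ OnChain I pl (σ.arr 4) (σ.arr 10) t i p u') ∨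
          (p < I.k ∧ pl p = 0 ∧ u' = u ∧ σ.arr 4 u = 0 ∧ u ∉ I.C)) (N + i * I.k + I.k) (υ.reg 29)
          (υ.reg 41) (υ.arr 14) →
        Runs (.load 45 10 45) υ 1 fun τ => (fun τ : State =>
          Grown I pl len₀ c₀ (fun p u => D p u ∨ OnChain I pl (σ.arr 4) (σ.arr 10) t (i + 1) p u)
            (N + (i + 1) * I.k) (τ.reg 29) (τ.reg 41) (τ.arr 14) ∧
          τ.reg 45 = (σ.arr 10)^[i + 1] t ∧ τ.reg 45 < I.n) ((τ.setReg 5 1).setReg 47 (i + 1)) := by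
      intro υ h1 h2 h3
      refine Runs.ev (by decide) (by decide) ?_
      simp only [Prog.ev, State.setReg_reg, State.setReg_arr, Nat.reduceEqDiff, if_true, if_false,
        h1, h2]
      refine ⟨h3.mono (by rw [Nat.succ_mul]; omega) ?_, ?_, hanc u⟩
      · rintro p u' (h | ⟨i', hi', h4, h5⟩)
        · exact Or.inl (Or.inl h)
        · rcases Nat.lt_succ_iff_lt_or_eq.1 hi' with h6 | rfl
          · exact Or.inl (Or.inr ⟨i', h6, h4, h5⟩)
          · have : u' = u := Fin.ext (by omega)
            subst this
            exact Or.inr ⟨h5.2.2.1, h5.2.2.2, rfl, h5.1, h5.2.1⟩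
      · rw [Function.iterate_succ_apply', ← h45, hu]
    have hskip : ¬ (σ.arr 4 u = 0 ∧ u ∉ I.C) → Runs .skip
        ((τ.setReg 30 (σ.arr 4 u)).setReg 31 (τ.arr 3 u)) 1 fun υ => υ.reg 45 = u ∧
        υ.arr 10 = σ.arr 10 ∧
        Grown I pl len₀ c₀ (fun p u' => (D p u' ∨ OnChain I pl (σ.arr 4) (σ.arr 10) t i p u') ∨
          (p < I.k ∧ pl p = 0 ∧ u' = u ∧ σ.arr 4 u = 0 ∧ u ∉ I.C)) (N + i * I.k + I.k) (υ.reg 29)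
          (υ.reg 41) (υ.arr 14) := by
      intro hn
      refine Runs.ev (by decide) (by decide) ?_
      simp only [Prog.ev, State.setReg_reg, State.setReg_arr, Nat.reduceEqDiff, if_true, if_false]
      refine ⟨hu, a10, hI.mono (by omega) ?_⟩
      rintro p u' (h | h)
      · exact h
      · exact absurd h.2.2.2 hn
    refine Runs.seq (T := I.k * (I.k * 7 + 13) + 2 + 1 + 1) (T' := 1) (Q := fun υ => υ.reg 45 = u ∧
      υ.arr 10 = σ.arr 10 ∧
      Grown I pl len₀ c₀ (fun p u' => (D p u' ∨ OnChain I pl (σ.arr 4) (σ.arr 10) t i p u') ∨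
          (p < I.k ∧ pl p = 0 ∧ u' = u ∧ σ.arr 4 u = 0 ∧ u ∉ I.C)) (N + i * I.k + I.k) (υ.reg 29)
          (υ.reg 41) (υ.arr 14)) ?_ fun υ _ h => hlast υ h.1 h.2.1 h.2.2
    refine Runs.ifLt (fun g1 => Runs.ifLt (fun g2 => ?_) fun g2 => ?_) fun g1 => ?_
    · simp only [hE.one] at g1 g2
      simp only [State.setReg_reg, Nat.reduceEqDiff, if_true, if_false, Nat.lt_one_iff] at g1 g2
      have huC : u ∉ I.C := fun h => by have := hC.2 h; omega
      refine (runs_childrenAt (u := u) hE (len₀ := len₀) (c₀ := c₀) (pl := pl) (N := N + i * I.k)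
        (D := fun p u => D p u ∨ OnChain I pl (σ.arr 4) (σ.arr 10) t i p u)
        (by simpa [r27] using hbase) (by simpa [r27] using hc₀) (by simpa using hI)
        (by simpa using hu) huC).conseq fun υ hυ hG => ⟨?_, ?_, hG.mono le_rfl ?_⟩
      · rw [hυ.1 45 (by decide)]; simpa using hu
      · rw [hυ.2 10 (by decide)]; simpa using a10
      · rintro p u' (h | h)
        · exact Or.inl h
        · exact Or.inr ⟨h.1, h.2.1, h.2.2.1⟩
    · simp only [hE.one] at g1 g2
      simp only [State.setReg_reg, Nat.reduceEqDiff, if_true, if_false, Nat.lt_one_iff] at g1 g2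
      exact (hskip fun h => h.2 (hC.1 (by omega))).mono (by omega) fun _ h => h
    · simp only [hE.one] at g1
      simp only [State.setReg_reg, Nat.reduceEqDiff, if_true, if_false, Nat.lt_one_iff] at g1
      exact (hskip fun h => g1 h.1).mono (by omega) fun _ h => h

/-- The time bound for the generation of the children. -/
def childrenTime (k : ℕ) : ℕ :=
  (k + 1) * ((k + 2) * (k * (k * 7 + 13) + 10) + 6) + 2

theorem runs_children (hE : Env E σ) (hbase : σ.reg 27 + I.k ≤ σ.reg 29 * I.k)
    (hcell : ∀ p < I.k, σ.arr 14 (σ.reg 27 + p) = pl p) (hnb : σ.reg 41 = σ.reg 29 * I.k)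
    (hanc : ∀ v : Fin I.n, σ.arr 10 v < I.n) (hnt : σ.reg 18 ≤ I.k + 1)
    (htarg : ∀ a < σ.reg 18, σ.arr 11 a < I.n) :
    Runs .children σ (childrenTime I.k) fun τ =>
      Grown I pl (σ.reg 29) (σ.arr 14) (fun p u => ∃ a < σ.reg 18,
        OnChain I pl (σ.arr 4) (σ.arr 10) (σ.arr 11 a) (I.k + 2) p u)
        ((I.k + 1) * ((I.k + 2) * I.k)) (τ.reg 29) (τ.reg 41) (τ.arr 14) := by
  refine (Runs.loop (T := 1 + ((I.k + 2) * (I.k * (I.k * 7 + 13) + 10) + 2)) (fun a τ =>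
      Grown I pl (σ.reg 29) (σ.arr 14) (fun p u => ∃ a' < a,
        OnChain I pl (σ.arr 4) (σ.arr 10) (σ.arr 11 a') (I.k + 2) p u)
        (a * ((I.k + 2) * I.k)) (τ.reg 29) (τ.reg 41) (τ.arr 14)) (N := σ.reg 18) rfl (by decide)
        (by decide) (by decide) ?_ ?_).mono ?_ ?_
  · simp only [State.setReg_reg, State.setReg_arr, Nat.reduceEqDiff, if_false]
    refine ⟨le_rfl, by omega, hnb, fun _ _ => rfl, fun q h1 h2 => by omega, ?_⟩
    rintro p u ⟨a, ha, -⟩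
    omega
  · intro a ha τ hτ haτ hI
    have hE := hE.frame hτ (by decide) (by decide)
    have r27 : τ.reg 27 = σ.reg 27 := hτ.1 27 (by decide)
    have a4 : τ.arr 4 = σ.arr 4 := hτ.2 4 (by decide)
    have a10 : τ.arr 10 = σ.arr 10 := hτ.2 10 (by decide)
    have a11 : τ.arr 11 = σ.arr 11 := hτ.2 11 (by decide)
    refine Runs.seq (T := 1) (Q := fun υ => υ = τ.setReg 45 (σ.arr 11 a))
      (.ev (by decide) (by decide) (by simp [Prog.ev, a11, haτ])) ?_
    rintro _ hυ rfl
    have hE := hE.frame hυ (by decide) (by decide)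
    refine (runs_chain hE (len₀ := σ.reg 29) (c₀ := σ.arr 14) (pl := pl) (N := a * ((I.k + 2) * I.k))
      (D := fun p u => ∃ a' < a, OnChain I pl (σ.arr 4) (σ.arr 10) (σ.arr 11 a') (I.k + 2) p u)
      (by simpa [r27] using hbase) (by simpa [r27] using hcell) (by simpa [a10] using hanc)
      (by simpa using hI) (htarg a ha) (by simp)).mono le_rfl fun ω hω => ?_
    refine Grown.mono (by simpa [a4, a10] using hω) (le_of_eq (by ring)) ?_
    rintro p u ⟨a', ha', h⟩
    rcases Nat.lt_succ_iff_lt_or_eq.1 ha' with h1 | rfl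
    · exact Or.inl ⟨a', h1, h⟩
    · exact Or.inr h
  · rw [childrenTime]
    have := Nat.mul_le_mul_right ((I.k + 2) * (I.k * (I.k * 7 + 13) + 10) + 6) hnt
    refine le_trans (le_of_eq ?_) (Nat.add_le_add_right this 2)
    ring
  · intro τ h
    exact h.mono (Nat.mul_le_mul_right _ hnt) fun _ _ h => h

end Children

end Firefighter

namespace Firefighter

/-! ### The queue of partial strategies -/

namespace Prog

def step (b : Bool) : Prog :=
  ifLt 42 29 (process b ;; children) skip ;; add 27 27 4

def search (b : Bool) : Prog :=
  loop 42 43 (step b)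

end Prog

variable {I : Instance} {E : Encoding I} {σ : State} {b : Bool}

/-- A number that exceeds the number of children of a partial strategy. -/
def branching (k : ℕ) : ℕ := (k + 2) ^ 3

/-- The partial strategy number `q` in the queue. -/
def entry (k : ℕ) (c : ℕ → ℕ) (q p : ℕ) : ℕ := c (q * k + p)

/-! ### The effect of one placement -/

section Congr

variable {pl pl' : ℕ → ℕ} (h : ∀ p < I.k, pl' p = pl p)
include h

theorem isPartial_congr (hp : IsPartial I pl) : IsPartial I pl' := fun p hpk => by
  rw [h p hpk]; exact hp p hpk

theorem free_congr : free I pl' = free I pl :=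
  Finset.filter_congr fun p hp => by rw [h p (Finset.mem_range.1 hp)]

theorem extends_congr {f : Fin I.k → Fin I.n} (hx : Extends I f pl) : Extends I f pl' :=
  fun p v hv => hx p v (by rw [← h p p.2, hv])

end Congr

theorem card_free_update {pl : ℕ → ℕ} {p : ℕ} (hp : p < I.k) (h0 : pl p = 0) (u : ℕ) :
    (free I (Function.update pl p (u + 1))).card + 1 = (free I pl).card := by
  have hmem : p ∈ free I pl := by simp [free, hp, h0]
  have : free I (Function.update pl p (u + 1)) = (free I pl).erase p := by
    ext q
    by_cases hq : q = p
    · subst hq; simp [free]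
    · simp [free, hq]
  rw [this, Finset.card_erase_add_one hmem]

theorem isPartial_update {pl : ℕ → ℕ} (h : IsPartial I pl) (p : ℕ) {u : Fin I.n} (hu : u ∉ I.C) :
    IsPartial I (Function.update pl p (u + 1)) := by
  intro q hq
  by_cases hqp : q = p
  · exact Or.inr ⟨u, hu, by rw [hqp, Function.update_self]⟩
  · rw [Function.update_of_ne hqp]; exact h q hq

/-- The state of the search, before the partial strategy number `x` is treated. -/
structure Queue (I : Instance) (b : Bool) (x ans base len nb : ℕ) (c : ℕ → ℕ) : Prop where
  base : base = x * I.k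
  nb : nb = len * I.k
  pos : 0 < len
  root : ∀ p < I.k, c p = 0
  partial_ : ∀ q < len, IsPartial I (entry I.k c q)
  made : ∀ q < x, q < len → ans = 1 ∨ ∀ h, Sol I b h → Extends I h (entry I.k c q) →
    ∃ q' < len, Extends I h (entry I.k c q') ∧
      (free I (entry I.k c q')).card + 1 = (free I (entry I.k c q)).card
  pot : ∑ q ∈ Finset.Ico x len, branching I.k ^ (free I (entry I.k c q)).card + x ≤
    branching I.k ^ I.k
  ans : ans = 0 ∨ (ans = 1 ∧ ((I.k = 0 ∨ I.C.card + 2 ≤ I.n) → ∃ h, Sol I b h))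

theorem Queue.init {c : ℕ → ℕ} (hc : ∀ p < I.k, c p = 0) : Queue I b 0 0 0 1 I.k c where
  base := by simp
  nb := by simp
  pos := Nat.one_pos
  root := hc
  partial_ q hq p hp := by
    obtain rfl : q = 0 := by omega
    exact Or.inl (by simpa [entry] using hc p hp)
  made q hq := absurd hq (Nat.not_lt_zero _)
  pot := by
    have : (free I (entry I.k c 0)).card ≤ I.k := by
      simpa [free] using Finset.card_filter_le (Finset.range I.k) (fun p => entry I.k c 0 p = 0)
    simpa using Nat.pow_le_pow_right (by simp [branching]) this
  ans := Or.inl rfl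

/-! ### Correctness and termination of the search -/

section

variable {x ans base len nb : ℕ} {c : ℕ → ℕ}

/-- At the end of the search, the answer is correct. -/
theorem Queue.correct (hQ : Queue I b (branching I.k ^ I.k) ans base len nb c) :
    (ans = 0 ∧ ∀ h, ¬ Sol I b h) ∨
      (ans = 1 ∧ ((I.k = 0 ∨ I.C.card + 2 ≤ I.n) → ∃ h, Sol I b h)) := by
  have hB : 0 < branching I.k := by simp [branching]
  rcases hQ.ans with h0 | h1
  swap
  · exact Or.inr h1
  refine Or.inl ⟨h0, fun h hs => ?_⟩
  -- A pending entry would add at least one to a potential that is already exhausted by the number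
  -- of rounds.
  have hlen : len ≤ branching I.k ^ I.k := by
    by_contra hlt
    have h1 : 0 < ∑ q ∈ Finset.Ico (branching I.k ^ I.k) len,
        branching I.k ^ (free I (entry I.k c q)).card :=
      Finset.sum_pos (fun q _ => Nat.pow_pos hB) ⟨_, Finset.mem_Ico.2 ⟨le_rfl, by omega⟩⟩
    have := hQ.pot
    omega
  -- A solution that extends an entry extends one with fewer free positions, so the descent from the
  -- empty partial strategy cannot end.
  have key : ∀ f q, q < len → Extends I h (entry I.k c q) →
      (free I (entry I.k c q)).card = f → False := by
    intro f
    induction f with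
    | zero =>
      intro q hq hx hf
      rcases hQ.made q (by omega) hq with h1 | h1
      · omega
      · obtain ⟨q', hq', -, h2⟩ := h1 h hs hx
        omega
    | succ f ih =>
      intro q hq hx hf
      rcases hQ.made q (by omega) hq with h1 | h1
      · omega
      · obtain ⟨q', hq', hx', h2⟩ := h1 h hs hx
        exact ih q' hq' hx' (by omega)
  refine key _ 0 hQ.pos (fun p v hv => ?_) rfl
  have := hQ.root p p.2
  simp only [entry, Nat.zero_mul, Nat.zero_add] at hv
  omega

/-- The loop always makes `branching k ^ k` rounds, and those after the end of the queue are idle.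
-/
theorem Queue.succ_of_le (hQ : Queue I b x ans base len nb c) (hx : len ≤ x)
    (hlt : x < branching I.k ^ I.k) : Queue I b (x + 1) ans (base + I.k) len nb c where
  base := by rw [hQ.base, Nat.succ_mul]
  nb := hQ.nb
  pos := hQ.pos
  root := hQ.root
  partial_ := hQ.partial_
  made q _ hq := hQ.made q (by omega) hq
  pot := by
    rw [Finset.Ico_eq_empty (by omega)]
    simpa using hlt
  ans := hQ.ans

/-- A solution that hits a target extends one of the children. -/
theorem exists_child {pl prot anc targ : ℕ → ℕ} {nt : ℕ} {h : Fin I.k → Fin I.n}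
    (hprot : IsProt I pl prot) (hpl : IsPartial I pl) (hs : Saves I h) (hx : Extends I h pl)
    (hh : Hits I h pl anc targ nt) : ∃ (p : ℕ) (u : Fin I.n),
      (∃ a < nt, OnChain I pl prot anc (targ a) (I.k + 2) p u) ∧
        Extends I h (Function.update pl p (u + 1)) := by
  obtain ⟨a, ha, i, hi, u, hu, hur, hup⟩ := hh
  obtain ⟨j, hj, hjt⟩ := hs.onTime u hur
  -- If `pl` filled the position `j`, it would hold `u` there, but `u` is not placed by `pl`.
  have hj0 : pl j = 0 := by
    rcases hpl j j.2 with h0 | ⟨v, -, hv⟩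
    · exact h0
    · have := (hx j v hv).1
      rw [hj] at this
      exact absurd ⟨j, j.2, this ▸ hv⟩ hup
  refine ⟨j, u, ⟨a, ha, i, hi, hu, (hprot.eq_zero_iff u).2 hup, fun hC => hs.avoid u hC hur, j.2,
    hj0⟩, fun p v hv => ?_⟩
  by_cases hpj : p = j
  · rw [hpj, Function.update_self] at hv
    have : u = v := Fin.ext (by omega)
    rw [hpj, ← this]
    exact ⟨hj, hjt⟩
  · rw [Function.update_of_ne (fun h' => hpj (Fin.ext h'))] at hv
    exact hx p v hv

/-- A pending entry with `f` free positions has weight `branching k ^ f`, a bound for the size of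
its subtree. Treating it replaces this weight by the weights of its children plus one for the round
spent. -/
theorem Queue.succ {τ : State} {len' nb' : ℕ} {c' : ℕ → ℕ} {prot : ℕ → ℕ} {σ : State}
    (hQ : Queue I b x (σ.reg 17) base len nb c) (hx : x < len)
    (hbr : Branches I (Sol I b) (entry I.k c x) σ τ) (hprot : IsProt I (entry I.k c x) prot)
    (hG : Grown I (entry I.k c x) len c (fun p u => ∃ a < τ.reg 18,
        OnChain I (entry I.k c x) prot (τ.arr 10) (τ.arr 11 a) (I.k + 2) p u)
        ((I.k + 1) * ((I.k + 2) * I.k)) len' nb' c') :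
    Queue I b (x + 1) (τ.reg 17) (base + I.k) len' nb' c' := by
  have hll := hG.le_len
  have hpl := hQ.partial_ x hx
  have hold : ∀ q < len, ∀ p < I.k, entry I.k c' q p = entry I.k c q p := by
    intro q hq p hp
    refine hG.old _ ?_
    calc q * I.k + p < (q + 1) * I.k := by rw [Nat.succ_mul]; omega
      _ ≤ len * I.k := Nat.mul_le_mul_right _ hq
  have hfree : ∀ q < len, free I (entry I.k c' q) = free I (entry I.k c q) :=
    fun q hq => free_congr (hold q hq)
  have hnew : ∀ q < len', len ≤ q → ∃ p < I.k, ∃ u : Fin I.n, u ∉ I.C ∧ entry I.k c x p = 0 ∧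
      ∀ p' < I.k, entry I.k c' q p' = Function.update (entry I.k c x) p (u + 1) p' := hG.new
  have hcard : ∀ q < len', len ≤ q →
      (free I (entry I.k c' q)).card + 1 = (free I (entry I.k c x)).card := by
    intro q hq hle
    obtain ⟨p, hp, u, hu, h0, he⟩ := hnew q hq hle
    rw [free_congr he, card_free_update hp h0]
  have hans : τ.reg 17 = 1 ∨ τ.reg 17 = σ.reg 17 := by
    rcases hbr.ans with h | h
    · exact Or.inr h
    · exact Or.inl h.1
  refine ⟨by rw [hQ.base, Nat.succ_mul], hG.nb, by have := hQ.pos; omega, ?_, ?_, ?_, ?_, ?_⟩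
  · intro p hp
    have := hold 0 hQ.pos p hp
    simp only [entry, Nat.zero_mul, Nat.zero_add] at this
    rw [this, hQ.root p hp]
  · intro q hq
    rcases lt_or_ge q len with hlt | hge
    · exact isPartial_congr (hold q hlt) (hQ.partial_ q hlt)
    · obtain ⟨p, hp, u, hu, h0, he⟩ := hnew q hq hge
      exact isPartial_congr he (isPartial_update hpl p hu)
  · intro q hqx hq
    rcases Nat.lt_succ_iff_lt_or_eq.1 hqx with hlt | rfl
    · rcases hans with h | h
      · exact Or.inl h
      rcases hQ.made q hlt (by omega) with h' | h'
      · exact Or.inl (h.trans h')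
      · refine Or.inr fun f hs hxf => ?_
        obtain ⟨q', hq', h1, h2⟩ := h' f hs (extends_congr (fun p hp =>
          (hold q (by omega) p hp).symm) hxf)
        exact ⟨q', by omega, extends_congr (hold q' hq') h1, by
          rw [hfree q' hq', hfree q (by omega), h2]⟩
    · refine hbr.complete.imp id fun h' f hs hxf => ?_
      have hxf' : Extends I f (entry I.k c q) :=
        extends_congr (fun p hp => (hold q hx p hp).symm) hxf
      obtain ⟨p, u, hD, hxu⟩ := exists_child hprot hpl hs.saves hxf' (h' f hs hxf')
      obtain ⟨q', hq', he⟩ := hG.made p u hD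
      obtain ⟨a, -, i, -, -, -, -, hp, h0⟩ := hD
      refine ⟨q', hq', extends_congr he hxu, ?_⟩
      rw [hfree q hx, free_congr (pl' := entry I.k c' q') he, card_free_update hp h0]
  · have h1 : ∑ q ∈ Finset.Ico x len, branching I.k ^ (free I (entry I.k c q)).card =
        branching I.k ^ (free I (entry I.k c x)).card +
        ∑ q ∈ Finset.Ico (x + 1) len, branching I.k ^ (free I (entry I.k c q)).card :=
      Finset.sum_eq_sum_Ico_succ_bot hx _
    have h2 : ∑ q ∈ Finset.Ico (x + 1) len, branching I.k ^ (free I (entry I.k c' q)).card =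
        ∑ q ∈ Finset.Ico (x + 1) len, branching I.k ^ (free I (entry I.k c q)).card :=
      Finset.sum_congr rfl fun q hq => by rw [hfree q (Finset.mem_Ico.1 hq).2]
    have h3 : ∑ q ∈ Finset.Ico len len', branching I.k ^ (free I (entry I.k c' q)).card + 1 ≤
        branching I.k ^ (free I (entry I.k c x)).card := by
      rcases hf : (free I (entry I.k c x)).card with _ | f
      · have : len' ≤ len := by
          by_contra hlt
          have := hcard len (by omega) le_rfl
          omega
        rw [Finset.Ico_eq_empty (by omega)]
        simp
      · rw [Finset.sum_congr rfl fun q hq => by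
          rw [show (free I (entry I.k c' q)).card = f by
            have := hcard q (Finset.mem_Ico.1 hq).2 (Finset.mem_Ico.1 hq).1
            omega], Finset.sum_const, smul_eq_mul, Nat.card_Ico]
        -- At most `k + 1` targets, `k + 2` vertices on each path and `k` positions: one more than
        -- their product is still at most `(k + 2) ^ 3`.
        have h4 : len' - len + 1 ≤ branching I.k := by
          have := hG.len_le
          have h5 : (I.k + 1) * ((I.k + 2) * I.k) + 1 ≤ branching I.k := by
            rw [branching]; nlinarith
          omega
        have h5 : 1 ≤ branching I.k ^ f := Nat.one_le_pow _ _ (by simp [branching])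
        calc (len' - len) * branching I.k ^ f + 1 ≤ (len' - len + 1) * branching I.k ^ f := by
              rw [Nat.succ_mul]; omega
          _ ≤ branching I.k * branching I.k ^ f := Nat.mul_le_mul_right _ h4
          _ = branching I.k ^ (f + 1) := by rw [pow_succ']
    have h6 := hQ.pot
    rw [← Finset.sum_Ico_consecutive _ hx hll, h2]
    omega
  · rcases hbr.ans with h | h
    · rw [h]; exact hQ.ans
    · exact Or.inr h

end

theorem runs_step {x : ℕ} (hE : Env E σ) (h42 : σ.reg 42 = x)
    (hlt : x < branching I.k ^ I.k)
    (hQ : Queue I b x (σ.reg 17) (σ.reg 27) (σ.reg 29) (σ.reg 41) (σ.arr 14)) :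
    Runs (.step b) σ (processTime I.n E.m I.k + childrenTime I.k + 2) fun τ =>
      Queue I b (x + 1) (τ.reg 17) (τ.reg 27) (τ.reg 29) (τ.reg 41) (τ.arr 14) := by
  refine Runs.mono (T := (processTime I.n E.m I.k + childrenTime I.k + 1) + 1) (Runs.seq
    (Q := fun τ => Env E τ ∧
      Queue I b (x + 1) (τ.reg 17) (τ.reg 27 + I.k) (τ.reg 29) (τ.reg 41) (τ.arr 14))
    (Runs.ifLt (fun h => ?_) fun h => ?_) ?_) (by omega) fun _ h => h
  · rw [h42] at h
    have hcell : ∀ p < I.k, σ.arr 14 (σ.reg 27 + p) = entry I.k (σ.arr 14) x p := fun p _ => by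
      rw [hQ.base, entry]
    refine (runs_process b hE (hQ.partial_ x h) hcell).seq fun τ hτ ⟨hbr, hprot, hanc⟩ => ?_
    have hE := hE.frame hτ (by cases b <;> decide) (by cases b <;> decide)
    have r27 : τ.reg 27 = σ.reg 27 := hτ.1 27 (by cases b <;> decide)
    have r29 : τ.reg 29 = σ.reg 29 := hτ.1 29 (by cases b <;> decide)
    have r41 : τ.reg 41 = σ.reg 41 := hτ.1 41 (by cases b <;> decide)
    have a14 : τ.arr 14 = σ.arr 14 := hτ.2 14 (by cases b <;> decide)
    refine (runs_children hE ?_ (pl := entry I.k (σ.arr 14) x) (by rw [a14, r27]; exact hcell)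
      (by rw [r41, r29]; exact hQ.nb) hanc hbr.nt_le hbr.targ_lt).conseq fun υ hυ hG => ?_
    · rw [r27, r29, hQ.base, ← Nat.succ_mul]
      exact Nat.mul_le_mul_right _ h
    · rw [a14, r29] at hG
      have := hQ.succ h hbr hprot hG
      rw [hυ.1 17 (by decide), hυ.1 27 (by decide), r27]
      exact ⟨hE.frame hυ (by decide) (by decide), this⟩
  · rw [h42] at h
    refine Runs.ev rfl (by simp [Prog.size, childrenTime]; omega) ⟨hE, hQ.succ_of_le (by omega) hlt⟩
  · rintro τ - ⟨hE, hQ⟩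
    refine Runs.ev rfl (by decide) ?_
    simp only [Prog.ev, State.setReg_reg, State.setReg_arr, Nat.reduceEqDiff, if_true, if_false,
      hE.k]
    exact hQ

/-- The time bound for the search. -/
def searchTime (n m k : ℕ) : ℕ :=
  branching k ^ k * (processTime n m k + childrenTime k + 2 + 3) + 2

theorem runs_search (hE : Env E σ) (h43 : σ.reg 43 = branching I.k ^ I.k)
    (hQ : Queue I b 0 (σ.reg 17) (σ.reg 27) (σ.reg 29) (σ.reg 41) (σ.arr 14)) :
    Runs (.search b) σ (searchTime I.n E.m I.k) fun τ =>
      Queue I b (branching I.k ^ I.k) (τ.reg 17) (τ.reg 27) (τ.reg 29) (τ.reg 41) (τ.arr 14) := by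
  refine Runs.loop (fun x τ =>
    Queue I b x (τ.reg 17) (τ.reg 27) (τ.reg 29) (τ.reg 41) (τ.arr 14)) h43
    (by cases b <;> decide) (by cases b <;> decide) (by decide) ?_ ?_
  · simpa using hQ
  · intro x hx τ hτ hxτ hI
    have hE := hE.frame hτ (by cases b <;> decide) (by cases b <;> decide)
    exact (runs_step hE hxτ hx hI).mono le_rfl fun υ hυ => by simpa using hυ

end Firefighter

namespace Firefighter

/-! ### The program -/

namespace Prog

/-- Compute the indicator function of the critical set. -/
def markCrit : Prog :=
  const 7 1 ;; loop 25 3 (load 30 2 25 ;; store 3 30 7)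

def setup : Prog :=
  const 6 0 ;; add 8 4 7 ;; add 9 8 7 ;; add 10 0 0 ;; add 11 10 7 ;; add 13 1 1 ;; add 12 0 13 ;;
  add 14 13 13 ;; add 14 14 7 ;; add 14 14 7 ;; add 15 11 7 ;; add 16 0 7 ;; const 17 0 ;;
  const 27 0 ;; const 29 1 ;; add 41 4 6 ;; const 43 1

/-- Multiply the register `43` by `k + 2`. -/
def mul : Prog :=
  const 45 0 ;; loop 46 9 (add 45 45 43) ;; add 43 45 6

/-- Each factor `branching k` is a cube, hence three multiplications by `k + 2` in every round, each
of them by repeated addition. -/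
def power : Prog :=
  loop 44 4 (mul ;; mul ;; mul)

/-- There is no solution if one firefighter has to be placed, but no vertex is available. -/
def finish : Prog :=
  ifLt 6 4 (add 30 3 7 ;; ifLt 30 0 skip (const 17 0)) skip ;; add 0 17 6

def solve (b : Bool) : Prog :=
  markCrit ;; setup ;; power ;; search b ;; finish

end Prog

variable {I : Instance} {E : Encoding I} {σ : State} {b : Bool}

theorem runs_markCrit : Runs .markCrit E.init (1 + (I.C.card * 5 + 2)) fun τ =>
    τ.reg 7 = 1 ∧ ∀ v : Fin I.n, 0 < τ.arr 3 v ↔ v ∈ I.C := by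
  refine Runs.seq (T := 1) (Q := fun υ => υ = E.init.setReg 7 1)
    (.ev (by decide) (by decide) rfl) ?_
  rintro _ - rfl
  refine (Runs.loop (T := 2) (fun j τ => τ.reg 7 = 1 ∧
    ∀ v : Fin I.n, 0 < τ.arr 3 v ↔ ∃ i < j, E.cr i = v) (N := E.crit.length) (by simp [Encoding.init])
    (by decide) (by decide) (by decide) ?_ ?_).mono (by rw [E.crit_length]) ?_
  · simp [Encoding.init]
  · rintro j hj τ hτ hjτ ⟨h7, hI⟩
    have h2 : τ.arr 2 = E.cr := by
      rw [hτ.2 2 (by decide)]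
      simpa using E.init_arr_two
    refine Runs.ev (by decide) (by decide) ?_
    simp only [Prog.ev, State.setReg_reg, State.setReg_arr, State.setArr_arr, State.setArr_reg,
      Nat.reduceEqDiff, if_true, if_false, h7, h2, hjτ, true_and]
    intro v
    by_cases hv : (v : ℕ) = E.cr j
    · rw [hv, Function.update_self]
      simp only [Nat.one_pos, true_iff]
      exact ⟨j, by omega, rfl⟩
    · rw [Function.update_of_ne hv, hI]
      constructor
      · rintro ⟨i, hi, h⟩
        exact ⟨i, by omega, h⟩
      · rintro ⟨i, hi, h⟩
        rcases Nat.lt_succ_iff_lt_or_eq.1 hi with h' | rfl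
        · exact ⟨i, h', h⟩
        · exact absurd h.symm hv
  · rintro τ ⟨h7, hI⟩
    refine ⟨h7, fun v => (hI v).trans ⟨?_, fun h => E.exists_cr h⟩⟩
    rintro ⟨i, hi, h⟩
    obtain ⟨u, hu, h'⟩ := E.cr_lt hi
    rwa [show v = u from Fin.ext (by omega)]

theorem runs_setup (h : ∀ x < 5, σ.reg x = E.init.reg x) (h7 : σ.reg 7 = 1)
    (h0 : σ.arr 0 = E.init.arr 0) (h1 : σ.arr 1 = E.init.arr 1)
    (h3 : ∀ v : Fin I.n, 0 < σ.arr 3 v ↔ v ∈ I.C) :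
    Runs .setup σ 17 fun τ => Env E τ ∧ τ.reg 3 = I.C.card ∧ τ.reg 17 = 0 ∧ τ.reg 27 = 0 ∧
      τ.reg 29 = 1 ∧ τ.reg 41 = I.k ∧ τ.reg 43 = 1 := by
  have g0 : σ.reg 0 = I.n := h 0 (by decide)
  have g1 : σ.reg 1 = E.m := h 1 (by decide)
  have g2 : σ.reg 2 = I.s := h 2 (by decide)
  have g3 : σ.reg 3 = I.C.card := by rw [h 3 (by decide), ← E.crit_length]; rfl
  have g4 : σ.reg 4 = I.k := h 4 (by decide)
  refine Runs.ev (by decide) (by decide) ⟨?_, ?_⟩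
  · constructor
    case edge₁ => exact h0
    case edge₂ => exact h1
    case crit => exact h3
    all_goals simp [Prog.setup, Prog.ev, g0, g1, g2, g4, h7]
    all_goals omega
  · simp [Prog.setup, Prog.ev, g3, g4]

theorem runs_mul (hE : Env E σ) {y : ℕ} (h43 : σ.reg 43 = y) :
    Runs .mul σ (I.k * 4 + 12) fun τ => τ.reg 43 = (I.k + 2) * y := by
  refine Runs.mono (T := 1 + ((I.k + 2) * (1 + 3) + 2 + 1)) (Runs.seq (Q := fun υ =>
    υ = σ.setReg 45 0) (.ev (by decide) (by decide) rfl) ?_) (by omega) fun _ h => h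
  rintro _ hυ rfl
  have hE := hE.frame hυ (by decide) (by decide)
  refine (Runs.loop (T := 1) (fun j τ => τ.reg 45 = j * y) hE.k2 (by decide) (by decide) (by decide)
    (by simp) ?_).seq fun τ hτ h => ?_
  · intro j hj τ hτ hjτ hI
    have : τ.reg 43 = y := by rw [hτ.1 43 (by decide)]; simpa using h43
    refine Runs.ev (by decide) (by decide) ?_
    simp [Prog.ev, hI, this, Nat.succ_mul]
  · have hE := hE.frame hτ (by decide) (by decide)
    refine Runs.ev (by decide) (by decide) ?_
    simp [Prog.ev, h, hE.zero]

theorem runs_power (hE : Env E σ) (h43 : σ.reg 43 = 1) :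
    Runs .power σ (I.k * (I.k * 12 + 39) + 2) fun τ => τ.reg 43 = branching I.k ^ I.k := by
  refine (Runs.loop (T := I.k * 4 + 12 + (I.k * 4 + 12 + (I.k * 4 + 12)))
    (fun j τ => τ.reg 43 = branching I.k ^ j) hE.k (by decide) (by decide) (by decide)
    (by simpa using h43) ?_).mono (le_of_eq (by ring)) fun _ h => h
  intro j hj τ hτ hjτ hI
  have hE := hE.frame hτ (by decide) (by decide)
  refine (runs_mul hE hI).seq fun υ hυ h => ?_
  have hE := hE.frame hυ (by decide) (by decide)
  refine (runs_mul hE h).seq fun ω hω h => ?_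
  have hE := hE.frame hω (by decide) (by decide)
  refine (runs_mul hE h).mono le_rfl fun ρ h => ?_
  simp only [State.setReg_reg, Nat.reduceEqDiff, if_false, h, pow_succ, branching]
  ring

/-- The time bound for the whole program. -/
def solveTime (n m k : ℕ) : ℕ :=
  1 + (n * 5 + 2) + (17 + (k * (k * 12 + 39) + 2 + (searchTime n m k + 7)))

theorem runs_solve (E : Encoding I) (b : Bool) :
    Runs (.solve b) E.init (solveTime I.n E.m I.k) fun τ =>
      (τ.reg 0 = 1 ∧ ∃ h, Sol I b h) ∨ (τ.reg 0 = 0 ∧ ¬ ∃ h, Sol I b h) := by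
  have hC : I.C.card ≤ I.n := by simpa using Finset.card_le_univ I.C
  refine (runs_markCrit.mono (T' := 1 + (I.n * 5 + 2)) (by omega) fun _ h => h).seq
    fun σ₁ hσ₁ ⟨h7, h3⟩ => ?_
  refine (runs_setup (E := E) (fun x hx => hσ₁.1 x ?_) h7 (hσ₁.2 0 (by decide))
    (hσ₁.2 1 (by decide)) h3).seq fun σ₂ hσ₂ ⟨hE, g3, g17, g27, g29, g41, g43⟩ => ?_
  · revert x; decide
  refine (runs_power hE g43).seq fun σ₃ hσ₃ h43 => ?_
  have hE3 := hE.frame hσ₃ (by decide) (by decide)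
  have h14 : σ₃.arr 14 = fun _ => 0 := by
    rw [hσ₃.2 14 (by decide), hσ₂.2 14 (by decide), hσ₁.2 14 (by decide)]
    rfl
  refine (runs_search (b := b) hE3 h43 ?_).seq fun σ₄ hσ₄ hQ => ?_
  · rw [hσ₃.1 17 (by decide), hσ₃.1 27 (by decide), hσ₃.1 29 (by decide), hσ₃.1 41 (by decide),
      g17, g27, g29, g41]
    exact Queue.init fun p _ => by rw [h14]
  have hE4 := hE3.frame hσ₄ (by cases b <;> decide) (by cases b <;> decide)
  have r3 : σ₄.reg 3 = I.C.card := by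
    rw [hσ₄.1 3 (by cases b <;> decide), hσ₃.1 3 (by decide), g3]
  refine Runs.ev rfl (by decide) ?_
  simp only [Prog.finish, Prog.ev, State.ite_reg, State.setReg_reg, Nat.reduceEqDiff, if_true, if_false,
    hE4.zero, hE4.one, hE4.k, hE4.n, r3]
  -- The search asserts a solution only under the condition of sufficient room, which the last part
  -- of the program tests. Without room there is no solution.
  have hroom : (∃ h, Sol I b h) → I.k = 0 ∨ I.C.card + 2 ≤ I.n :=
    fun ⟨h, hs⟩ => room_of_saves hs.saves
  rcases hQ.correct with ⟨h0, h1⟩ | ⟨h0, h1⟩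
  · refine Or.inr ⟨?_, fun ⟨h, hs⟩ => h1 h hs⟩
    simp [h0, hE4.zero]
  · by_cases hr : I.k = 0 ∨ I.C.card + 2 ≤ I.n
    · refine Or.inl ⟨?_, h1 hr⟩
      rcases hr with hk | hr
      · simp [hk, h0, hE4.zero]
      · have : I.C.card + 1 < I.n := by omega
        simp [this, h0, hE4.zero]
    · refine Or.inr ⟨?_, fun h => hr (hroom h)⟩
      have hk : 0 < I.k := by omega
      have : ¬ I.C.card + 1 < I.n := by omega
      simp [this, hk, hE4.zero]

/-! ### The running time -/

/-- The searches cost a multiple of `m * m + n * m`, and `n ≥ 1` allows `m * m` to be absorbed by `n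
* (m * m)`. -/
theorem augTime_le {n m X : ℕ} (hX : n * (m + 1) ^ 2 = X) (hn : 0 < n) : augTime n m ≤ 500 * X := by
  have h1 : m * m ≤ n * (m * m) := Nat.le_mul_of_pos_left _ hn
  have h2 : m ≤ n * m := Nat.le_mul_of_pos_left _ hn
  have h3 : X = n * (m * m) + 2 * (n * m) + n := by rw [← hX]; ring
  have h4 : augTime n m = 60 * (n * m) + 120 * (m * m) + 38 * n + 152 * m + 65 := by
    rw [augTime]; ring
  omega

theorem untimedTime_le {n m X : ℕ} (k : ℕ) (hX : n * (m + 1) ^ 2 = X) (hn : 0 < n) :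
    untimedTime n m k ≤ 700 * ((k + 2) * X) := by
  have h2 : m ≤ n * m := Nat.le_mul_of_pos_left _ hn
  have h3 : X = n * (m * m) + 2 * (n * m) + n := by rw [← hX]; ring
  have h4 := Nat.mul_le_mul_left (k + 1) (Nat.add_le_add_right (augTime_le hX hn) 3)
  have h5 : (k + 1) * (500 * X + 3) ≤ 503 * ((k + 1) * X) := by
    have : (k + 1) * 3 ≤ 3 * ((k + 1) * X) := by
      rw [mul_comm]
      exact Nat.mul_le_mul_left _ (Nat.le_mul_of_pos_right _ (by omega))
    linarith
  have h6 : (k + 2) * X = (k + 1) * X + X := by ring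
  rw [untimedTime]
  omega

theorem processTime_le {n m X : ℕ} (k : ℕ) (hX : n * (m + 1) ^ 2 = X) (hn : 0 < n) :
    processTime n m k ≤ 1000 * ((k + 2) * X) := by
  have h2 : m ≤ n * m := Nat.le_mul_of_pos_left _ hn
  have h3 : X = n * (m * m) + 2 * (n * m) + n := by rw [← hX]; ring
  have h4 := untimedTime_le k hX hn
  have h5 : (k + 1) * (2 * m * 15 + 7) ≤ (k + 1) * (37 * X) :=
    Nat.mul_le_mul_left _ (by omega)
  have h6 : (k + 2) * X = (k + 1) * X + X := by ring
  have h7 : (k + 1) * (37 * X) = 37 * ((k + 1) * X) := by ring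
  have h8 : k + 1 ≤ (k + 1) * X := Nat.le_mul_of_pos_right _ (by omega)
  rw [processTime]
  omega

theorem solveTime_le {n m X : ℕ} (k : ℕ) (hX : n * (m + 1) ^ 2 = X) (hn : 0 < n) :
    solveTime n m k ≤ 2000 * ((k + 2) ^ (3 * k + 4) * X) := by
  have hX1 : 1 ≤ X := by
    rw [← hX]; exact Nat.mul_pos hn (by positivity)
  have hnX : n ≤ X := by
    rw [← hX]; exact Nat.le_mul_of_pos_right _ (by positivity)
  have h1 := processTime_le k hX hn
  have hP : branching k ^ k = (k + 2) ^ (3 * k) := by rw [branching, ← pow_mul]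
  have h2 : childrenTime k + 7 ≤ 50 * (k + 2) ^ 4 := by
    -- The inequality is witnessed by its slack, a polynomial with nonnegative coefficients.
    have : childrenTime k + 7 + (43 * k ^ 4 + 366 * k ^ 3 + 1137 * k ^ 2 + 1538 * k + 765) =
      50 * (k + 2) ^ 4 := by rw [childrenTime]; ring
    omega
  have h3 : (k + 2) ≤ (k + 2) ^ 4 := Nat.le_self_pow (by norm_num) _
  have h4 : processTime n m k + childrenTime k + 2 + 3 ≤ 1050 * ((k + 2) ^ 4 * X) := by
    have h5 : (k + 2) * X ≤ (k + 2) ^ 4 * X := Nat.mul_le_mul_right _ h3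
    have h6 : (k + 2) ^ 4 ≤ (k + 2) ^ 4 * X := Nat.le_mul_of_pos_right _ hX1
    omega
  have h5 := Nat.mul_le_mul_left ((k + 2) ^ (3 * k)) h4
  have h6 : (k + 2) ^ (3 * k) * (1050 * ((k + 2) ^ 4 * X)) =
      1050 * ((k + 2) ^ (3 * k + 4) * X) := by ring
  have h7 : (k + 2) ^ 4 ≤ (k + 2) ^ (3 * k + 4) := Nat.pow_le_pow_right (by omega) (by omega)
  have h8 : (k + 2) ^ 4 * X ≤ (k + 2) ^ (3 * k + 4) * X := Nat.mul_le_mul_right _ h7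
  have h9 : k * (k * 12 + 39) + 36 ≤ 12 * (k + 2) ^ 4 := by
    have : k * (k * 12 + 39) + 36 + (12 * k ^ 4 + 96 * k ^ 3 + 276 * k ^ 2 + 345 * k + 156) =
      12 * (k + 2) ^ 4 := by ring
    omega
  have h10 : (k + 2) ^ 4 ≤ (k + 2) ^ 4 * X := Nat.le_mul_of_pos_right _ hX1
  have h11 : X ≤ (k + 2) ^ 4 * X := Nat.le_mul_of_pos_left _ (by positivity)
  rw [solveTime, searchTime, hP]
  omega

/-- For `k ≥ 2` one has `k + 2 ≤ k ^ 2` and `2 * (3 * k + 4) ≤ 14 * k ^ 3`. The constant `2187 = 3 ^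
7` is the left-hand side for `k = 1`, and for `k = 0` the convention `0 ^ 0 = 1` enters. -/
theorem pow_le_pow_cube (k : ℕ) : (k + 2) ^ (3 * k + 4) ≤ 2187 * k ^ (14 * k ^ 3) := by
  rcases k with _ | _ | k
  · norm_num
  · norm_num
  · have h1 : k + 1 + 1 + 2 ≤ (k + 1 + 1) ^ 2 := by nlinarith
    have h2 : 2 * (3 * (k + 1 + 1) + 4) ≤ 14 * (k + 1 + 1) ^ 3 := by
      have := Nat.le_self_pow (n := 3) (by norm_num) (k + 1 + 1)
      omega
    calc (k + 1 + 1 + 2) ^ (3 * (k + 1 + 1) + 4)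
        ≤ ((k + 1 + 1) ^ 2) ^ (3 * (k + 1 + 1) + 4) := Nat.pow_le_pow_left h1 _
      _ = (k + 1 + 1) ^ (2 * (3 * (k + 1 + 1) + 4)) := by rw [pow_mul]
      _ ≤ (k + 1 + 1) ^ (14 * (k + 1 + 1) ^ 3) := Nat.pow_le_pow_right (by omega) h2
      _ ≤ 2187 * (k + 1 + 1) ^ (14 * (k + 1 + 1) ^ 3) := Nat.le_mul_of_pos_left _ (by norm_num)

theorem decidesWithin_solve (b : Bool) : DecidesWithin (.solve b) (fun I => ∃ h, Sol I b h)
    (fun I => I.k ^ (14 * I.k ^ 3) * (2000 * 2187 * (I.n * (I.m + 1) ^ 2))) := by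
  intro I E
  obtain ⟨τ, t, h1, h2, h3⟩ := runs_solve E b
  have hn : 0 < I.n := (Nat.zero_le _).trans_lt I.s.2
  refine ⟨τ, t, h1, h2.trans ((solveTime_le I.k rfl hn).trans ?_), fun h => ?_, fun h => ?_⟩
  · rw [E.m_eq]
    calc 2000 * ((I.k + 2) ^ (3 * I.k + 4) * (I.n * (I.m + 1) ^ 2))
        ≤ 2000 * (2187 * I.k ^ (14 * I.k ^ 3) * (I.n * (I.m + 1) ^ 2)) :=
          Nat.mul_le_mul_left _ (Nat.mul_le_mul_right _ (pow_le_pow_cube _))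
      _ = _ := by ring
  · rcases h3 with h3 | h3
    · exact h3.1
    · exact absurd h h3.2
  · rcases h3 with h3 | h3
    · exact absurd h3.2 h
    · exact h3.1

theorem DecidesWithin.isFPT {P : Instance → Prop} {p : Prog} {c A : ℕ}
    (h : DecidesWithin p P (fun I => I.k ^ (c * I.k ^ 3) * (A * (I.n * (I.m + 1) ^ 2)))) :
    IsFPT P := by
  have hpow : Primrec₂ ((· ^ ·) : ℕ → ℕ → ℕ) :=
    Primrec₂.unpaired'.1 Nat.Primrec.pow
  refine ⟨p, fun k => k ^ (c * k ^ 3) * A, 3, ?_, fun I E => ?_⟩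
  · exact (Primrec.nat_mul.comp (hpow.comp .id (Primrec.nat_mul.comp (.const c)
      (hpow.comp .id (.const 3)))) (.const A)).to_comp
  · obtain ⟨τ, t, h1, h2, h3⟩ := h I E
    refine ⟨τ, t, h1, h2.trans ?_, h3⟩
    have hn : 0 < I.n := (Nat.zero_le _).trans_lt I.s.2
    beta_reduce
    rw [← mul_assoc]
    refine Nat.mul_le_mul_left _ ?_
    -- The vertex `s` exists, so `n ≥ 1` and `m + 1 ≤ n + m`.
    calc I.n * (I.m + 1) ^ 2 ≤ (I.n + I.m) * (I.n + I.m) ^ 2 :=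
          Nat.mul_le_mul (by omega) (Nat.pow_le_pow_left (by omega) _)
      _ = (I.n + I.m) ^ 3 := by ring

theorem sacs_eq : SACS = fun I => ∃ h, Sol I true h := funext fun I => propext (sacs_iff I)

theorem sacsUntimed_eq : SACSUntimed = fun I => ∃ h, Sol I false h :=
  funext fun I => propext (sacsUntimed_iff I)

end Firefighter

theorem mainTheorem1 :
    (Firefighter.IsFPT Firefighter.SACS ∧
      ∃ (c A : ℕ) (p : Firefighter.Prog), Firefighter.DecidesWithin p Firefighter.SACS
        (fun I => I.k ^ (c * I.k ^ 3) * (A * (I.n * (I.m + 1) ^ 2)))) ∧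
    (Firefighter.IsFPT Firefighter.SACSUntimed ∧
      ∃ (c A : ℕ) (p : Firefighter.Prog), Firefighter.DecidesWithin p Firefighter.SACSUntimed
        (fun I => I.k ^ (c * I.k ^ 3) * (A * (I.n * (I.m + 1) ^ 2)))) := by
  rw [Firefighter.sacs_eq, Firefighter.sacsUntimed_eq]
  exact ⟨⟨(Firefighter.decidesWithin_solve true).isFPT, _, _, _,
      Firefighter.decidesWithin_solve true⟩,
    (Firefighter.decidesWithin_solve false).isFPT, _, _, _, Firefighter.decidesWithin_solve false⟩
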